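/- For real $c\ge 1$ let $T_c:\mathbb{R}^2\to\mathbb{R}^2$ be the affine bijection $T_c(x,y)=(cx+(c-1)y+1,\ (c+1)x+cy+1)$, let $P_k=T_c^k(0,0)$ for $k\in\mathbb{Z}$, let $Q_c^+$ be the convex hull of $\{P_k : k\in\mathbb{Z}\}$, and let $Q_c^-=-Q_c^+$. Let $S_c$ be the translation surface obtained from the disjoint union of $Q_c^+$ and $Q_c^-$ by identifying, for every $k\in\mathbb{Z}$, the edge $[P_k,P_{k+1}]$ of $Q_c^+$ with the edge $[-P_{k+1},-P_k]$ of $Q_c^-$ by the translation that carries $P_k$ to $-P_{k+1}$; it carries the path metric induced by the Euclidean metric on the two polygons. For $A\in GL(2,\mathbb{R})$ let $A(S_c)$ be the surface obtained by gluing $A(Q_c^+)$ and $A(Q_c^-)$ by the corresponding edge identifications. The Veech group $\Gamma(S_c)$ is the set of all $A\in GL(2,\mathbb{R})$ for which there is a direction preserving isometry from $A(S_c)$ onto $S_c$, that is, an isometry that is a translation in the local planar coordinates near every point that is not a vertex of the polygons. **Theorem (Veech groups).** For every real $c\ge1$, the set $\Gamma(S_c)$ is the subgroup of $GL(2,\mathbb{R})$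 generated by the involutions $-I$, $$A_c=\begin{pmatrix}-1&0\\0&1\end{pmatrix},\qquad B_c=\begin{pmatrix}-1&2\\0&1\end{pmatrix},\qquad C_c=\begin{pmatrix}-c&c-1\\-c-1&c\end{pmatrix}.$$ For $c=1$, $\Gamma(S_1)$ is the congruence two subgroup of $SL^{\pm}(2,\mathbb{Z})$, i.e. the group of integer matrices of determinant $\pm1$ that are congruent to $I$ modulo $2$; and $S_1$ has the lattice property: $\Gamma(S_1)$ is a lattice (a discrete subgroup of finite covolume) in $SL^{\pm}(2,\mathbb{R})$, the group of real $2\times2$ matrices of determinant $\pm1$. -/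

import Mathlib

open scoped ENNReal

noncomputable section

/-- The plane `ℝ²` with its Euclidean norm. -/
abbrev Plane : Type := EuclideanSpace ℝ (Fin 2)

/-- The action of `GL(2, ℝ)` on column vectors. -/
def linAct (A : GL (Fin 2) ℝ) : Plane →ₗ[ℝ] Plane :=
  Matrix.toEuclideanLin (A : Matrix (Fin 2) (Fin 2) ℝ)

/-- A presentation of a surface: convex regions of the plane, together with pairs of edges
identified by translations. For `k : Edge`, the edge `[a k, b k]` of the region `src k` is
identified with the edge `[a k + t k, b k + t k]` of the region `tgt k` by the translation by
`t k`. -/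
structure PolygonGluing where
  Piece : Type
  region : Piece → Set Plane
  Edge : Type
  src : Edge → Piece
  tgt : Edge → Piece
  a : Edge → Plane
  b : Edge → Plane
  t : Edge → Plane
  convex_region : ∀ i, Convex ℝ (region i)
  edge_src : ∀ k, segment ℝ (a k) (b k) ⊆ region (src k)
  edge_tgt : ∀ k, ∀ p ∈ segment ℝ (a k) (b k), p + t k ∈ region (tgt k)

namespace PolygonGluing

/-- The disjoint union of the regions. -/
def Pre (G : PolygonGluing) : Type := Σ i : G.Piece, {p : Plane // p ∈ G.region i}

/-- The edge identifications. -/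
inductive Glue (G : PolygonGluing) : G.Pre → G.Pre → Prop
  | edge (k : G.Edge) (p : Plane) (hp : p ∈ segment ℝ (G.a k) (G.b k)) :
      Glue G ⟨G.src k, p, G.edge_src k hp⟩ ⟨G.tgt k, p + G.t k, G.edge_tgt k p hp⟩

/-- The points of the surface: the disjoint union of the regions modulo the equivalence relation
generated by the edge identifications. -/
def Surface (G : PolygonGluing) : Type := Quot G.Glue

/-- The point of the surface represented by the point `p` of the region `i`. -/
def pt (G : PolygonGluing) (i : G.Piece) (p : Plane) (hp : p ∈ G.region i) : G.Surface :=
  Quot.mk _ ⟨i, p, hp⟩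

/-- The points of the surface that come from vertices of the polygons, i.e. from endpoints of
edges. -/
def vertices (G : PolygonGluing) : Set G.Surface :=
  {x | ∃ k : G.Edge, x = G.pt (G.src k) (G.a k) (G.edge_src k (left_mem_segment ℝ _ _)) ∨
    x = G.pt (G.src k) (G.b k) (G.edge_src k (right_mem_segment ℝ _ _))}

/-- `G.Seg x y v`: some region contains a straight segment running from `x` to `y` with
displacement vector `v`. -/
def Seg (G : PolygonGluing) (x y : G.Surface) (v : Plane) : Prop :=
  ∃ (i : G.Piece) (p q : Plane) (hp : p ∈ G.region i) (hq : q ∈ G.region i),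
    G.pt i p hp = x ∧ G.pt i q hq = y ∧ q - p = v

/-- `G.PolyPath x y L`: there is a path of length `L` from `x` to `y` that is a concatenation of
finitely many straight segments, each contained in one region. -/
inductive PolyPath (G : PolygonGluing) : G.Surface → G.Surface → ℝ → Prop
  | nil (x : G.Surface) : PolyPath G x x 0
  | cons {x y z : G.Surface} {v : Plane} {L : ℝ} :
      G.Seg x y v → PolyPath G y z L → PolyPath G x z (‖v‖ + L)

/-- The (intrinsic) distance on the surface induced by the Euclidean metric of the regions: the
infimum of the lengths of paths. -/
def pathDist (G : PolygonGluing) (x y : G.Surface) : ℝ≥0∞ :=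
  ⨅ (L : ℝ) (_ : G.PolyPath x y L), ENNReal.ofReal L

/-- A map preserves direction if, near every point that is not a vertex, it takes short straight
segments to straight segments with the same displacement vector (it is a translation in local
coordinates). -/
def DirectionPreserving (G H : PolygonGluing) (f : G.Surface → H.Surface) : Prop :=
  ∀ x : G.Surface, x ∉ G.vertices → ∃ ε : ℝ, 0 < ε ∧
    ∀ (y : G.Surface) (v : Plane), ‖v‖ < ε → G.Seg x y v → H.Seg (f x) (f y) v

/-- Two translation surfaces are the same if there is a direction preserving isometry from one
onto the other. -/
def Same (G H : PolygonGluing) : Prop :=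
  ∃ f : G.Surface ≃ H.Surface,
    (∀ x y, H.pathDist (f x) (f y) = G.pathDist x y) ∧ DirectionPreserving G H f

/-- The surface `A(S)`: the regions `A(P)` glued by the same edge identifications. -/
def transform (A : GL (Fin 2) ℝ) (G : PolygonGluing) : PolygonGluing where
  Piece := G.Piece
  region i := linAct A '' G.region i
  Edge := G.Edge
  src := G.src
  tgt := G.tgt
  a k := linAct A (G.a k)
  b k := linAct A (G.b k)
  t k := linAct A (G.t k)
  convex_region i := (G.convex_region i).linear_image _
  edge_src k := by
    have h := image_segment ℝ (linAct A).toAffineMap (G.a k) (G.b k)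
    simp only [LinearMap.coe_toAffineMap] at h
    rw [← h]
    exact Set.image_mono (G.edge_src k)
  edge_tgt k := by
    have h := image_segment ℝ (linAct A).toAffineMap (G.a k) (G.b k)
    simp only [LinearMap.coe_toAffineMap] at h
    rw [← h]
    rintro _ ⟨p, hp, rfl⟩
    exact ⟨p + G.t k, G.edge_tgt k p hp, map_add _ _ _⟩

/-- The Veech group `Γ(S) ⊆ GL(2, ℝ)`: all `A` such that `A(S)` and `S` are the same. -/
def veechGroup (G : PolygonGluing) : Set (GL (Fin 2) ℝ) :=
  {A | Same (transform A G) G}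

end PolygonGluing

/-- The affine map `T_c (x, y) = (c x + (c - 1) y + 1, (c + 1) x + c y + 1)`, a bijection of the
plane. -/
def affT (c : ℝ) : Equiv.Perm Plane where
  toFun p := !₂[c * p 0 + (c - 1) * p 1 + 1, (c + 1) * p 0 + c * p 1 + 1]
  invFun p := !₂[c * (p 0 - 1) - (c - 1) * (p 1 - 1), -(c + 1) * (p 0 - 1) + c * (p 1 - 1)]
  left_inv p := by
    ext i
    fin_cases i <;> simp <;> ring
  right_inv p := by
    ext i
    fin_cases i <;> simp <;> ring

/-- The points `T_c ^ k (0, 0)`, `k ∈ ℤ`. -/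
def vert (c : ℝ) (k : ℤ) : Plane := (affT c ^ k) 0

/-- The polygon `Q_c⁺`, the convex hull of the points `T_c ^ k (0, 0)`. -/
def polyQ (c : ℝ) : Set Plane := convexHull ℝ (Set.range (vert c))

/-- The translation surface `S_c` (for `c ≥ 1`). The region with index `true` is `Q_c⁺`, and the
region with index `false` is its image `Q_c⁻` under rotation by `π` about the origin. For each
`k ∈ ℤ` the edge `[P_k, P_{k+1}]` of `Q_c⁺` is identified with its image `[-P_{k+1}, -P_k]` in
`Q_c⁻` by translation. -/
def surfS (c : ℝ) : PolygonGluing where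
  Piece := Bool
  region i := if i then polyQ c else (fun p => -p) '' polyQ c
  Edge := ℤ
  src _ := true
  tgt _ := false
  a k := vert c k
  b k := vert c (k + 1)
  t k := -vert c k - vert c (k + 1)
  convex_region i := by
    cases i
    · simpa [polyQ] using (convex_convexHull ℝ (Set.range (vert c))).neg
    · simpa [polyQ] using convex_convexHull ℝ (Set.range (vert c))
  edge_src k := by
    simpa [polyQ] using (convex_convexHull ℝ (Set.range (vert c))).segment_subset
      (subset_convexHull ℝ _ ⟨k, rfl⟩) (subset_convexHull ℝ _ ⟨k + 1, rfl⟩)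
  edge_tgt k := by
    rintro _ ⟨u, v, hu, hv, huv, rfl⟩
    have h : v • vert c k + u • vert c (k + 1) ∈ polyQ c :=
      (convex_convexHull ℝ (Set.range (vert c)))
        (subset_convexHull ℝ _ ⟨k, rfl⟩) (subset_convexHull ℝ _ ⟨k + 1, rfl⟩) hv hu
        (by rw [add_comm]; exact huv)
    simp only [Bool.false_eq_true, if_false]
    refine ⟨_, h, ?_⟩
    obtain rfl : v = 1 - u := by linarith
    module

/-- The involution `A_c`. -/
def genA : GL (Fin 2) ℝ where
  val := !![-1, 0; 0, 1]
  inv := !![-1, 0; 0, 1]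
  val_inv := by ext i j; fin_cases i <;> fin_cases j <;> simp
  inv_val := by ext i j; fin_cases i <;> fin_cases j <;> simp

/-- The involution `B_c`. -/
def genB : GL (Fin 2) ℝ where
  val := !![-1, 2; 0, 1]
  inv := !![-1, 2; 0, 1]
  val_inv := by ext i j; fin_cases i <;> fin_cases j <;> simp
  inv_val := by ext i j; fin_cases i <;> fin_cases j <;> simp

/-- The involution `C_c`. -/
def genC (c : ℝ) : GL (Fin 2) ℝ where
  val := !![-c, c - 1; -c - 1, c]
  inv := !![-c, c - 1; -c - 1, c]
  val_inv := by ext i j; fin_cases i <;> fin_cases j <;> simp <;> ring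
  inv_val := by ext i j; fin_cases i <;> fin_cases j <;> simp <;> ring

/-- The congruence two subgroup of `SL^±(2, ℤ) = GL(2, ℤ)`: the integer matrices of determinant
`±1` that are congruent to the identity modulo `2`, regarded as a subgroup of `GL(2, ℝ)`. -/
def congruenceTwo : Subgroup (GL (Fin 2) ℝ) :=
  (Matrix.GeneralLinearGroup.map (n := Fin 2) (Int.castRingHom (ZMod 2))).ker.map
    (Matrix.GeneralLinearGroup.map (n := Fin 2) (Int.castRingHom ℝ))

/-- The group `SL^±(2, ℝ)` of real matrices of determinant `±1`. -/
def SLpm : Subgroup (GL (Fin 2) ℝ) where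
  carrier := {g | (g : Matrix (Fin 2) (Fin 2) ℝ).det = 1 ∨
    (g : Matrix (Fin 2) (Fin 2) ℝ).det = -1}
  one_mem' := by simp
  mul_mem' := by
    rintro g h (hg | hg) (hh | hh) <;> simp [hg, hh]
  inv_mem' := by
    rintro g (hg | hg) <;> simp [Matrix.det_nonsing_inv, hg]

/-- A lattice in a topological group: a discrete subgroup of finite covolume, that is, one that
has a fundamental domain of finite Haar measure. -/
def IsLatticeSubgroup {H : Type*} [Group H] [TopologicalSpace H] (Λ : Subgroup H) : Prop :=
  letI : MeasurableSpace H := borel H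
  DiscreteTopology Λ ∧ ∃ (μ : MeasureTheory.Measure H) (F : Set H),
    μ.IsHaarMeasure ∧ MeasureTheory.IsFundamentalDomain Λ F μ ∧ μ F < ∞

/-- The lattice property: the Veech group is (a subgroup of `SL^±(2, ℝ)` and) a lattice in
`SL^±(2, ℝ)`. -/
def HasLatticeProperty (G : PolygonGluing) : Prop :=
  ∃ Λ : Subgroup SLpm, G.veechGroup = (Λ.map SLpm.subtype : Set (GL (Fin 2) ℝ)) ∧
    IsLatticeSubgroup Λ

end

open scoped ENNReal

open PolygonGluing

/-! Write `vert c k` = (a_k, b_k) and m = 2c + 2.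

The generators belong to the Veech group because each is the derivative of an affine automorphism of
S_c. The matrix -I interchanges the two polygons. A_c and C_c are the linear parts of affine
symmetries of Q_c⁺ that reverse the order of the vertices. For B_c one uses b_{k+1} - b_k = a_{k+1}
+ a_k: the parts of the two polygons between consecutive vertex heights form a horizontal cylinder
whose circumference is twice its height, for every n. So a horizontal shear by 2 is a full twist of
all the cylinders at once (`exists_twist`), and A_c B_c is such a shear.

Conversely, let A belong to the Veech group. The isometry gives a bijection of S_c that is affine
with derivative A near every point that is not a vertex. It permutes the vertices, since these have
infinite cone angle (`not_mem_vertices_of_isometry`). Hence A preserves the set `closedHol` of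
holonomy vectors of closed geodesics, and also the set `primHol` (`veechGroup_subset_holStab`). It
remains to see that this stabilizer is generated by the involutions (`holStab_le_genGroup`). Three
facts about a closed holonomy vector (x, y) are used: (1) if y ≠ 0 then (c - 1)y² < (c + 1)x², since
a steeper geodesic escapes to infinity in Q_c⁺ (`closedHol_quadratic`); (2) |y| lies in a
well-ordered additive monoid whose least nonzero element is m (`abs_mem_heightMonoid`); (3) if y = 0
then |x| ≥ 2 (`two_le_of_mem_closedHol`). Shears by multiples of 2 achieve |x| ≤ |y|, and if |x| <
|y| then (1) makes C_c or C_c A_c lower |y|. By (2) this descent stops, so every closed holonomy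
vector is equivalent to a horizontal or a diagonal one. The shortest ones in these two directions
are (2, 0) and (m, m). They are inequivalent because only the second lies in `primHol`. A stabilizer
element can therefore be corrected by generators until it fixes (2, 0), and then, by the same
descent, until it fixes (m, m) too; then it is the identity.

For c = 1 a Euclidean algorithm on the first column identifies the group with the congruence two
subgroup (`genGroup_one`). Finite covolume follows from a Siegel set, which has finite Haar measure
by a scaling argument (`measure_siegelSet_lt_top`) and meets every SL(2, ℤ) orbit. -/

/-! ### Vertices, levels and supporting lines of the polygon Q_c⁺ -/

theorem vert_zero (c : ℝ) : vert c 0 = 0 := by simp [vert]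

theorem vert_succ (c : ℝ) (k : ℤ) : vert c (k + 1) = affT c (vert c k) := by
  unfold vert
  rw [add_comm, zpow_add, zpow_one, Equiv.Perm.mul_apply]

theorem vert_succ_fst (c : ℝ) (k : ℤ) :
    vert c (k + 1) 0 = c * vert c k 0 + (c - 1) * vert c k 1 + 1 := by
  rw [vert_succ]; simp [affT]

theorem vert_succ_snd (c : ℝ) (k : ℤ) :
    vert c (k + 1) 1 = (c + 1) * vert c k 0 + c * vert c k 1 + 1 := by
  rw [vert_succ]; simp [affT]

theorem vert_zero_apply (c : ℝ) (i : Fin 2) : vert c 0 i = 0 := by simp [vert_zero]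

/-- The vertices of `Q_c⁺` are symmetric with respect to the vertical axis. -/
theorem vert_neg (c : ℝ) (k : ℤ) : vert c (-k) 0 = -vert c k 0 ∧ vert c (-k) 1 = vert c k 1 := by
  have key : ∀ n : ℕ, vert c (-(n : ℤ)) 0 = -vert c n 0 ∧ vert c (-(n : ℤ)) 1 = vert c n 1 := by
    intro n
    induction n with
    | zero => simp [vert_zero]
    | succ n ih =>
      have h0 := vert_succ_fst c (-((n + 1 : ℕ) : ℤ))
      have h1 := vert_succ_snd c (-((n + 1 : ℕ) : ℤ))
      have e : -((n + 1 : ℕ) : ℤ) + 1 = -(n : ℤ) := by push_cast; ring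
      rw [e, ih.1] at h0
      rw [e, ih.2] at h1
      have g0 := vert_succ_fst c n
      have g1 := vert_succ_snd c n
      push_cast at *
      constructor
      · linear_combination -c * h0 + (c - 1) * h1 + g0
      · linear_combination (c + 1) * h0 - c * h1 - g1
  rcases Int.eq_nat_or_neg k with ⟨n, rfl | rfl⟩
  · exact key n
  · rw [neg_neg]
    exact ⟨by rw [(key n).1, neg_neg], (key n).2.symm⟩

theorem vert_neg_fst (c : ℝ) (k : ℤ) : vert c (-k) 0 = -vert c k 0 := (vert_neg c k).1

theorem vert_neg_snd (c : ℝ) (k : ℤ) : vert c (-k) 1 = vert c k 1 := (vert_neg c k).2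

/-- This identity makes every horizontal cylinder half as high as its circumference, so that one and
the same shear twists them all. -/
theorem vert_snd_sub (c : ℝ) (k : ℤ) :
    vert c (k + 1) 1 - vert c k 1 = vert c (k + 1) 0 + vert c k 0 := by
  rw [vert_succ_fst, vert_succ_snd]; ring

theorem vert_snd_nonneg {c : ℝ} (hc : 1 ≤ c) (k : ℤ) : 0 ≤ vert c k 1 := by
  have key : ∀ n : ℕ, 0 ≤ vert c n 0 ∧ 0 ≤ vert c n 1 := by
    intro n
    induction n with
    | zero => simp [vert_zero]
    | succ n ih =>
      have g0 := vert_succ_fst c n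
      have g1 := vert_succ_snd c n
      push_cast at *
      rw [g0, g1]
      have := ih.1; have := ih.2; have : 0 ≤ c - 1 := by linarith
      constructor <;> positivity
  rcases Int.eq_nat_or_neg k with ⟨n, rfl | rfl⟩
  · exact (key n).2
  · rw [vert_neg_snd]; exact (key n).2

theorem vert_fst_nonneg {c : ℝ} (hc : 1 ≤ c) (n : ℕ) : 0 ≤ vert c n 0 := by
  induction n with
  | zero => simp [vert_zero]
  | succ n ih =>
    have g0 := vert_succ_fst c n
    have h1 := vert_snd_nonneg hc n
    push_cast at *
    rw [g0]
    have : 0 ≤ c - 1 := by linarith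
    positivity

theorem vert_fst_step {c : ℝ} (hc : 1 ≤ c) (k : ℤ) : vert c k 0 + 1 ≤ vert c (k + 1) 0 := by
  have key : ∀ n : ℕ, vert c n 0 + 1 ≤ vert c (n + 1) 0 := by
    intro n
    rw [vert_succ_fst]
    have h0 := vert_fst_nonneg hc n
    have h1 := vert_snd_nonneg hc n
    nlinarith
  rcases le_or_gt 0 k with h | h
  · obtain ⟨n, rfl⟩ := Int.eq_ofNat_of_zero_le h
    exact key n
  · obtain ⟨n, hn⟩ := Int.eq_ofNat_of_zero_le (show 0 ≤ -k - 1 by omega)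
    obtain rfl : k = -((n : ℤ) + 1) := by omega
    have e : -((n : ℤ) + 1) + 1 = -n := by ring
    rw [e, vert_neg_fst, vert_neg_fst]
    linarith [key n]

theorem vert_fst_strictMono {c : ℝ} (hc : 1 ≤ c) : StrictMono fun k => vert c k 0 :=
  strictMono_int_of_lt_succ fun k => by linarith [vert_fst_step hc k]

theorem vert_snd_step {c : ℝ} (hc : 1 ≤ c) (n : ℕ) : vert c n 1 + 1 ≤ vert c (n + 1) 1 := by
  have h := vert_snd_sub c n
  have h0 := vert_fst_nonneg hc n
  have h1 := vert_fst_step hc n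
  linarith

theorem vert_snd_strictMono {c : ℝ} (hc : 1 ≤ c) : StrictMono fun n : ℕ => vert c n 1 :=
  strictMono_nat_of_lt_succ fun n => by
    have := vert_snd_step hc n
    push_cast at *
    linarith

theorem le_vert_snd {c : ℝ} (hc : 1 ≤ c) (n : ℕ) : (n : ℝ) ≤ vert c n 1 := by
  induction n with
  | zero => simp [vert_zero]
  | succ n ih =>
    have := vert_snd_step hc n
    push_cast at *
    linarith

/-- The edge vectors of `Q_c⁺` lie on a hyperbola. -/
theorem edge_quadratic (c : ℝ) (k : ℤ) :
    (c - 1) * (vert c (k + 1) 1 - vert c k 1) ^ 2 + 2 =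
      (c + 1) * (vert c (k + 1) 0 - vert c k 0) ^ 2 := by
  have step : ∀ k : ℤ, ((c - 1) * (vert c (k + 1) 1 - vert c k 1) ^ 2 + 2 =
      (c + 1) * (vert c (k + 1) 0 - vert c k 0) ^ 2) ↔
      ((c - 1) * (vert c (k + 1 + 1) 1 - vert c (k + 1) 1) ^ 2 + 2 =
      (c + 1) * (vert c (k + 1 + 1) 0 - vert c (k + 1) 0) ^ 2) := by
    intro k
    rw [vert_succ_fst c (k + 1), vert_succ_snd c (k + 1), vert_succ_fst c k, vert_succ_snd c k]
    constructor <;> intro h <;> linear_combination h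
  induction k using Int.induction_on with
  | zero =>
    rw [vert_succ_fst, vert_succ_snd]
    simp [vert_zero]
    ring
  | succ i ih => exact (step _).1 ih
  | pred i ih =>
    have := step (-(i : ℤ) - 1)
    rw [sub_add_cancel] at this
    rw [sub_add_cancel]
    exact this.2 ih

/-- The functional that vanishes on the line through the `k`-th edge of `Q_c⁺` and is nonnegative
on `Q_c⁺`. -/
def edgeFun (c : ℝ) (k : ℤ) (p : Plane) : ℝ :=
  (vert c (k + 1) 0 - vert c k 0) * (p 1 - vert c k 1) -
    (vert c (k + 1) 1 - vert c k 1) * (p 0 - vert c k 0)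

theorem edgeFun_zero_index (c : ℝ) (p : Plane) : edgeFun c 0 p = p 1 - p 0 := by
  unfold edgeFun
  rw [vert_succ_fst, vert_succ_snd, vert_zero_apply, vert_zero_apply]
  ring

/-- `edgeFun` is a determinant and the linear part of T_c has determinant 1. Thus every question
about the edge `k` reduces to the edge `0`, which lies on the line y = x. -/
theorem edgeFun_affT (c : ℝ) (k : ℤ) (p : Plane) :
    edgeFun c (k + 1) (affT c p) = edgeFun c k p := by
  unfold edgeFun
  rw [vert_succ_fst c (k + 1), vert_succ_snd c (k + 1), vert_succ_fst c k, vert_succ_snd c k]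
  simp [affT]
  ring

theorem edgeFun_vert_sub (c : ℝ) (k j : ℤ) :
    edgeFun c k (vert c j) = edgeFun c 0 (vert c (j - k)) := by
  have step : ∀ k j : ℤ, edgeFun c (k + 1) (vert c (j + 1)) = edgeFun c k (vert c j) := by
    intro k j
    rw [vert_succ, edgeFun_affT]
  induction k using Int.induction_on generalizing j with
  | zero => simp
  | succ i ih =>
    have := step i (j - 1)
    rw [sub_add_cancel] at this
    rw [this, ih]
    congr 2; ring
  | pred i ih =>
    have := step (-(i : ℤ) - 1) j
    rw [sub_add_cancel] at this
    rw [← this, ih]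
    congr 2; ring

theorem edgeFun_vert_left (c : ℝ) (k : ℤ) : edgeFun c k (vert c k) = 0 := by
  simp [edgeFun]

theorem edgeFun_vert_right (c : ℝ) (k : ℤ) : edgeFun c k (vert c (k + 1)) = 0 := by
  simp [edgeFun]; ring

/-- For the edge `0` the value is b_j - a_j. If j < 0 then a_j < 0 ≤ b_j; if j ≥ 2 the recursion
gives b_j - a_j = a_{j-1} + b_{j-1} > 0. -/
theorem edgeFun_vert_pos {c : ℝ} (hc : 1 ≤ c) {k j : ℤ} (h0 : j ≠ k) (h1 : j ≠ k + 1) :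
    0 < edgeFun c k (vert c j) := by
  rw [edgeFun_vert_sub, edgeFun_zero_index]
  rcases lt_or_ge (j - k) 0 with h | h
  · have := vert_fst_strictMono hc h
    have h2 := vert_snd_nonneg hc (j - k)
    simp only [vert_zero_apply] at this
    linarith
  · obtain ⟨n, hn⟩ := Int.eq_ofNat_of_zero_le (show 0 ≤ j - k - 2 by omega)
    have e : j - k = (((n : ℤ) + 1) + 1) := by omega
    have e2 : (0 : ℤ) < n + 1 := by positivity
    have h3 := vert_fst_strictMono hc e2
    have h4 := vert_snd_nonneg hc (n + 1)
    simp only [vert_zero_apply] at h3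
    rw [e, vert_succ_snd, vert_succ_fst c (n + 1)]
    linarith

theorem edgeFun_vert_nonneg {c : ℝ} (hc : 1 ≤ c) (k j : ℤ) : 0 ≤ edgeFun c k (vert c j) := by
  by_cases h0 : j = k
  · rw [h0, edgeFun_vert_left]
  · by_cases h1 : j = k + 1
    · rw [h1, edgeFun_vert_right]
    · exact (edgeFun_vert_pos hc h0 h1).le

theorem edgeFun_combo (c : ℝ) (k : ℤ) (p q : Plane) (u v : ℝ) (h : u + v = 1) :
    edgeFun c k (u • p + v • q) = u * edgeFun c k p + v * edgeFun c k q := by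
  obtain rfl : v = 1 - u := by linarith
  simp [edgeFun]
  ring

theorem edgeFun_add (c : ℝ) (k : ℤ) (p v : Plane) :
    edgeFun c k (p + v) = edgeFun c k p + ((vert c (k + 1) 0 - vert c k 0) * v 1 -
      (vert c (k + 1) 1 - vert c k 1) * v 0) := by
  simp [edgeFun]; ring

theorem continuous_edgeFun (c : ℝ) (k : ℤ) : Continuous (edgeFun c k) := by
  unfold edgeFun; fun_prop

theorem vert_mem_polyQ (c : ℝ) (k : ℤ) : vert c k ∈ polyQ c := subset_convexHull ℝ _ ⟨k, rfl⟩

theorem convex_polyQ (c : ℝ) : Convex ℝ (polyQ c) := convex_convexHull ℝ _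

theorem edgeFun_nonneg {c : ℝ} (hc : 1 ≤ c) (k : ℤ) {p : Plane} (hp : p ∈ polyQ c) :
    0 ≤ edgeFun c k p := by
  have hconv : Convex ℝ {p : Plane | 0 ≤ edgeFun c k p} := by
    intro p hp q hq u v hu hv huv
    simp only [Set.mem_ofPred_eq] at *
    rw [edgeFun_combo c k p q u v huv]
    positivity
  have := convexHull_min (s := Set.range (vert c)) (t := {p : Plane | 0 ≤ edgeFun c k p})
    (by rintro _ ⟨j, rfl⟩; exact edgeFun_vert_nonneg hc k j) hconv
  exact this hp

theorem snd_nonneg {c : ℝ} (hc : 1 ≤ c) {p : Plane} (hp : p ∈ polyQ c) : 0 ≤ p 1 := by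
  have h0 := edgeFun_nonneg hc 0 hp
  have h1 := edgeFun_nonneg hc (-1) hp
  rw [edgeFun_zero_index] at h0
  unfold edgeFun at h1
  rw [vert_neg_fst, vert_neg_snd, show (-1 : ℤ) + 1 = 0 by rfl, vert_zero_apply, vert_zero_apply,
    show vert c 1 0 = 1 by simpa [vert_zero] using vert_succ_fst c 0,
    show vert c 1 1 = 1 by simpa [vert_zero] using vert_succ_snd c 0] at h1
  linarith

/-- Each height `y ≥ 0` lies on a unique level `b_n ≤ y < b_{n+1}`. -/
theorem exists_level {c : ℝ} (hc : 1 ≤ c) {y : ℝ} (hy : 0 ≤ y) :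
    ∃ n : ℕ, vert c n 1 ≤ y ∧ y < vert c (n + 1) 1 := by
  have hex : ∃ n : ℕ, y < vert c n 1 := by
    obtain ⟨n, hn⟩ := exists_nat_gt y
    exact ⟨n, hn.trans_le (le_vert_snd hc n)⟩
  classical
  have hpos : Nat.find hex ≠ 0 := by
    intro h0
    have := Nat.find_spec hex
    rw [h0] at this
    simp [vert_zero] at this
    linarith
  obtain ⟨n, hn⟩ := Nat.exists_eq_succ_of_ne_zero hpos
  refine ⟨n, ?_, ?_⟩
  · have := Nat.find_min hex (m := n) (by omega)
    linarith
  · have := Nat.find_spec hex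
    rw [hn] at this
    exact_mod_cast this

theorem level_unique {c : ℝ} (hc : 1 ≤ c) {y : ℝ} {n m : ℕ} (h1 : vert c n 1 ≤ y)
    (h2 : y < vert c (n + 1) 1) (h3 : vert c m 1 ≤ y) (h4 : y < vert c (m + 1) 1) : n = m := by
  have a1 : vert c n 1 < vert c ((m + 1 : ℕ) : ℤ) 1 := by push_cast; linarith
  have a2 : vert c m 1 < vert c ((n + 1 : ℕ) : ℤ) 1 := by push_cast; linarith
  have b1 := (vert_snd_strictMono hc).lt_iff_lt.1 a1
  have b2 := (vert_snd_strictMono hc).lt_iff_lt.1 a2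
  omega

/-- A point between two levels that lies on the correct side of the two edges there belongs to
`Q_c⁺`. -/
theorem mem_polyQ_of_level {c : ℝ} (hc : 1 ≤ c) {p : Plane} (n : ℕ) (h1 : vert c n 1 ≤ p 1)
    (h2 : p 1 ≤ vert c (n + 1) 1) (hr : 0 ≤ edgeFun c n p) (hl : 0 ≤ edgeFun c (-n - 1) p) :
    p ∈ polyQ c := by
  have hb := vert_snd_step hc n
  have ha := vert_fst_step hc n
  have ha0 := vert_fst_nonneg hc n
  set t : ℝ := (p 1 - vert c n 1) / (vert c (n + 1) 1 - vert c n 1) with ht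
  have hd : 0 < vert c (n + 1) 1 - vert c n 1 := by linarith
  have ht0 : 0 ≤ t := div_nonneg (by linarith) hd.le
  have ht1 : t ≤ 1 := by rw [ht, div_le_one hd]; linarith
  have hty : t * (vert c (n + 1) 1 - vert c n 1) = p 1 - vert c n 1 := by
    rw [ht]; field_simp
  set X : ℝ := vert c n 0 + t * (vert c (n + 1) 0 - vert c n 0) with hX
  have hR : (1 - t) • vert c n + t • vert c (n + 1) ∈ polyQ c :=
    convex_polyQ c (vert_mem_polyQ c _) (vert_mem_polyQ c _) (by linarith) ht0 (by ring)
  have hL : (1 - t) • vert c (-n) + t • vert c (-(n + 1)) ∈ polyQ c :=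
    convex_polyQ c (vert_mem_polyQ c _) (vert_mem_polyQ c _) (by linarith) ht0 (by ring)
  have hXr : p 0 ≤ X := by
    unfold edgeFun at hr
    rw [← hty] at hr
    have : 0 ≤ (vert c (n + 1) 1 - vert c n 1) * (X - p 0) := by rw [hX]; linarith
    have := nonneg_of_mul_nonneg_right this hd
    linarith
  have hXl : -X ≤ p 0 := by
    unfold edgeFun at hl
    rw [show -(n : ℤ) - 1 + 1 = -n by ring, show -(n : ℤ) - 1 = -(n + 1) by ring,
      vert_neg_fst, vert_neg_fst, vert_neg_snd, vert_neg_snd] at hl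
    have e : p 1 = vert c n 1 + t * (vert c (n + 1) 1 - vert c n 1) := by linarith
    rw [e] at hl
    have : 0 ≤ (vert c (n + 1) 1 - vert c n 1) * (X + p 0) := by rw [hX]; linarith
    have := nonneg_of_mul_nonneg_right this hd
    linarith
  have hX0 : 0 ≤ X := by
    have : 0 ≤ t * (vert c (n + 1) 0 - vert c n 0) := mul_nonneg ht0 (by linarith)
    linarith
  -- The horizontal slice at this height runs from `-X` to `X`, and `s` is the position of `p` on
  -- it, counted from the right. If `X = 0` the slice is a single point.
  have main : ∃ s : ℝ, 0 ≤ s ∧ s ≤ 1 ∧ p 0 = (1 - 2 * s) * X := by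
    rcases hX0.eq_or_lt with h | h
    · exact ⟨0, le_rfl, zero_le_one, by rw [← h] at hXr hXl ⊢; linarith⟩
    · refine ⟨(X - p 0) / (2 * X), div_nonneg (by linarith) (by linarith), ?_, ?_⟩
      · rw [div_le_one (by linarith)]; linarith
      · field_simp; ring
  obtain ⟨s, hs0, hs1, hs⟩ := main
  have := convex_polyQ c hR hL (a := 1 - s) (b := s) (by linarith) hs0 (by ring)
  convert this using 1
  ext i
  fin_cases i
  · simp [-neg_add_rev, vert_neg_fst, hs, hX]
    ring
  · simp [-neg_add_rev, vert_neg_snd]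
    linear_combination -hty

/-- The part of `Q_c⁺` below the level `b_n` is cut out by finitely many edges. -/
theorem mem_polyQ_of_lt {c : ℝ} (hc : 1 ≤ c) {p : Plane} (n : ℕ) (h0 : 0 ≤ p 1)
    (hn : p 1 < vert c n 1) (h : ∀ j : ℤ, -n ≤ j → j < n → 0 ≤ edgeFun c j p) : p ∈ polyQ c := by
  obtain ⟨m, hm1, hm2⟩ := exists_level hc h0
  have hmn : m < n := (vert_snd_strictMono hc).lt_iff_lt.1 (hm1.trans_lt hn)
  exact mem_polyQ_of_level hc m hm1 hm2.le (h _ (by omega) (by omega)) (h _ (by omega) (by omega))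

theorem mem_polyQ_iff {c : ℝ} (hc : 1 ≤ c) {p : Plane} :
    p ∈ polyQ c ↔ ∀ k, 0 ≤ edgeFun c k p := by
  refine ⟨fun h k => edgeFun_nonneg hc k h, fun h => ?_⟩
  have h0 : 0 ≤ p 1 := by
    have h0 := h 0
    have h1 := h (-1)
    rw [edgeFun_zero_index] at h0
    unfold edgeFun at h1
    rw [vert_neg_fst, vert_neg_snd, show (-1 : ℤ) + 1 = 0 by rfl, vert_zero_apply, vert_zero_apply,
      show vert c 1 0 = 1 by simpa [vert_zero] using vert_succ_fst c 0,
      show vert c 1 1 = 1 by simpa [vert_zero] using vert_succ_snd c 0] at h1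
    linarith
  obtain ⟨m, hm1, hm2⟩ := exists_level hc h0
  exact mem_polyQ_of_level hc m hm1 hm2.le (h _) (h _)

/-- The vertices of `Q_c⁺`. -/
def IsVert (c : ℝ) (p : Plane) : Prop := ∃ k, p = vert c k

/-- The point reflection that exchanges the endpoints of the `k`-th edge. -/
def edgeFlip (c : ℝ) (k : ℤ) (p : Plane) : Plane := vert c k + vert c (k + 1) - p

theorem edgeFlip_edgeFlip (c : ℝ) (k : ℤ) (p : Plane) : edgeFlip c k (edgeFlip c k p) = p := by
  simp [edgeFlip]

theorem mem_segment_of_edgeFun_eq_zero {c : ℝ} (hc : 1 ≤ c) {k : ℤ} {p : Plane}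
    (hp : p ∈ polyQ c) (h : edgeFun c k p = 0) : p ∈ segment ℝ (vert c k) (vert c (k + 1)) := by
  have ha := vert_fst_step hc k
  set d := vert c (k + 1) 0 - vert c k 0 with hd
  have hd0 : 0 < d := by linarith
  set s := (p 0 - vert c k 0) / d with hs
  have hsd : s * d = p 0 - vert c k 0 := by rw [hs]; field_simp
  have hp' : p = (1 - s) • vert c k + s • vert c (k + 1) := by
    ext i
    fin_cases i
    · simp
      linear_combination -hsd
    · simp
      unfold edgeFun at h
      have : d * (p 1 - ((1 - s) * vert c k 1 + s * vert c (k + 1) 1)) = 0 := by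
        linear_combination h - (vert c (k + 1) 1 - vert c k 1) * hsd
      rcases mul_eq_zero.1 this with h' | h'
      · linarith
      · linarith
  -- The neighbouring edges confine the parameter: `edgeFun c (k - 1)` vanishes at P_k and is
  -- positive at P_{k+1}, while `edgeFun c (k + 1)` does the opposite.
  have h1 := edgeFun_nonneg hc (k - 1) hp
  have h2 := edgeFun_nonneg hc (k + 1) hp
  rw [hp', edgeFun_combo _ _ _ _ _ _ (by ring)] at h1 h2
  have e1 := edgeFun_vert_right c (k - 1)
  rw [sub_add_cancel] at e1
  rw [e1] at h1
  rw [edgeFun_vert_left] at h2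
  have p1 := edgeFun_vert_pos hc (k := k - 1) (j := k + 1) (by omega) (by omega)
  have p2 := edgeFun_vert_pos hc (k := k + 1) (j := k) (by omega) (by omega)
  have s0 : 0 ≤ s := by
    by_contra hneg
    have := mul_neg_of_neg_of_pos (not_le.1 hneg) p1
    linarith
  have s1 : 0 ≤ 1 - s := by
    by_contra hneg
    have := mul_neg_of_neg_of_pos (not_le.1 hneg) p2
    linarith
  exact ⟨1 - s, s, s1, s0, by ring, hp'.symm⟩

theorem edgeFun_eq_zero_of_mem_segment {c : ℝ} {k : ℤ} {p : Plane}
    (h : p ∈ segment ℝ (vert c k) (vert c (k + 1))) : edgeFun c k p = 0 := by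
  obtain ⟨u, v, -, -, huv, rfl⟩ := h
  rw [edgeFun_combo _ _ _ _ _ _ huv, edgeFun_vert_left, edgeFun_vert_right]
  ring

theorem segment_subset_polyQ (c : ℝ) (k : ℤ) :
    segment ℝ (vert c k) (vert c (k + 1)) ⊆ polyQ c :=
  (convex_polyQ c).segment_subset (vert_mem_polyQ c _) (vert_mem_polyQ c _)

/-- A nonnegative affine function that vanishes inside the edge `k` vanishes at both of its ends,
but `edgeFun c j` with j ≠ k vanishes at no more than one of them. -/
theorem isVert_of_two_edges {c : ℝ} (hc : 1 ≤ c) {j k : ℤ} (hjk : j ≠ k) {p : Plane}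
    (hp : p ∈ polyQ c) (hj : edgeFun c j p = 0) (hk : edgeFun c k p = 0) : IsVert c p := by
  obtain ⟨u, v, hu, hv, huv, rfl⟩ := mem_segment_of_edgeFun_eq_zero hc hp hk
  rw [edgeFun_combo _ _ _ _ _ _ huv] at hj
  have n1 := edgeFun_vert_nonneg hc j k
  have n2 := edgeFun_vert_nonneg hc j (k + 1)
  have m1 := mul_nonneg hu n1
  have m2 := mul_nonneg hv n2
  rcases hu.eq_or_lt with h | h
  · exact ⟨k + 1, by rw [← h]; simp [show v = 1 by linarith]⟩
  rcases hv.eq_or_lt with h' | h'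
  · exact ⟨k, by rw [← h']; simp [show u = 1 by linarith]⟩
  exfalso
  have z1 : edgeFun c j (vert c k) = 0 := by
    rcases mul_eq_zero.1 (show u * edgeFun c j (vert c k) = 0 by linarith) with h | h <;> linarith
  have z2 : edgeFun c j (vert c (k + 1)) = 0 := by
    rcases mul_eq_zero.1 (show v * edgeFun c j (vert c (k + 1)) = 0 by linarith) with h | h <;>
      linarith
  by_cases hjk' : k = j + 1
  · exact (edgeFun_vert_pos hc (k := j) (j := k + 1) (by omega) (by omega)).ne' z2
  · exact (edgeFun_vert_pos hc (k := j) (j := k) (by omega) (by omega)).ne' z1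

theorem edgeFlip_mem_segment {c : ℝ} {k : ℤ} {p : Plane}
    (h : p ∈ segment ℝ (vert c k) (vert c (k + 1))) :
    edgeFlip c k p ∈ segment ℝ (vert c k) (vert c (k + 1)) := by
  obtain ⟨u, v, hu, hv, huv, rfl⟩ := h
  refine ⟨v, u, hv, hu, by linarith, ?_⟩
  obtain rfl : v = 1 - u := by linarith
  unfold edgeFlip
  module

theorem vert_injective {c : ℝ} (hc : 1 ≤ c) : Function.Injective (vert c) := fun j k h =>
  (vert_fst_strictMono hc).injective (by simp [h])

theorem isVert_edgeFlip {c : ℝ} (hc : 1 ≤ c) {k : ℤ} {p : Plane} (h : edgeFun c k p = 0)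
    (hv : IsVert c p) : IsVert c (edgeFlip c k p) := by
  obtain ⟨j, rfl⟩ := hv
  by_cases h0 : j = k
  · exact ⟨k + 1, by rw [h0]; simp [edgeFlip]⟩
  · by_cases h1 : j = k + 1
    · exact ⟨k, by rw [h1]; simp [edgeFlip]⟩
    · exact absurd h (edgeFun_vert_pos hc h0 h1).ne'

theorem edgeFun_edgeFlip (c : ℝ) (k : ℤ) (p : Plane) :
    edgeFun c k (edgeFlip c k p) = -edgeFun c k p := by
  simp [edgeFun, edgeFlip]; ring

theorem edgeFlip_mem_polyQ {c : ℝ} (hc : 1 ≤ c) {k : ℤ} {p : Plane} (hp : p ∈ polyQ c)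
    (h : edgeFun c k p = 0) : edgeFlip c k p ∈ polyQ c :=
  segment_subset_polyQ c k (edgeFlip_mem_segment (mem_segment_of_edgeFun_eq_zero hc hp h))

/-! ### Points of S_c and their representatives -/

/-- The sign `1` for `Q_c⁺` and `-1` for `Q_c⁻`. -/
def sgn (i : Bool) : ℝ := if i then 1 else -1

@[simp] theorem sgn_true : sgn true = 1 := rfl

@[simp] theorem sgn_false : sgn false = -1 := rfl

theorem sgn_not (i : Bool) : sgn (!i) = -sgn i := by cases i <;> simp

theorem sgn_mul_self (i : Bool) : sgn i * sgn i = 1 := by cases i <;> simp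

theorem sgn_smul_smul (i : Bool) (p : Plane) : sgn i • sgn i • p = p := by
  rw [smul_smul, sgn_mul_self, one_smul]

theorem sgn_ne_zero (i : Bool) : sgn i ≠ 0 := by cases i <;> simp

theorem norm_sgn_smul (i : Bool) (p : Plane) : ‖sgn i • p‖ = ‖p‖ := by
  cases i <;> simp

theorem mem_region_iff (c : ℝ) (i : Bool) (p : Plane) :
    p ∈ (surfS c).region i ↔ sgn i • p ∈ polyQ c := by
  cases i
  · simp [surfS]
  · simp [surfS]

/-- `IsRep c x i q`: the point `x` of `S_c` is represented by the point `± q` of `Q_c^±`. -/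
def IsRep (c : ℝ) (x : (surfS c).Surface) (i : Bool) (q : Plane) : Prop :=
  ∃ h : sgn i • q ∈ (surfS c).region i, (surfS c).pt i (sgn i • q) h = x

theorem IsRep.mem {c : ℝ} {x : (surfS c).Surface} {i : Bool} {q : Plane} (h : IsRep c x i q) :
    q ∈ polyQ c := by
  have := (mem_region_iff c i _).1 h.1
  rwa [sgn_smul_smul] at this

theorem exists_rep_of_mem {c : ℝ} (i : Bool) {q : Plane} (hq : q ∈ polyQ c) :
    ∃ x, IsRep c x i q :=
  ⟨_, (mem_region_iff c i _).2 (by rwa [sgn_smul_smul]), rfl⟩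

theorem IsRep.unique {c : ℝ} {x y : (surfS c).Surface} {i : Bool} {q : Plane} (hx : IsRep c x i q)
    (hy : IsRep c y i q) : x = y := hx.2.symm.trans hy.2

theorem rep_pt {c : ℝ} (i : Bool) (p : Plane) (hp : p ∈ (surfS c).region i) :
    IsRep c ((surfS c).pt i p hp) i (sgn i • p) :=
  ⟨by rwa [sgn_smul_smul], by congr 1; exact sgn_smul_smul i p⟩

theorem exists_rep {c : ℝ} (x : (surfS c).Surface) : ∃ i q, IsRep c x i q := by
  obtain ⟨⟨i, p, hp⟩, rfl⟩ := Quot.exists_rep x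
  exact ⟨i, _, rep_pt i p hp⟩

/-- When the points of Q_c⁻ are written as -q with q in Q_c⁺, the gluing translation becomes the
reflection in the midpoint of the edge, the same map in both directions. -/
theorem IsRep.flip {c : ℝ} (hc : 1 ≤ c) {x : (surfS c).Surface} {i : Bool} {q : Plane} {k : ℤ}
    (h : IsRep c x i q) (hk : edgeFun c k q = 0) : IsRep c x (!i) (edgeFlip c k q) := by
  have hs := mem_segment_of_edgeFun_eq_zero hc h.mem hk
  obtain ⟨hq, rfl⟩ := h
  cases i
  · have g := Quot.sound (PolygonGluing.Glue.edge (G := surfS c) k (edgeFlip c k q)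
      (edgeFlip_mem_segment hs))
    refine ⟨(mem_region_iff c _ _).2 ?_, ?_⟩
    · rw [sgn_smul_smul]; exact segment_subset_polyQ c k (edgeFlip_mem_segment hs)
    · refine Eq.trans ?_ (g.trans ?_)
      · unfold PolygonGluing.pt
        congr 1
        simp [surfS]
        rfl
      · unfold PolygonGluing.pt
        congr 1
        congr 2
        simp [surfS, edgeFlip]
        abel
  · have g := Quot.sound (PolygonGluing.Glue.edge (G := surfS c) k q hs)
    refine ⟨(mem_region_iff c _ _).2 ?_, ?_⟩
    · rw [sgn_smul_smul]; exact segment_subset_polyQ c k (edgeFlip_mem_segment hs)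
    · refine Eq.trans ?_ (g.symm.trans ?_)
      · unfold PolygonGluing.pt
        congr 1
        congr 2
        simp [surfS, edgeFlip]
        abel
      · unfold PolygonGluing.pt
        congr 1
        simp [surfS]

/-- Two points of the disjoint union that represent the same point of `S_c`. -/
def SameRep (c : ℝ) (i : Bool) (q : Plane) (j : Bool) (r : Plane) : Prop :=
  (IsVert c q ∧ IsVert c r) ∨ (i = j ∧ q = r) ∨
    (j = !i ∧ ∃ k, edgeFun c k q = 0 ∧ r = edgeFlip c k q)

theorem SameRep.symm {c : ℝ} {i j : Bool} {q r : Plane}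
    (h : SameRep c i q j r) : SameRep c j r i q := by
  rcases h with h | ⟨rfl, rfl⟩ | ⟨rfl, k, hk, rfl⟩
  · exact Or.inl h.symm
  · exact Or.inr (Or.inl ⟨rfl, rfl⟩)
  · exact Or.inr (Or.inr ⟨by simp, k, by rw [edgeFun_edgeFlip, hk, neg_zero],
      (edgeFlip_edgeFlip c k q).symm⟩)

/-- `SameRep` relates all vertices to one another, which is coarser than the gluing. This makes
transitivity easy, as no corners have to be followed around a vertex, and it costs nothing where
only points off the vertices have to be told apart. -/
theorem SameRep.trans {c : ℝ} (hc : 1 ≤ c) {i j l : Bool} {q r s : Plane} (hr : r ∈ polyQ c)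
    (h : SameRep c i q j r) (h' : SameRep c j r l s) : SameRep c i q l s := by
  rcases h with h | ⟨rfl, rfl⟩ | ⟨rfl, k, hk, rfl⟩
  · rcases h' with h' | ⟨rfl, rfl⟩ | ⟨rfl, k', hk', rfl⟩
    · exact Or.inl ⟨h.1, h'.2⟩
    · exact Or.inl h
    · exact Or.inl ⟨h.1, isVert_edgeFlip hc hk' h.2⟩
  · exact h'
  · have hk0 : edgeFun c k (edgeFlip c k q) = 0 := by rw [edgeFun_edgeFlip, hk, neg_zero]
    have back : IsVert c (edgeFlip c k q) → IsVert c q := by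
      intro hv
      have := isVert_edgeFlip hc hk0 hv
      rwa [edgeFlip_edgeFlip] at this
    rcases h' with h' | ⟨rfl, rfl⟩ | ⟨rfl, k', hk', rfl⟩
    · exact Or.inl ⟨back h'.1, h'.2⟩
    · exact Or.inr (Or.inr ⟨rfl, k, hk, rfl⟩)
    · by_cases hkk : k = k'
      · subst hkk
        exact Or.inr (Or.inl ⟨by simp, (edgeFlip_edgeFlip c k q).symm⟩)
      · have hv := isVert_of_two_edges hc hkk hr hk0 hk'
        exact Or.inl ⟨back hv, isVert_edgeFlip hc hk' hv⟩

theorem IsRep.sameRep {c : ℝ} (hc : 1 ≤ c) {x : (surfS c).Surface} {i j : Bool} {q r : Plane}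
    (h : IsRep c x i q) (h' : IsRep c x j r) : SameRep c i q j r := by
  have key : ∀ a b : (surfS c).Pre, Relation.EqvGen (surfS c).Glue a b →
      SameRep c a.1 (sgn a.1 • a.2.1) b.1 (sgn b.1 • b.2.1) := by
    intro a b hab
    induction hab with
    | rel a b h =>
      cases h with
      | edge k p hp =>
        refine Or.inr (Or.inr ⟨rfl, k, ?_, ?_⟩)
        · have : edgeFun c k p = 0 := edgeFun_eq_zero_of_mem_segment hp
          simpa [surfS] using this
        · simp [surfS, edgeFlip]
          abel
    | refl a => exact Or.inr (Or.inl ⟨rfl, rfl⟩)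
    | symm a b _ ih => exact ih.symm
    | trans a b d _ _ ih1 ih2 => exact ih1.trans hc ((mem_region_iff c _ _).1 b.2.2) ih2
  have := key _ _ (Quot.eqvGen_exact (h.2.trans h'.2.symm))
  simpa only [sgn_smul_smul] using this

theorem mem_vertices_iff {c : ℝ} (hc : 1 ≤ c) {x : (surfS c).Surface} {i : Bool} {q : Plane}
    (h : IsRep c x i q) : x ∈ (surfS c).vertices ↔ IsVert c q := by
  constructor
  · rintro ⟨(k : ℤ), hk | hk⟩
    · have h1 : IsRep c x true (sgn true • vert c k) := by rw [hk]; exact rep_pt true _ _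
      rw [sgn_true, one_smul] at h1
      rcases h1.sameRep hc h with h | ⟨-, rfl⟩ | ⟨-, k', hk', rfl⟩
      · exact h.2
      · exact ⟨k, rfl⟩
      · exact isVert_edgeFlip hc hk' ⟨k, rfl⟩
    · have h1 : IsRep c x true (sgn true • vert c (k + 1)) := by rw [hk]; exact rep_pt true _ _
      rw [sgn_true, one_smul] at h1
      rcases h1.sameRep hc h with h | ⟨-, rfl⟩ | ⟨-, k', hk', rfl⟩
      · exact h.2
      · exact ⟨k + 1, rfl⟩
      · exact isVert_edgeFlip hc hk' ⟨k + 1, rfl⟩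
  · rintro ⟨k, rfl⟩
    cases i
    · have h1 := h.flip hc (edgeFun_vert_left c k)
      refine ⟨k, Or.inr ?_⟩
      refine h1.unique ?_
      have := rep_pt (c := c) true (vert c (k + 1)) ((surfS c).edge_src k (right_mem_segment ℝ _ _))
      rw [sgn_true, one_smul] at this
      have e : edgeFlip c k (vert c k) = vert c (k + 1) := by simp [edgeFlip]
      rw [e]
      exact this
    · refine ⟨k, Or.inl ?_⟩
      refine h.unique ?_
      have := rep_pt (c := c) true (vert c k) ((surfS c).edge_src k (left_mem_segment ℝ _ _))
      rw [sgn_true, one_smul] at this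
      exact this

theorem seg_iff {c : ℝ} {x y : (surfS c).Surface} {v : Plane} :
    (surfS c).Seg x y v ↔ ∃ i q r, IsRep c x i q ∧ IsRep c y i r ∧ v = sgn i • (r - q) := by
  constructor
  · rintro ⟨(i : Bool), p, q, hp, hq, rfl, rfl, rfl⟩
    exact ⟨i, _, _, rep_pt i p hp, rep_pt i q hq, by rw [smul_sub, sgn_smul_smul, sgn_smul_smul]⟩
  · rintro ⟨i, q, r, ⟨hq, rfl⟩, ⟨hr, rfl⟩, rfl⟩
    exact ⟨i, _, _, hq, hr, rfl, rfl, by rw [smul_sub]⟩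

/-! ### The Euclidean structure away from the vertices -/

open Filter Topology in
/-- Near a point `q` of `Q_c⁺`, the polygon is cut out by the edges through `q`. -/
theorem eventually_mem_polyQ {c : ℝ} (hc : 1 ≤ c) {q : Plane} (hq : q ∈ polyQ c) :
    ∀ᶠ p in 𝓝 q, (∀ k, edgeFun c k q = 0 → 0 ≤ edgeFun c k p) →
      p ∈ polyQ c ∧ ∀ j, edgeFun c j q ≠ 0 → 0 < edgeFun c j p := by
  obtain ⟨n, hn⟩ : ∃ n : ℕ, q 1 < vert c n 1 := by
    obtain ⟨n, hn⟩ := exists_nat_gt (q 1)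
    exact ⟨n, hn.trans_le (le_vert_snd hc n)⟩
  have hn0 : 0 < n := by
    rcases Nat.eq_zero_or_pos n with h | h
    · subst h
      have := snd_nonneg hc hq
      simp [vert_zero] at hn
      linarith
    · exact h
  have e1 : ∀ᶠ p in 𝓝 q, p 1 < vert c n 1 :=
    (show Continuous fun p : Plane => p 1 by fun_prop).continuousAt.eventually_lt
      continuousAt_const hn
  have e2 : ∀ᶠ p in 𝓝 q, ∀ j ∈ Finset.Ico (-n : ℤ) n, 0 < edgeFun c j q → 0 < edgeFun c j p := by
    rw [Filter.eventually_all_finset]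
    intro j _
    by_cases h : 0 < edgeFun c j q
    · filter_upwards [(continuous_edgeFun c j).continuousAt.eventually (lt_mem_nhds h)] with p hp _
      exact hp
    · exact Filter.Eventually.of_forall fun p h' => absurd h' h
  filter_upwards [e1, e2] with p h1 h2 h3
  have pos : ∀ j, edgeFun c j q ≠ 0 → 0 < edgeFun c j q := fun j hj =>
    lt_of_le_of_ne (edgeFun_nonneg hc j hq) hj.symm
  have nn : ∀ j : ℤ, -n ≤ j → j < n → 0 ≤ edgeFun c j p := by
    intro j hj hj'
    by_cases h : edgeFun c j q = 0
    · exact h3 j h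
    · exact (h2 j (Finset.mem_Ico.2 ⟨hj, hj'⟩) (pos j h)).le
  have hp0 : 0 ≤ p 1 := by
    have h0 := nn 0 (by omega) (by omega)
    have h1 := nn (-1) (by omega) (by omega)
    rw [edgeFun_zero_index] at h0
    unfold edgeFun at h1
    rw [vert_neg_fst, vert_neg_snd, show (-1 : ℤ) + 1 = 0 by rfl, vert_zero_apply, vert_zero_apply,
      show vert c 1 0 = 1 by simpa [vert_zero] using vert_succ_fst c 0,
      show vert c 1 1 = 1 by simpa [vert_zero] using vert_succ_snd c 0] at h1
    linarith
  have hp := mem_polyQ_of_lt hc n hp0 h1 nn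
  refine ⟨hp, fun j hj => ?_⟩
  by_cases hjn : -n ≤ j ∧ j < n
  · exact h2 j (Finset.mem_Ico.2 hjn) (pos j hj)
  · refine lt_of_le_of_ne (edgeFun_nonneg hc j hp) fun h0 => ?_
    have big : ∀ l : ℤ, (n : ℤ) ≤ |l| → vert c n 1 ≤ vert c l 1 := by
      intro l hl
      have : vert c l 1 = vert c (l.natAbs : ℕ) 1 := by
        rcases Int.natAbs_eq l with h | h
        · conv_lhs => rw [h]
        · conv_lhs => rw [h, vert_neg_snd]
      rw [this]
      rw [Int.abs_eq_natAbs] at hl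
      exact (vert_snd_strictMono hc).monotone (by exact_mod_cast hl)
    obtain ⟨u, v, hu, hv, huv, rfl⟩ := mem_segment_of_edgeFun_eq_zero hc hp h0.symm
    have b1 := big j (by rw [le_abs]; omega)
    have b2 := big (j + 1) (by rw [le_abs]; omega)
    simp at h1
    have e : vert c n 1 = u * vert c n 1 + v * vert c n 1 := by rw [← add_mul, huv, one_mul]
    linarith [mul_le_mul_of_nonneg_left b1 hu, mul_le_mul_of_nonneg_left b2 hv]

theorem IsRep.eq_or_flip {c : ℝ} (hc : 1 ≤ c) {x : (surfS c).Surface} (hx : x ∉ (surfS c).vertices)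
    {i j : Bool} {q r : Plane} (h : IsRep c x i q) (h' : IsRep c x j r) :
    (j = i ∧ r = q) ∨ (j = !i ∧ ∃ k, edgeFun c k q = 0 ∧ r = edgeFlip c k q) := by
  rcases h.sameRep hc h' with hv | ⟨h1, h2⟩ | h1
  · exact absurd ((mem_vertices_iff hc h).2 hv.1) hx
  · exact Or.inl ⟨h1.symm, h2.symm⟩
  · exact Or.inr h1

theorem IsRep.eq_of_interior {c : ℝ} (hc : 1 ≤ c) {x : (surfS c).Surface} {i j : Bool}
    {q r : Plane} (h : IsRep c x i q) (hq : ∀ k, edgeFun c k q ≠ 0) (h' : IsRep c x j r) :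
    j = i ∧ r = q := by
  rcases h.sameRep hc h' with ⟨⟨k, rfl⟩, -⟩ | ⟨h1, h2⟩ | ⟨-, k, hk, -⟩
  · exact absurd (edgeFun_vert_left c k) (hq k)
  · exact ⟨h1.symm, h2.symm⟩
  · exact absurd hk (hq k)

theorem IsVert.two_edges {c : ℝ} {p : Plane} (h : IsVert c p) :
    ∃ k, edgeFun c k p = 0 ∧ edgeFun c (k + 1) p = 0 := by
  obtain ⟨k, rfl⟩ := h
  refine ⟨k - 1, ?_, ?_⟩
  · have := edgeFun_vert_right c (k - 1)
    rwa [sub_add_cancel] at this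
  · rw [sub_add_cancel]; exact edgeFun_vert_left c k

theorem IsRep.seg {c : ℝ} {x y : (surfS c).Surface} {i : Bool} {q r : Plane} (h : IsRep c x i q)
    (h' : IsRep c y i r) : (surfS c).Seg x y (sgn i • (r - q)) :=
  seg_iff.2 ⟨i, q, r, h, h', rfl⟩

theorem seg_symm {c : ℝ} {x y : (surfS c).Surface} {v : Plane} (h : (surfS c).Seg x y v) :
    (surfS c).Seg y x (-v) := by
  obtain ⟨i, q, r, hq, hr, rfl⟩ := seg_iff.1 h
  convert hr.seg hq using 1
  rw [← smul_neg, neg_sub]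

/-- Off the vertices the only ambiguity is the choice between q and its flip across one edge.
Flipping changes the sign of the edge function, so if both pieces contain the segment, its end lies
on the edge too and the two ends are glued. -/
theorem seg_unique {c : ℝ} (hc : 1 ≤ c) {x y y' : (surfS c).Surface} {v : Plane}
    (hx : x ∉ (surfS c).vertices) (h : (surfS c).Seg x y v) (h' : (surfS c).Seg x y' v) :
    y = y' := by
  obtain ⟨i, q, r, hq, hr, rfl⟩ := seg_iff.1 h
  obtain ⟨j, q', r', hq', hr', hv⟩ := seg_iff.1 h'
  rcases hq.eq_or_flip hc hx hq' with ⟨rfl, rfl⟩ | ⟨rfl, k, hk, rfl⟩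
  · have : r = r' := by
      have := smul_right_injective Plane (sgn_ne_zero j) hv
      simpa using this
    subst this
    exact hr.unique hr'
  · have e : r' = edgeFlip c k r := by
      rw [sgn_not, neg_smul, ← smul_neg] at hv
      have := smul_right_injective Plane (sgn_ne_zero i) hv
      simp only [edgeFlip] at this ⊢
      rw [eq_comm, ← sub_eq_zero] at this ⊢
      rw [← this]
      abel
    have h1 := edgeFun_nonneg hc k hr.mem
    have h2 := edgeFun_nonneg hc k hr'.mem
    rw [e, edgeFun_edgeFlip] at h2
    have h3 := hr.flip hc (k := k) (by linarith)
    rw [← e] at h3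
    exact h3.unique hr'

/-- Every point that is not a vertex has a neighbourhood that is a Euclidean disc. -/
theorem exists_disc {c : ℝ} (hc : 1 ≤ c) {x : (surfS c).Surface} (hx : x ∉ (surfS c).vertices) :
    ∃ ρ : ℝ, 0 < ρ ∧ (∀ v, ‖v‖ < ρ → ∃ y, (surfS c).Seg x y v) ∧
      ∀ z z' u d, (surfS c).Seg x z u → (surfS c).Seg z z' d → ‖u‖ < ρ →
        (surfS c).Seg x z' (u + d) := by
  have loc : ∀ {i q}, IsRep c x i q → ∃ ρ > 0, ∀ p, ‖p - q‖ < ρ →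
      (∀ k, edgeFun c k q = 0 → 0 ≤ edgeFun c k p) →
      p ∈ polyQ c ∧ ∀ j, edgeFun c j q ≠ 0 → 0 < edgeFun c j p := by
    intro i q hq
    obtain ⟨ρ, h, h'⟩ := Metric.eventually_nhds_iff.1 (eventually_mem_polyQ hc hq.mem)
    exact ⟨ρ, h, fun p hp => h' (by rwa [dist_eq_norm])⟩
  obtain ⟨i, q, hq⟩ := exists_rep x
  -- One radius has to serve all representatives of `x`. There are at most two of them, because a
  -- point that is not a vertex lies on at most one edge.
  obtain ⟨ρ, hρ, hall⟩ : ∃ ρ > 0, ∀ j r, IsRep c x j r → ∀ p, ‖p - r‖ < ρ →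
      (∀ k, edgeFun c k r = 0 → 0 ≤ edgeFun c k p) →
      p ∈ polyQ c ∧ ∀ j, edgeFun c j r ≠ 0 → 0 < edgeFun c j p := by
    obtain ⟨ρ, hρ, h⟩ := loc hq
    by_cases hk : ∃ k, edgeFun c k q = 0
    · obtain ⟨k, hk⟩ := hk
      obtain ⟨ρ', hρ', h'⟩ := loc (hq.flip hc hk)
      refine ⟨min ρ ρ', lt_min hρ hρ', fun j r hr p hp => ?_⟩
      rcases hq.eq_or_flip hc hx hr with ⟨rfl, rfl⟩ | ⟨rfl, k', hk', rfl⟩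
      · exact h p (hp.trans_le (min_le_left _ _))
      · by_cases hkk : k = k'
        · subst hkk
          exact h' p (hp.trans_le (min_le_right _ _))
        · exact absurd ((mem_vertices_iff hc hq).2 (isVert_of_two_edges hc hkk hq.mem hk hk')) hx
    · refine ⟨ρ, hρ, fun j r hr p hp => ?_⟩
      rcases hq.eq_or_flip hc hx hr with ⟨rfl, rfl⟩ | ⟨rfl, k', hk', rfl⟩
      · exact h p hp
      · exact absurd ⟨k', hk'⟩ hk
  refine ⟨ρ, hρ, fun v hv => ?_, fun z z' u d hu hd hsmall => ?_⟩
  · have direct : ∀ j r, IsRep c x j r →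
        (∀ k, edgeFun c k r = 0 → 0 ≤ edgeFun c k (r + sgn j • v)) →
        ∃ y, (surfS c).Seg x y v := by
      intro j r hr h
      have := (hall j r hr (r + sgn j • v) (by simpa [norm_sgn_smul] using hv) h).1
      obtain ⟨y, hy⟩ := exists_rep_of_mem j this
      refine ⟨y, ?_⟩
      convert hr.seg hy using 1
      rw [add_sub_cancel_left, sgn_smul_smul]
    -- A vector that leaves one piece through the edge containing `x` points into the other piece
    -- after the flip.
    by_cases hgood : ∀ k, edgeFun c k q = 0 → 0 ≤ edgeFun c k (q + sgn i • v)
    · exact direct i q hq hgood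
    · push Not at hgood
      obtain ⟨k, hk, hk'⟩ := hgood
      refine direct _ _ (hq.flip hc hk) fun k' hk'' => ?_
      by_cases hkk : k = k'
      · subst hkk
        have e : edgeFlip c k q + sgn (!i) • v = edgeFlip c k (q + sgn i • v) := by
          rw [sgn_not]; simp only [edgeFlip, neg_smul]; abel
        rw [e, edgeFun_edgeFlip]
        linarith
      · have hf := edgeFlip_mem_polyQ hc hq.mem hk
        have hv := isVert_of_two_edges hc hkk hf (by rw [edgeFun_edgeFlip, hk, neg_zero]) hk''
        exact absurd ((mem_vertices_iff hc (hq.flip hc hk)).2 hv) hx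
  · obtain ⟨j, r, p, hr, hp, rfl⟩ := seg_iff.1 hu
    have hnear : ‖p - r‖ < ρ := by
      rwa [norm_sgn_smul] at hsmall
    have hpos := (hall j r hr p hnear fun k _ => edgeFun_nonneg hc k hp.mem).2
    -- Within the radius the only edges that can contain `p` are those through `r`. So a change of
    -- piece at `z` is already possible at `x`, and the flip can be applied to the whole
    -- displacement.
    have zero_of : ∀ k, edgeFun c k p = 0 → edgeFun c k r = 0 := fun k hk => by
      by_contra h
      exact (hpos k h).ne' hk
    have hz : z ∉ (surfS c).vertices := by
      intro hz
      obtain ⟨k, h1, h2⟩ := ((mem_vertices_iff hc hp).1 hz).two_edges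
      exact hx ((mem_vertices_iff hc hr).2
        (isVert_of_two_edges hc (by omega : k ≠ k + 1) hr.mem (zero_of _ h1) (zero_of _ h2)))
    obtain ⟨l, p', s, hp', hs, rfl⟩ := seg_iff.1 hd
    rcases hp.eq_or_flip hc hz hp' with ⟨rfl, rfl⟩ | ⟨rfl, k, hk, rfl⟩
    · convert hr.seg hs using 1
      rw [← smul_add]
      congr 1
      abel
    · convert (hr.flip hc (zero_of k hk)).seg hs using 1
      rw [sgn_not]
      simp only [neg_smul, ← smul_neg]
      rw [← smul_add]
      congr 1
      simp only [edgeFlip]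
      abel

/-- Points at a small distance from a point `x` that is not a vertex are joined to `x` by a short
segment. -/
theorem exists_seg_of_polyPath {c : ℝ} (hc : 1 ≤ c) {x : (surfS c).Surface}
    (hx : x ∉ (surfS c).vertices) :
    ∃ ρ : ℝ, 0 < ρ ∧ ∀ y L, (surfS c).PolyPath x y L → L < ρ →
      ∃ u, ‖u‖ ≤ L ∧ (surfS c).Seg x y u := by
  obtain ⟨ρ, hρ, -, h⟩ := exists_disc hc hx
  have nonneg : ∀ {z y L}, (surfS c).PolyPath z y L → 0 ≤ L := by
    intro z y L hL
    induction hL with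
    | nil => exact le_rfl
    | cons _ _ ih => positivity
  -- As long as the path stays in the disc, each further segment is absorbed into a single segment
  -- from `x` by adding displacements.
  have key : ∀ {z y L}, (surfS c).PolyPath z y L → ∀ u, (surfS c).Seg x z u → ‖u‖ + L < ρ →
      ∃ u', ‖u'‖ ≤ ‖u‖ + L ∧ (surfS c).Seg x y u' := by
    intro z y L hL
    induction hL with
    | nil z => exact fun u hu _ => ⟨u, by simp, hu⟩
    | @cons z z' y v L hseg hpath ih =>
      intro u hu hlt
      have hL0 := nonneg hpath
      have hv0 := norm_nonneg v
      obtain ⟨u', h1, h2⟩ := ih (u + v) (h z z' u v hu hseg (by linarith))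
        (by linarith [norm_add_le u v])
      exact ⟨u', by linarith [norm_add_le u v], h2⟩
  refine ⟨ρ, hρ, fun y L hL hlt => ?_⟩
  obtain ⟨i, q, hq⟩ := exists_rep x
  have h0 : (surfS c).Seg x x 0 := by simpa using hq.seg hq
  simpa using key hL 0 h0 (by simpa using hlt)

/-! ### Linear images of the surface and affine automorphisms -/

theorem linAct_mul (A B : GL (Fin 2) ℝ) (v : Plane) : linAct (A * B) v = linAct A (linAct B v) := by
  simp [linAct, Matrix.toEuclideanLin, Matrix.toLpLin_apply]

theorem linAct_one (v : Plane) : linAct 1 v = v := by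
  simp [linAct, Matrix.toEuclideanLin]

theorem linAct_inv_apply (A : GL (Fin 2) ℝ) (v : Plane) : linAct A⁻¹ (linAct A v) = v := by
  rw [← linAct_mul, inv_mul_cancel, linAct_one]

theorem linAct_apply_inv (A : GL (Fin 2) ℝ) (v : Plane) : linAct A (linAct A⁻¹ v) = v := by
  rw [← linAct_mul, mul_inv_cancel, linAct_one]

theorem linAct_fst (A : GL (Fin 2) ℝ) (v : Plane) :
    linAct A v 0 = A.1 0 0 * v 0 + A.1 0 1 * v 1 := by
  simp [linAct, Matrix.toEuclideanLin, Matrix.toLpLin_apply]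

theorem linAct_snd (A : GL (Fin 2) ℝ) (v : Plane) :
    linAct A v 1 = A.1 1 0 * v 0 + A.1 1 1 * v 1 := by
  simp [linAct, Matrix.toEuclideanLin, Matrix.toLpLin_apply]

noncomputable section

namespace PolygonGluing

/-- The canonical bijection from a surface onto its image under `A`. -/
def transformEquiv (A : GL (Fin 2) ℝ) (G : PolygonGluing) :
    G.Surface ≃ (transform A G).Surface where
  toFun := Quot.map (fun a => ⟨a.1, linAct A a.2.1, Set.mem_image_of_mem _ a.2.2⟩) (by
    rintro _ _ ⟨k, p, hp⟩
    have h := image_segment ℝ (linAct A).toAffineMap (G.a k) (G.b k)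
    simp only [LinearMap.coe_toAffineMap] at h
    refine (congrArg₂ (transform A G).Glue rfl ?_).mpr
      (Glue.edge (G := transform A G) k (linAct A p)
      (by rw [show segment ℝ ((transform A G).a k) ((transform A G).b k) =
            segment ℝ (linAct A (G.a k)) (linAct A (G.b k)) from rfl, ← h]
          exact Set.mem_image_of_mem _ hp))
    exact Sigma.ext rfl (heq_of_eq (Subtype.ext (map_add (linAct A) p (G.t k)))))
  invFun := Quot.map (fun a => ⟨a.1, linAct A⁻¹ a.2.1, by
      obtain ⟨p, hp, h⟩ := a.2.2
      rw [← h, linAct_inv_apply]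
      exact hp⟩) (by
    rintro _ _ ⟨k, p, hp⟩
    have h := image_segment ℝ (linAct A).toAffineMap (G.a k) (G.b k)
    simp only [LinearMap.coe_toAffineMap] at h
    rw [show segment ℝ ((transform A G).a k) ((transform A G).b k) =
            segment ℝ (linAct A (G.a k)) (linAct A (G.b k)) from rfl, ← h] at hp
    obtain ⟨q, hq, rfl⟩ := hp
    refine (congrArg₂ G.Glue ?_ ?_).mpr (Glue.edge (G := G) k q hq)
    · exact Sigma.ext rfl (heq_of_eq (Subtype.ext (linAct_inv_apply A q)))
    · refine Sigma.ext rfl (heq_of_eq (Subtype.ext ?_))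
      change linAct A⁻¹ (linAct A q + linAct A (G.t k)) = q + G.t k
      rw [← map_add, linAct_inv_apply])
  left_inv := by
    rintro ⟨i, p, hp⟩
    simp only [Quot.map]
    congr 3
    exact linAct_inv_apply A p
  right_inv := by
    rintro ⟨i, p, hp⟩
    simp only [Quot.map]
    congr 3
    exact linAct_apply_inv A p

theorem transform_seg_iff {A : GL (Fin 2) ℝ} {G : PolygonGluing} {x y : G.Surface} {v : Plane} :
    (transform A G).Seg (transformEquiv A G x) (transformEquiv A G y) (linAct A v) ↔
      G.Seg x y v := by
  constructor
  · rintro ⟨i, _, _, ⟨p, hp, rfl⟩, ⟨q, hq, rfl⟩, h1, h2, h3⟩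
    refine ⟨i, p, q, hp, hq, (transformEquiv A G).injective h1, (transformEquiv A G).injective h2,
      ?_⟩
    rw [← map_sub] at h3
    rw [← linAct_inv_apply A (q - p), h3, linAct_inv_apply]
  · rintro ⟨i, p, q, hp, hq, rfl, rfl, rfl⟩
    exact ⟨i, _, _, Set.mem_image_of_mem _ hp, Set.mem_image_of_mem _ hq, rfl, rfl,
      (map_sub _ _ _).symm⟩

theorem transform_mem_vertices {A : GL (Fin 2) ℝ} {G : PolygonGluing} {x : G.Surface} :
    transformEquiv A G x ∈ (transform A G).vertices ↔ x ∈ G.vertices := by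
  constructor
  · rintro ⟨k, h | h⟩
    · exact ⟨k, Or.inl ((transformEquiv A G).injective h)⟩
    · exact ⟨k, Or.inr ((transformEquiv A G).injective h)⟩
  · rintro ⟨k, h | h⟩
    · exact ⟨k, Or.inl (congrArg (transformEquiv A G) h)⟩
    · exact ⟨k, Or.inr (congrArg (transformEquiv A G) h)⟩

theorem PolyPath.append {G : PolygonGluing} {x y z : G.Surface} {L L' : ℝ}
    (h : G.PolyPath x y L) (h' : G.PolyPath y z L') : G.PolyPath x z (L + L') := by
  induction h with
  | nil => simpa using h'
  | cons hs _ ih => rw [add_assoc]; exact .cons hs (ih h')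

/-- `G.StraightPath u x y L`: a path from `x` to `y` that consists of consecutive segments in the
direction of `u`, with total displacement `L • u`. -/
inductive StraightPath (G : PolygonGluing) (u : Plane) : G.Surface → G.Surface → ℝ → Prop
  | nil (x : G.Surface) : StraightPath G u x x 0
  | cons {x y z : G.Surface} {s L : ℝ} :
      0 ≤ s → G.Seg x y (s • u) → StraightPath G u y z L → StraightPath G u x z (s + L)

theorem StraightPath.nonneg {G : PolygonGluing} {u : Plane} {x y : G.Surface} {L : ℝ}
    (h : G.StraightPath u x y L) : 0 ≤ L := by
  induction h with
  | nil => exact le_rfl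
  | cons hs _ _ ih => positivity

theorem StraightPath.append {G : PolygonGluing} {u : Plane} {x y z : G.Surface} {L L' : ℝ}
    (h : G.StraightPath u x y L) (h' : G.StraightPath u y z L') :
    G.StraightPath u x z (L + L') := by
  induction h with
  | nil => simpa using h'
  | cons hs hseg _ ih => rw [add_assoc]; exact .cons hs hseg (ih h')

theorem StraightPath.single {G : PolygonGluing} {u : Plane} {x y : G.Surface} {s : ℝ}
    (hs : 0 ≤ s) (h : G.Seg x y (s • u)) : G.StraightPath u x y s := by
  simpa using StraightPath.cons hs h (.nil y)

theorem StraightPath.rescale {G : PolygonGluing} {u w : Plane} {x y : G.Surface} {s L : ℝ}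
    (hs : 0 ≤ s) (h : G.StraightPath w x y L) (hw : w = s • u) : G.StraightPath u x y (L * s) := by
  induction h with
  | nil => simpa using StraightPath.nil _
  | @cons x y z r L hr hseg _ ih =>
    rw [add_mul]
    refine .cons (by positivity) ?_ ih
    rwa [mul_smul, ← hw]

/-- A map that takes segments to straight paths according to the linear map `A`, and preserves
vertices. -/
def IsAffine (G : PolygonGluing) (A : GL (Fin 2) ℝ) (F : G.Surface → G.Surface) : Prop :=
  (∀ x, F x ∈ G.vertices ↔ x ∈ G.vertices) ∧
    ∀ x y v, G.Seg x y v → G.StraightPath (linAct A v) (F x) (F y) 1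

theorem IsAffine.straightPath {G : PolygonGluing} {A : GL (Fin 2) ℝ} {F : G.Surface → G.Surface}
    (hF : G.IsAffine A F) {u : Plane} {x y : G.Surface} {L : ℝ} (h : G.StraightPath u x y L) :
    G.StraightPath (linAct A u) (F x) (F y) L := by
  induction h with
  | nil => exact .nil _
  | @cons x y z s L hs hseg _ ih =>
    have := (hF.2 _ _ _ hseg).rescale hs (map_smul _ _ _)
    rw [one_mul] at this
    exact this.append ih

theorem IsAffine.comp {G : PolygonGluing} {A B : GL (Fin 2) ℝ} {F F' : G.Surface → G.Surface}
    (hF : G.IsAffine A F) (hF' : G.IsAffine B F') : G.IsAffine (A * B) (F ∘ F') :=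
  ⟨fun x => (hF.1 _).trans (hF'.1 x), fun x y v h => by
    rw [linAct_mul]
    exact hF.straightPath (hF'.2 x y v h)⟩

theorem isAffine_one (G : PolygonGluing) : G.IsAffine 1 id :=
  ⟨fun _ => Iff.rfl, fun x y v h => .single zero_le_one (by rwa [one_smul, linAct_one])⟩

/-- The derivatives of the affine automorphisms of a surface. -/
def affGroup (G : PolygonGluing) : Subgroup (GL (Fin 2) ℝ) where
  carrier := {A | ∃ F : G.Surface ≃ G.Surface, G.IsAffine A F ∧ G.IsAffine A⁻¹ F.symm}
  one_mem' := ⟨Equiv.refl _, G.isAffine_one, by rw [inv_one]; exact G.isAffine_one⟩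
  mul_mem' := by
    rintro A B ⟨F, hF, hF'⟩ ⟨F₁, hF₁, hF₁'⟩
    exact ⟨F₁.trans F, hF.comp hF₁, by rw [mul_inv_rev]; exact hF₁'.comp hF'⟩
  inv_mem' := by
    rintro A ⟨F, hF, hF'⟩
    exact ⟨F.symm, hF', by rw [inv_inv]; exact hF⟩

end PolygonGluing

end

/-- In a disc around `x` consecutive parallel pieces merge into one segment. This turns the straight
paths of `IsAffine` into the single segments that `DirectionPreserving` asks for. -/
theorem seg_of_straightPath {c : ℝ} {x z y : (surfS c).Surface}
    {ρ : ℝ} (hρ : ∀ z z' u d, (surfS c).Seg x z u → (surfS c).Seg z z' d → ‖u‖ < ρ →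
        (surfS c).Seg x z' (u + d)) {v : Plane} (hv : ‖v‖ < ρ) {L : ℝ}
    (h : (surfS c).StraightPath v z y L) :
    ∀ s : ℝ, 0 ≤ s → s + L ≤ 1 → (surfS c).Seg x z (s • v) → (surfS c).Seg x y ((s + L) • v) := by
  induction h with
  | nil => intro s _ _ hs; simpa using hs
  | @cons z z' y r L hr hseg hpath ih =>
    intro s hs hle h
    have hL := hpath.nonneg
    have h1 : ‖s • v‖ < ρ := by
      rw [norm_smul, Real.norm_of_nonneg hs]
      have : s * ‖v‖ ≤ 1 * ‖v‖ := mul_le_mul_of_nonneg_right (by linarith) (norm_nonneg v)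
      linarith
    have h2 := hρ _ _ _ _ h hseg h1
    rw [← add_smul] at h2
    have := ih (s + r) (by positivity) (by linarith) h2
    rwa [add_assoc] at this

/-- The isometry is `F` after the inverse of the canonical bijection from S onto A(S). The linear
parts `A` and `A⁻¹` cancel, so polygonal paths keep their lengths in both directions. -/
theorem affGroup_le_veechGroup {c : ℝ} (hc : 1 ≤ c) :
    ((surfS c).affGroup : Set (GL (Fin 2) ℝ)) ⊆ (surfS c).veechGroup := by
  rintro A ⟨F, hF, hF'⟩
  set φ := transformEquiv A (surfS c) with hφ
  have key1 : ∀ {x y : (surfS c).Surface} {L : ℝ}, (surfS c).PolyPath x y L →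
      (transform A (surfS c)).PolyPath (φ (F.symm x)) (φ (F.symm y)) L := by
    have aux : ∀ {w : Plane} {x y : (surfS c).Surface} {L : ℝ},
        (surfS c).StraightPath (linAct A⁻¹ w) x y L →
        (transform A (surfS c)).PolyPath (φ x) (φ y) (L * ‖w‖) := by
      intro w x y L h
      induction h with
      | nil => simpa using PolyPath.nil _
      | @cons x y z s L hs hseg _ ih =>
        have h1 := transform_seg_iff (A := A).2 hseg
        rw [map_smul, linAct_apply_inv] at h1
        have := PolyPath.cons h1 ih
        rwa [norm_smul, Real.norm_of_nonneg hs, ← add_mul] at this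
    intro x y L h
    induction h with
    | nil => exact .nil _
    | @cons x y z v L hseg _ ih =>
      have := aux (hF'.2 _ _ _ hseg)
      rw [one_mul] at this
      exact this.append ih
  have key2 : ∀ {x y : (transform A (surfS c)).Surface} {L : ℝ},
      (transform A (surfS c)).PolyPath x y L →
      (surfS c).PolyPath (F (φ.symm x)) (F (φ.symm y)) L := by
    have aux : ∀ {w : Plane} {x y : (surfS c).Surface} {L : ℝ},
        (surfS c).StraightPath w x y L → (surfS c).PolyPath x y (L * ‖w‖) := by
      intro w x y L h
      induction h with
      | nil => simpa using PolyPath.nil _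
      | @cons x y z s L hs hseg _ ih =>
        have := PolyPath.cons hseg ih
        rwa [norm_smul, Real.norm_of_nonneg hs, ← add_mul] at this
    intro x y L h
    induction h with
    | nil => exact .nil _
    | @cons x y z v L hseg _ ih =>
      have h1 : (surfS c).Seg (φ.symm x) (φ.symm y) (linAct A⁻¹ v) := by
        rw [← transform_seg_iff (A := A), linAct_apply_inv, ← hφ, φ.apply_symm_apply,
          φ.apply_symm_apply]
        exact hseg
      have := aux (hF.2 _ _ _ h1)
      rw [one_mul, linAct_apply_inv] at this
      exact this.append ih
  refine ⟨φ.symm.trans F, fun x y => ?_, fun x hx => ?_⟩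
  · unfold pathDist
    refine iInf_congr fun L => iInf_congr_Prop ⟨fun h => ?_, key2⟩ fun _ => rfl
    rw [Equiv.trans_apply, Equiv.trans_apply] at h
    have := key1 h
    rwa [F.symm_apply_apply, F.symm_apply_apply, φ.apply_symm_apply, φ.apply_symm_apply] at this
  · have hx' : F (φ.symm x) ∉ (surfS c).vertices := by
      rw [hF.1, ← transform_mem_vertices (A := A), ← hφ, φ.apply_symm_apply]
      exact hx
    obtain ⟨ρ, hρ, -, h⟩ := exists_disc hc hx'
    refine ⟨ρ, hρ, fun y v hv hseg => ?_⟩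
    have h1 : (surfS c).Seg (φ.symm x) (φ.symm y) (linAct A⁻¹ v) := by
      rw [← transform_seg_iff (A := A), linAct_apply_inv, ← hφ, φ.apply_symm_apply,
        φ.apply_symm_apply]
      exact hseg
    have h2 := hF.2 _ _ _ h1
    rw [linAct_apply_inv] at h2
    obtain ⟨i, q, hq⟩ := exists_rep (F (φ.symm x))
    have h0 : (surfS c).Seg (F (φ.symm x)) (F (φ.symm x)) ((0 : ℝ) • v) := by
      simpa using hq.seg hq
    simpa using seg_of_straightPath h hv h2 0 le_rfl (by simp) h0

/-! ### Geodesics off the vertices and locally affine maps -/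

namespace PolygonGluing

/-- `G.Geod u x y L`: a geodesic from `x` to `y` in the direction of `u`, with displacement
`L • u`, that does not meet the vertices. -/
inductive Geod (G : PolygonGluing) (u : Plane) : G.Surface → G.Surface → ℝ → Prop
  | nil (x : G.Surface) : x ∉ G.vertices → Geod G u x x 0
  | cons {x y z : G.Surface} {s L : ℝ} : x ∉ G.vertices → 0 < s → G.Seg x y (s • u) →
      Geod G u y z L → Geod G u x z (s + L)

theorem Geod.nonneg {G : PolygonGluing} {u : Plane} {x y : G.Surface} {L : ℝ}
    (h : G.Geod u x y L) : 0 ≤ L := by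
  induction h with
  | nil => exact le_rfl
  | cons _ hs _ _ ih => positivity

theorem Geod.left {G : PolygonGluing} {u : Plane} {x y : G.Surface} {L : ℝ}
    (h : G.Geod u x y L) : x ∉ G.vertices := by
  cases h <;> assumption

theorem Geod.append {G : PolygonGluing} {u : Plane} {x y z : G.Surface} {L L' : ℝ}
    (h : G.Geod u x y L) (h' : G.Geod u y z L') : G.Geod u x z (L + L') := by
  induction h with
  | nil => simpa using h'
  | cons hx hs hseg _ ih => rw [add_assoc]; exact .cons hx hs hseg (ih h')

theorem Geod.single {G : PolygonGluing} {u : Plane} {x y : G.Surface} {s : ℝ}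
    (hx : x ∉ G.vertices) (hy : y ∉ G.vertices) (hs : 0 < s) (h : G.Seg x y (s • u)) :
    G.Geod u x y s := by
  simpa using Geod.cons hx hs h (.nil y hy)

theorem Geod.rescale {G : PolygonGluing} {u w : Plane} {x y : G.Surface} {s L : ℝ}
    (hs : 0 < s) (h : G.Geod w x y L) (hw : w = s • u) : G.Geod u x y (L * s) := by
  induction h with
  | nil x hx => simpa using Geod.nil x hx
  | @cons x y z r L hx hr hseg _ ih =>
    rw [add_mul]
    refine .cons hx (by positivity) ?_ ih
    rwa [mul_smul, ← hw]

end PolygonGluing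

/-- A transitive relation that holds between nearby points of `[0, 1]` holds between `0` and
`1`. -/
theorem rel_zero_one_of_local (R : ℝ → ℝ → Prop)
    (trans : ∀ s t r, s ∈ Set.Icc (0 : ℝ) 1 → t ∈ Set.Icc (0 : ℝ) 1 → r ∈ Set.Icc (0 : ℝ) 1 →
      R s t → R t r → R s r)
    (loc : ∀ t ∈ Set.Icc (0 : ℝ) 1, ∃ ε > 0, ∀ s ∈ Set.Icc (0 : ℝ) 1,
      (t - ε < s → s ≤ t → R s t) ∧ (t ≤ s → s < t + ε → R t s)) : R 0 1 := by
  set S : Set ℝ := {t | t ∈ Set.Icc (0 : ℝ) 1 ∧ R 0 t} with hS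
  have z : (0 : ℝ) ∈ Set.Icc (0 : ℝ) 1 := ⟨le_rfl, zero_le_one⟩
  have h0 : (0 : ℝ) ∈ S := by
    obtain ⟨ε, hε, h⟩ := loc 0 z
    exact ⟨z, (h 0 z).2 le_rfl (by linarith)⟩
  have hb : BddAbove S := ⟨1, fun t ht => ht.1.2⟩
  set m := sSup S with hm
  have hmI : m ∈ Set.Icc (0 : ℝ) 1 := ⟨le_csSup hb h0, csSup_le ⟨0, h0⟩ fun t ht => ht.1.2⟩
  obtain ⟨ε, hε, h⟩ := loc m hmI
  obtain ⟨t, ht, htm⟩ := exists_lt_of_lt_csSup ⟨0, h0⟩ (show m - ε < m by linarith)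
  have hRm : R 0 m := trans _ _ _ z ht.1 hmI ht.2 ((h t ht.1).1 htm (le_csSup hb ht))
  rcases hmI.2.eq_or_lt with h1 | h1
  · rwa [h1] at hRm
  · exfalso
    set s := min 1 (m + ε / 2) with hs
    have hsm : m < s := lt_min h1 (by linarith)
    have hsI : s ∈ Set.Icc (0 : ℝ) 1 := ⟨hmI.1.trans hsm.le, min_le_left _ _⟩
    have : R m s := (h s hsI).2 hsm.le (by
      have := min_le_right 1 (m + ε / 2)
      rw [← hs] at this
      linarith)
    have : s ∈ S := ⟨hsI, trans _ _ _ z hmI hsI hRm this⟩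
    exact absurd (le_csSup hb this) (not_le.2 hsm)

/-- A map that is affine near every point that is not a vertex. -/
def IsLocAffine (c : ℝ) (A : GL (Fin 2) ℝ) (F : (surfS c).Surface → (surfS c).Surface) : Prop :=
  (∀ x ∉ (surfS c).vertices, F x ∉ (surfS c).vertices) ∧
  ∀ x ∉ (surfS c).vertices, ∃ ε > 0, ∀ y v, ‖v‖ < ε → (surfS c).Seg x y v →
    (surfS c).Seg (F x) (F y) (linAct A v)

/-- Vertices are extreme points: the two edge functions that vanish at a vertex inside the segment
would also vanish at its end `q`. -/
theorem not_isVert_of_between {c : ℝ} (hc : 1 ≤ c) {q r : Plane} (hq : q ∈ polyQ c)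
    (hr : r ∈ polyQ c) (hqv : ¬IsVert c q) {t : ℝ} (ht0 : 0 < t) (ht1 : t < 1) :
    ¬IsVert c ((1 - t) • q + t • r) := by
  intro hv
  obtain ⟨k, h1, h2⟩ := hv.two_edges
  rw [edgeFun_combo _ _ _ _ _ _ (by ring)] at h1 h2
  have zero : ∀ j, (1 - t) * edgeFun c j q + t * edgeFun c j r = 0 → edgeFun c j q = 0 := by
    intro j hj
    have a1 := edgeFun_nonneg hc j hq
    have a2 := mul_nonneg ht0.le (edgeFun_nonneg hc j hr)
    have a3 := mul_nonneg (by linarith : 0 ≤ 1 - t) a1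
    rcases mul_eq_zero.1 (by linarith : (1 - t) * edgeFun c j q = 0) with h | h
    · linarith
    · exact h
  exact hqv (isVert_of_two_edges hc (by omega : k ≠ k + 1) hq (zero _ h1) (zero _ h2))

/-- The radius in `IsLocAffine` depends on the point, so the segment is subdivided by means of
`rel_zero_one_of_local`. The image may cross edges, hence it is a geodesic rather than a segment. -/
theorem IsLocAffine.geod_of_seg {c : ℝ} (hc : 1 ≤ c) {A : GL (Fin 2) ℝ}
    {F : (surfS c).Surface → (surfS c).Surface} (hF : IsLocAffine c A F) {x y : (surfS c).Surface}
    {v : Plane} (hx : x ∉ (surfS c).vertices) (hy : y ∉ (surfS c).vertices)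
    (h : (surfS c).Seg x y v) : (surfS c).Geod (linAct A v) (F x) (F y) 1 := by
  obtain ⟨i, q, r, hq, hr, rfl⟩ := seg_iff.1 h
  set v := sgn i • (r - q) with hv
  have hqv : ¬IsVert c q := fun h => hx ((mem_vertices_iff hc hq).2 h)
  have hrv : ¬IsVert c r := fun h => hy ((mem_vertices_iff hc hr).2 h)
  have hex : ∀ t : ℝ, ∃ z, t ∈ Set.Icc (0 : ℝ) 1 → IsRep c z i ((1 - t) • q + t • r) := by
    intro t
    by_cases ht : t ∈ Set.Icc (0 : ℝ) 1
    · obtain ⟨z, hz⟩ := exists_rep_of_mem i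
        (convex_polyQ c hq.mem hr.mem (by linarith [ht.2] : 0 ≤ 1 - t) ht.1 (by ring))
      exact ⟨z, fun _ => hz⟩
    · exact ⟨x, fun h => absurd h ht⟩
  choose X hX using hex
  have hXv : ∀ t ∈ Set.Icc (0 : ℝ) 1, X t ∉ (surfS c).vertices := by
    intro t ht
    rw [mem_vertices_iff hc (hX t ht)]
    rcases ht.1.eq_or_lt with h0 | h0
    · rw [← h0]; simpa using hqv
    rcases ht.2.eq_or_lt with h1 | h1
    · rw [h1]; simpa using hrv
    · exact not_isVert_of_between hc hq.mem hr.mem hqv h0 h1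
  have hXseg : ∀ t ∈ Set.Icc (0 : ℝ) 1, ∀ s ∈ Set.Icc (0 : ℝ) 1,
      (surfS c).Seg (X t) (X s) ((s - t) • v) := by
    intro t ht s hs
    convert (hX t ht).seg (hX s hs) using 1
    rw [hv, smul_comm]
    congr 1
    module
  have h0 : X 0 = x := (hX 0 (by simp)).unique (by simpa using hq)
  have h1 : X 1 = y := (hX 1 (by simp)).unique (by simpa using hr)
  have main := rel_zero_one_of_local
    (fun s t => (surfS c).Geod (linAct A v) (F (X s)) (F (X t)) (t - s)) ?_ ?_
  · simpa [h0, h1] using main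
  · intro s t r _ _ _ h h'
    have := h.append h'
    convert this using 1
    ring
  · intro t ht
    obtain ⟨ε, hε, h⟩ := hF.2 (X t) (hXv t ht)
    have hpos : 0 < ‖v‖ + 1 := by positivity
    have small : ∀ s, |s - t| < ε / (‖v‖ + 1) → ‖(s - t) • v‖ < ε := by
      intro s hs
      rw [norm_smul, Real.norm_eq_abs]
      rw [lt_div_iff₀ hpos] at hs
      have : |s - t| * ‖v‖ ≤ |s - t| * (‖v‖ + 1) :=
        mul_le_mul_of_nonneg_left (by linarith) (abs_nonneg _)
      linarith
    have nil : (surfS c).Geod (linAct A v) (F (X t)) (F (X t)) (t - t) := by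
      rw [sub_self]; exact .nil _ (hF.1 _ (hXv t ht))
    refine ⟨ε / (‖v‖ + 1), by positivity, fun s hs => ⟨fun hs1 hs2 => ?_, fun hs1 hs2 => ?_⟩⟩
    · rcases hs2.eq_or_lt with rfl | hlt
      · exact nil
      have := seg_symm (h (X s) _ (small s (by rw [abs_lt]; constructor <;> linarith))
        (hXseg t ht s hs))
      refine .single (hF.1 _ (hXv s hs)) (hF.1 _ (hXv t ht)) (by linarith) ?_
      convert this using 1
      rw [map_smul (linAct A) (s - t) v, ← neg_smul, neg_sub]
    · rcases hs1.eq_or_lt with rfl | hlt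
      · exact nil
      have := h (X s) _ (small s (by rw [abs_lt]; constructor <;> linarith)) (hXseg t ht s hs)
      refine .single (hF.1 _ (hXv t ht)) (hF.1 _ (hXv s hs)) (by linarith) ?_
      rwa [map_smul] at this

theorem IsLocAffine.geod {c : ℝ} (hc : 1 ≤ c) {A : GL (Fin 2) ℝ}
    {F : (surfS c).Surface → (surfS c).Surface} (hF : IsLocAffine c A F) {x y : (surfS c).Surface}
    {u : Plane} {L : ℝ} (h : (surfS c).Geod u x y L) :
    (surfS c).Geod (linAct A u) (F x) (F y) L := by
  induction h with
  | nil x hx => exact .nil _ (hF.1 x hx)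
  | @cons x y z s L hx hs hseg hpath ih =>
    have := (hF.geod_of_seg hc hx hpath.left hseg).rescale hs (map_smul _ _ _)
    rw [one_mul] at this
    exact this.append ih

/-! ### Vertices have infinite cone angle, and isometries permute them -/

/-- The edge `k` joins the corner P_k of Q_c⁺ to the corner -P_{k+1} of Q_c⁻, and the edge `k + 1`
joins the latter to P_{k+2}. So infinitely many corners meet at one vertex of S_c. -/
theorem IsRep.shift_two {c : ℝ} (hc : 1 ≤ c) {x : (surfS c).Surface} {i : Bool} {k : ℤ} :
    IsRep c x i (vert c k) ↔ IsRep c x i (vert c (k + 2)) := by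
  have e1 : edgeFlip c k (vert c k) = vert c (k + 1) := by simp [edgeFlip]
  have e2 : edgeFlip c (k + 1) (vert c (k + 1)) = vert c (k + 2) := by
    simp [edgeFlip, add_assoc]
  have e3 : edgeFlip c (k + 1) (vert c (k + 2)) = vert c (k + 1) := by
    rw [← e2, edgeFlip_edgeFlip]
  have e4 : edgeFlip c k (vert c (k + 1)) = vert c k := by rw [← e1, edgeFlip_edgeFlip]
  have z3 : edgeFun c (k + 1) (vert c (k + 2)) = 0 := by
    have := edgeFun_vert_right c (k + 1)
    rwa [add_assoc] at this
  constructor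
  · intro h
    have h1 := h.flip hc (edgeFun_vert_left c k)
    rw [e1] at h1
    have h2 := h1.flip hc (edgeFun_vert_left c (k + 1))
    rwa [e2, Bool.not_not] at h2
  · intro h
    have h1 := h.flip hc z3
    rw [e3] at h1
    have h2 := h1.flip hc (edgeFun_vert_right c k)
    rwa [e4, Bool.not_not] at h2

theorem exists_rep_true_of_mem_vertices {c : ℝ} (hc : 1 ≤ c) {x : (surfS c).Surface}
    (hx : x ∈ (surfS c).vertices) : ∃ k, IsRep c x true (vert c k) := by
  obtain ⟨i, q, hq⟩ := exists_rep x
  obtain ⟨k, rfl⟩ := (mem_vertices_iff hc hq).1 hx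
  cases i
  · have := hq.flip hc (edgeFun_vert_left c k)
    exact ⟨k + 1, by simpa [edgeFlip] using this⟩
  · exact ⟨k, hq⟩

/-- The parity of the index determines the vertex. Finiteness serves to show that a bijection whose
inverse maps vertices to vertices does so itself. -/
theorem vertices_finite {c : ℝ} (hc : 1 ≤ c) : (surfS c).vertices.Finite := by
  obtain ⟨x0, h0⟩ := exists_rep_of_mem (c := c) true (vert_mem_polyQ c 0)
  obtain ⟨x1, h1⟩ := exists_rep_of_mem (c := c) true (vert_mem_polyQ c 1)
  have shift : ∀ (x : (surfS c).Surface) (k m : ℤ),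
      IsRep c x true (vert c k) ↔ IsRep c x true (vert c (k + 2 * m)) := by
    intro x k m
    induction m using Int.induction_on with
    | zero => simp
    | succ i ih => rw [ih, IsRep.shift_two hc]; ring_nf
    | pred i ih => rw [ih, IsRep.shift_two hc (k := k + 2 * (-(i : ℤ) - 1))]; ring_nf
  refine (Set.toFinite {x0, x1}).subset fun x hx => ?_
  obtain ⟨k, hk⟩ := exists_rep_true_of_mem_vertices hc hx
  rcases Int.even_or_odd' k with ⟨m, rfl | rfl⟩
  · left
    exact ((shift x 0 m).2 (by simpa using hk)).unique h0
  · right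
    exact ((shift x 1 m).2 (by rwa [add_comm] at hk)).unique h1

theorem exists_linAct_bound (A : GL (Fin 2) ℝ) : ∃ C : ℝ, 0 < C ∧ ∀ v, ‖linAct A v‖ ≤ C * ‖v‖ :=
  (LinearMap.toContinuousLinearMap (linAct A)).isBoundedLinearMap.bound

/-- The polygon contains the vertical rays that start at its vertices. -/
theorem vert_add_up {c : ℝ} (hc : 1 ≤ c) (k : ℤ) {t : ℝ} (ht : 0 < t) :
    vert c k + !₂[0, t] ∈ polyQ c ∧ ∀ j, edgeFun c j (vert c k + !₂[0, t]) ≠ 0 := by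
  have pos : ∀ j, 0 < edgeFun c j (vert c k + !₂[0, t]) := by
    intro j
    rw [edgeFun_add]
    have h1 := edgeFun_vert_nonneg hc j k
    have h2 := vert_fst_step hc j
    have h3 : 0 < (vert c (j + 1) 0 - vert c j 0) * t := mul_pos (by linarith) ht
    simp
    linarith
  exact ⟨(mem_polyQ_iff hc).2 fun j => (pos j).le, fun j => (pos j).ne'⟩

/-- A local isometry cannot map an ordinary point to a vertex, where the cone angle is infinite. -/
theorem not_mem_vertices_of_isometry {c : ℝ} (hc : 1 ≤ c) {A : GL (Fin 2) ℝ}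
    (F : (surfS c).Surface ≃ (surfS c).Surface)
    (hseg : ∀ x ∉ (surfS c).vertices, ∃ ε > 0, ∀ y v, ‖v‖ < ε → (surfS c).Seg x y v →
      (surfS c).Seg (F x) (F y) (linAct A v))
    (hdist : ∀ r > 0, ∃ δ > 0, ∀ x y L, (surfS c).PolyPath (F x) (F y) L → L < δ →
      ∃ L' < r, (surfS c).PolyPath x y L') {x : (surfS c).Surface}
    (hx : x ∉ (surfS c).vertices) : F x ∉ (surfS c).vertices := by
  intro hw
  obtain ⟨k, hk⟩ := exists_rep_true_of_mem_vertices hc hw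
  obtain ⟨ρ, hρ, hpath⟩ := exists_seg_of_polyPath hc hx
  obtain ⟨ε, hε, hdir⟩ := hseg x hx
  obtain ⟨C, hC, hbound⟩ := exists_linAct_bound A
  -- Below `ρ` a short path yields a segment from `x`, below `ε` the map `F` is affine on it, and
  -- below `1 / C` its image is shorter than 1, the least horizontal distance between two vertices
  -- of the polygon.
  obtain ⟨δ, hδ, hdist⟩ := hdist (min ρ (min ε (1 / C))) (by positivity)
  set t := min δ 1 / 2 with ht
  have ht0 : 0 < t := by positivity
  have htδ : t < δ := by
    have := min_le_left δ 1
    have : 0 < min δ 1 := by positivity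
    linarith
  have key : ∀ l, IsRep c (F x) true (vert c l) → ∃ y, IsRep c (F y) true (vert c l + !₂[0, t]) ∧
      (surfS c).Seg x y (linAct A⁻¹ !₂[0, t]) := by
    intro l hl
    obtain ⟨hmem, hinner⟩ := vert_add_up hc l ht0
    obtain ⟨z, hz⟩ := exists_rep_of_mem true hmem
    obtain ⟨y, rfl⟩ := F.surjective z
    refine ⟨y, hz, ?_⟩
    have h1 : (surfS c).Seg (F x) (F y) !₂[0, t] := by simpa using hl.seg hz
    have h2 := PolyPath.cons h1 (.nil _)
    have hn : ‖(!₂[0, t] : Plane)‖ = t := by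
      simp [EuclideanSpace.norm_eq, Real.sqrt_sq ht0.le]
    rw [hn, add_zero] at h2
    obtain ⟨L', hL', hP⟩ := hdist _ _ _ h2 htδ
    obtain ⟨u, hu, hS⟩ := hpath y L' hP (hL'.trans_le (min_le_left _ _))
    have hu1 : ‖u‖ < min ε (1 / C) := (hu.trans_lt hL').trans_le (min_le_right _ _)
    have h3 := hdir y u (hu1.trans_le (min_le_left _ _)) hS
    obtain ⟨j, p, p', hp, hp', e⟩ := seg_iff.1 h3
    obtain ⟨rfl, rfl⟩ := hz.eq_of_interior hc hinner hp'
    obtain ⟨m, rfl⟩ := (mem_vertices_iff hc hp).1 hw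
    have hAu : ‖linAct A u‖ < 1 := by
      have h5 := hu1.trans_le (min_le_right _ _)
      rw [lt_div_iff₀ hC] at h5
      linarith [hbound u]
    have hml : m = l := by
      by_contra hne
      have big : 1 ≤ |linAct A u 0| := by
        rw [e]
        simp
        have hgap : ∀ a b : ℤ, a < b → vert c a 0 + 1 ≤ vert c b 0 := fun a b hab =>
          (vert_fst_step hc a).trans ((vert_fst_strictMono hc).monotone (by omega))
        rcases lt_or_gt_of_ne hne with h | h
        · exact le_trans (by linarith [hgap _ _ h]) (le_abs_self _)
        · exact le_trans (by linarith [hgap _ _ h]) (neg_le_abs _)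
      have := PiLp.norm_apply_le (linAct A u) 0
      rw [Real.norm_eq_abs] at this
      linarith
    subst hml
    have e' : linAct A u = !₂[0, t] := by rw [e]; simp
    rwa [← e', linAct_inv_apply]
  -- The vertical segments at the corners P_k and P_{k+2} come from the same vector at `x`. So they
  -- would end at the same point, although their ends are distinct interior points of Q_c⁺.
  obtain ⟨y, hy, hyS⟩ := key k hk
  obtain ⟨y', hy', hyS'⟩ := key (k + 2) ((IsRep.shift_two hc).1 hk)
  have := seg_unique hc hx hyS hyS'
  subst this
  have := (hy.eq_of_interior hc (vert_add_up hc k ht0).2 hy').2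
  have := vert_injective hc (add_right_cancel this)
  omega

theorem exists_locAffine_of_mem_veechGroup {c : ℝ} (hc : 1 ≤ c) {A : GL (Fin 2) ℝ}
    (hA : A ∈ (surfS c).veechGroup) : ∃ F : (surfS c).Surface ≃ (surfS c).Surface,
      IsLocAffine c A F ∧ IsLocAffine c A⁻¹ F.symm := by
  obtain ⟨f, hiso, hdir⟩ := hA
  set φ := transformEquiv A (surfS c) with hφ
  obtain ⟨C, hC, hbound⟩ := exists_linAct_bound A
  obtain ⟨C', hC', hbound'⟩ := exists_linAct_bound A⁻¹
  set F := φ.trans f with hF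
  have hseg : ∀ x ∉ (surfS c).vertices, ∃ ε > 0, ∀ y v, ‖v‖ < ε → (surfS c).Seg x y v →
      (surfS c).Seg (F x) (F y) (linAct A v) := by
    intro x hx
    obtain ⟨ε, hε, h⟩ := hdir (φ x) (by rwa [hφ, transform_mem_vertices])
    refine ⟨ε / C, by positivity, fun y v hv hs => ?_⟩
    rw [lt_div_iff₀ hC] at hv
    exact h (φ y) _ (by linarith [hbound v]) (transform_seg_iff.2 hs)
  have hpoly : ∀ {x y : (transform A (surfS c)).Surface} {L : ℝ},
      (transform A (surfS c)).PolyPath x y L →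
      ∃ L' ≤ C' * L, (surfS c).PolyPath (φ.symm x) (φ.symm y) L' := by
    intro x y L h
    induction h with
    | nil x => exact ⟨0, by simp, .nil _⟩
    | @cons x y z v L hs _ ih =>
      obtain ⟨L', hL', hP⟩ := ih
      have h1 : (surfS c).Seg (φ.symm x) (φ.symm y) (linAct A⁻¹ v) := by
        rw [← transform_seg_iff (A := A), linAct_apply_inv, ← hφ, φ.apply_symm_apply,
          φ.apply_symm_apply]
        exact hs
      exact ⟨_, by linarith [hbound' v], .cons h1 hP⟩
  have hdist : ∀ r > 0, ∃ δ > 0, ∀ x y L, (surfS c).PolyPath (F x) (F y) L → L < δ →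
      ∃ L' < r, (surfS c).PolyPath x y L' := by
    intro r hr
    refine ⟨r / C', by positivity, fun x y L hL hlt => ?_⟩
    have h1 : (surfS c).pathDist (F x) (F y) < ENNReal.ofReal (r / C') :=
      lt_of_le_of_lt (iInf₂_le L hL) ((ENNReal.ofReal_lt_ofReal_iff (by positivity)).2 hlt)
    have h2 := hiso (φ x) (φ y)
    rw [show f (φ x) = F x from rfl, show f (φ y) = F y from rfl] at h2
    rw [h2] at h1
    unfold pathDist at h1
    simp only [iInf_lt_iff] at h1
    obtain ⟨L₁, hL₁, hlt₁⟩ := h1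
    obtain ⟨L', hL', hP⟩ := hpoly hL₁
    rw [φ.symm_apply_apply, φ.symm_apply_apply] at hP
    refine ⟨L', ?_, hP⟩
    have h3 := (ENNReal.ofReal_lt_ofReal_iff (by positivity)).1 hlt₁
    rw [lt_div_iff₀ hC'] at h3
    linarith
  have hnv : ∀ x ∉ (surfS c).vertices, F x ∉ (surfS c).vertices := fun x hx =>
    not_mem_vertices_of_isometry hc F hseg hdist hx
  have hnv' : ∀ x ∉ (surfS c).vertices, F.symm x ∉ (surfS c).vertices := by
    -- The inverse maps the finite vertex set injectively into itself, hence onto itself, so it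
    -- takes no other point to a vertex.
    have maps : Set.MapsTo F.symm (surfS c).vertices (surfS c).vertices := by
      intro w hw
      by_contra h
      have := hnv _ h
      rw [F.apply_symm_apply] at this
      exact this hw
    have surj : F.symm '' (surfS c).vertices = (surfS c).vertices :=
      Set.eq_of_subset_of_ncard_le maps.image_subset
        (Set.ncard_image_of_injective _ F.symm.injective).ge (vertices_finite hc)
    intro w hw h
    rw [← surj] at h
    obtain ⟨w', hw', e⟩ := h
    rw [F.symm.injective e] at hw'
    exact hw hw'
  refine ⟨F, ⟨hnv, hseg⟩, hnv', fun w hw => ?_⟩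
  -- The disc at the preimage of `w` provides a segment with vector `A⁻¹ v`. Its image starts at `w`
  -- with vector `v`, so by uniqueness it is the given segment.
  obtain ⟨ε, hε, h⟩ := hseg _ (hnv' w hw)
  obtain ⟨ρ, hρ, hex, -⟩ := exists_disc hc (hnv' w hw)
  refine ⟨min ε ρ / C', by positivity, fun z v hv hs => ?_⟩
  rw [lt_div_iff₀ hC'] at hv
  have hv' : ‖linAct A⁻¹ v‖ < min ε ρ := by linarith [hbound' v]
  obtain ⟨y, hy⟩ := hex _ (hv'.trans_le (min_le_right _ _))
  have h1 := h y _ (hv'.trans_le (min_le_left _ _)) hy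
  rw [F.apply_symm_apply, linAct_apply_inv] at h1
  rw [seg_unique hc hw hs h1, F.symm_apply_apply]
  exact hy

/-! ### Invariance of the holonomy vectors -/

/-- The holonomy vectors of the closed geodesics of `S_c`. -/
def closedHol (c : ℝ) : Set Plane := {v | v ≠ 0 ∧ ∃ x, (surfS c).Geod v x x 1}

/-- The vectors `v` such that some geodesic in the direction of `v` closes up for the first time
after `2c • v`. -/
def primHol (c : ℝ) : Set Plane :=
  {v | ∃ x, (surfS c).Geod v x x (2 * c) ∧ ∀ s, 0 < s → s < 2 * c → ¬(surfS c).Geod v x x s}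

/-- The linear maps that preserve the holonomy vectors of closed geodesics. -/
def holStab (c : ℝ) : Subgroup (GL (Fin 2) ℝ) where
  carrier := {A | (∀ v, linAct A v ∈ closedHol c ↔ v ∈ closedHol c) ∧
    ∀ v, linAct A v ∈ primHol c ↔ v ∈ primHol c}
  one_mem' := by simp [linAct_one]
  mul_mem' := by
    rintro A B ⟨h1, h2⟩ ⟨h3, h4⟩
    exact ⟨fun v => by rw [linAct_mul, h1, h3], fun v => by rw [linAct_mul, h2, h4]⟩
  inv_mem' := by
    rintro A ⟨h1, h2⟩
    exact ⟨fun v => by rw [← h1, linAct_apply_inv], fun v => by rw [← h2, linAct_apply_inv]⟩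

theorem IsLocAffine.linAct_mem {c : ℝ} (hc : 1 ≤ c) {A : GL (Fin 2) ℝ}
    {F : (surfS c).Surface ≃ (surfS c).Surface} (hF : IsLocAffine c A F)
    (hF' : IsLocAffine c A⁻¹ F.symm) (v : Plane) :
    (v ∈ closedHol c → linAct A v ∈ closedHol c) ∧ (v ∈ primHol c → linAct A v ∈ primHol c) := by
  constructor
  · rintro ⟨hv, x, hx⟩
    refine ⟨fun h => hv ?_, F x, hF.geod hc hx⟩
    rw [← linAct_inv_apply A v, h, map_zero]
  · rintro ⟨x, hx, hprim⟩
    refine ⟨F x, hF.geod hc hx, fun s hs hs' h => hprim s hs hs' ?_⟩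
    have := hF'.geod hc h
    rwa [F.symm_apply_apply, linAct_inv_apply] at this

theorem veechGroup_subset_holStab {c : ℝ} (hc : 1 ≤ c) :
    (surfS c).veechGroup ⊆ (holStab c : Set (GL (Fin 2) ℝ)) := by
  intro A hA
  obtain ⟨F, hF, hF'⟩ := exists_locAffine_of_mem_veechGroup hc hA
  have h1 := hF.linAct_mem hc hF'
  have h2 := hF'.linAct_mem hc (F := F.symm) (by rwa [inv_inv, Equiv.symm_symm])
  refine ⟨fun v => ⟨fun h => ?_, (h1 v).1⟩, fun v => ⟨fun h => ?_, (h1 v).2⟩⟩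
  · have := (h2 _).1 h
    rwa [linAct_inv_apply] at this
  · have := (h2 _).2 h
    rwa [linAct_inv_apply] at this

/-! ### Automorphisms with derivatives -I, A_c and C_c -/

/-- A function on the two polygons that is compatible with the gluing descends to `S_c`. -/
theorem exists_lift {c : ℝ} {α : Type*} (g : Bool → Plane → α)
    (hg : ∀ k q, q ∈ polyQ c → edgeFun c k q = 0 → g true q = g false (edgeFlip c k q)) :
    ∃ F : (surfS c).Surface → α, ∀ x i q, IsRep c x i q → F x = g i q := by
  refine ⟨Quot.lift (fun a => g a.1 (sgn a.1 • a.2.1)) ?_, ?_⟩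
  · rintro _ _ ⟨(k : ℤ), p, hp⟩
    have h1 := hg k p (segment_subset_polyQ c k hp) (edgeFun_eq_zero_of_mem_segment hp)
    have e1 : sgn true • p = p := by simp
    have e2 : sgn false • (p + (-vert c k - vert c (k + 1))) = edgeFlip c k p := by
      simp [edgeFlip]; abel
    change g true (sgn true • p) = g false (sgn false • (p + (-vert c k - vert c (k + 1))))
    rw [e1, e2, h1]
  · rintro _ i q ⟨h, rfl⟩
    change g i (sgn i • sgn i • q) = g i q
    rw [sgn_smul_smul]

/-- The automorphism interchanges the two pieces and keeps the coordinate `q`. It respects the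
gluing because `edgeFlip` is the same on both sides. -/
theorem neg_one_mem_affGroup {c : ℝ} (hc : 1 ≤ c) : (-1 : GL (Fin 2) ℝ) ∈ (surfS c).affGroup := by
  have hex : ∀ (i : Bool) (q : Plane), ∃ x : (surfS c).Surface, q ∈ polyQ c → IsRep c x (!i) q := by
    intro i q
    by_cases h : q ∈ polyQ c
    · obtain ⟨x, hx⟩ := exists_rep_of_mem (!i) h
      exact ⟨x, fun _ => hx⟩
    · obtain ⟨x, -⟩ := exists_rep_of_mem (c := c) i (vert_mem_polyQ c 0)
      exact ⟨x, fun h' => absurd h' h⟩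
  choose g hg using hex
  obtain ⟨F, hF⟩ := exists_lift (c := c) g fun k q hq hk =>
    ((hg true q hq).flip hc hk).unique (hg false _ (edgeFlip_mem_polyQ hc hq hk))
  have hrep : ∀ {x i q}, IsRep c x i q → IsRep c (F x) (!i) q := fun {x i q} h => by
    rw [hF x i q h]; exact hg i q h.mem
  have hFF : Function.LeftInverse F F := fun x => by
    obtain ⟨i, q, h⟩ := exists_rep x
    have := hrep (hrep h)
    rw [Bool.not_not] at this
    exact this.unique h
  have neg_apply : ∀ v, linAct (-1) v = -v := fun v => by
    ext i
    fin_cases i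
    · simp [linAct_fst]
    · simp [linAct_snd]
  have haff : (surfS c).IsAffine (-1) F := by
    constructor
    · intro x
      obtain ⟨i, q, h⟩ := exists_rep x
      rw [mem_vertices_iff hc h, mem_vertices_iff hc (hrep h)]
    · intro x y v h
      obtain ⟨i, q, r, hq, hr, rfl⟩ := seg_iff.1 h
      refine .single zero_le_one ?_
      convert (hrep hq).seg (hrep hr) using 1
      rw [one_smul, neg_apply, sgn_not, neg_smul]
  exact ⟨⟨F, F, hFF, hFF⟩, haff, by rw [inv_neg_one]; exact haff⟩

/-- An involution of the plane that reverses the order of the vertices of `Q_c⁺` gives an affine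
automorphism of `S_c`. -/
theorem mem_affGroup_of_reversing {c : ℝ} (hc : 1 ≤ c) (A : GL (Fin 2) ℝ) (hA : A⁻¹ = A)
    (b : Plane) (n : ℤ) (h : ∀ k, linAct A (vert c k) + b = vert c (n - k)) :
    A ∈ (surfS c).affGroup := by
  set τ : Plane → Plane := fun q => linAct A q + b with hτ
  have hAA : ∀ v, linAct A (linAct A v) = v := fun v => by
    have := linAct_inv_apply A v
    rwa [hA] at this
  have hAb : linAct A b + b = 0 := by
    have h0 := h n
    rw [sub_self, vert_zero] at h0
    have h1 := h 0
    rw [sub_zero, vert_zero, map_zero, zero_add] at h1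
    rw [h1, ← h0, h1]
  have ττ : ∀ q, τ (τ q) = q := fun q => by
    simp only [hτ, map_add, hAA]
    rw [add_assoc, hAb, add_zero]
  have τcombo : ∀ (u v : ℝ) (p q : Plane), u + v = 1 →
      τ (u • p + v • q) = u • τ p + v • τ q := by
    intro u v p q huv
    obtain rfl : v = 1 - u := by linarith
    simp only [hτ, map_add, map_smul]
    module
  have τmem : ∀ q ∈ polyQ c, τ q ∈ polyQ c := by
    have hconv : Convex ℝ {q | τ q ∈ polyQ c} := by
      intro p hp q hq u v hu hv huv
      change τ (u • p + v • q) ∈ polyQ c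
      rw [τcombo u v p q huv]
      exact convex_polyQ c hp hq hu hv huv
    refine convexHull_min ?_ hconv
    rintro _ ⟨k, rfl⟩
    change linAct A (vert c k) + b ∈ polyQ c
    rw [h k]
    exact vert_mem_polyQ c _
  -- The map sends P_k and P_{k+1} to P_{n-k} and P_{n-k-1}, so the edge `k` goes to the edge `n - k
  -- - 1`.
  have τedge : ∀ k q, q ∈ polyQ c → edgeFun c k q = 0 → edgeFun c (n - k - 1) (τ q) = 0 := by
    intro k q hq hk
    obtain ⟨u, v, hu, hv, huv, rfl⟩ := mem_segment_of_edgeFun_eq_zero hc hq hk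
    rw [τcombo u v _ _ huv, edgeFun_combo _ _ _ _ _ _ huv]
    simp only [hτ]
    rw [h, h, show n - (k + 1) = n - k - 1 by ring, edgeFun_vert_left]
    have := edgeFun_vert_right c (n - k - 1)
    rw [sub_add_cancel] at this
    rw [this]
    ring
  have τflip : ∀ k q, τ (edgeFlip c k q) = edgeFlip c (n - k - 1) (τ q) := by
    intro k q
    have h1 := h k
    have h2 := h (k + 1)
    rw [show n - (k + 1) = n - k - 1 by ring] at h2
    simp only [edgeFlip, sub_add_cancel, ← h1, ← h2, hτ, map_sub, map_add]
    abel
  have τvert : ∀ q, IsVert c (τ q) ↔ IsVert c q := by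
    have one : ∀ q, IsVert c q → IsVert c (τ q) := by
      rintro _ ⟨k, rfl⟩
      exact ⟨n - k, h k⟩
    exact fun q => ⟨fun h => by simpa [ττ] using one _ h, one q⟩
  have hex : ∀ (i : Bool) (q : Plane), ∃ x : (surfS c).Surface,
      q ∈ polyQ c → IsRep c x i (τ q) := by
    intro i q
    by_cases h : q ∈ polyQ c
    · obtain ⟨x, hx⟩ := exists_rep_of_mem i (τmem q h)
      exact ⟨x, fun _ => hx⟩
    · obtain ⟨x, -⟩ := exists_rep_of_mem (c := c) i (vert_mem_polyQ c 0)
      exact ⟨x, fun h' => absurd h' h⟩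
  choose g hg using hex
  obtain ⟨F, hF⟩ := exists_lift (c := c) g fun k q hq hk => by
    have h1 := (hg true q hq).flip hc (τedge k q hq hk)
    have h2 := hg false _ (edgeFlip_mem_polyQ hc hq hk)
    rw [τflip] at h2
    exact h1.unique h2
  have hrep : ∀ {x i q}, IsRep c x i q → IsRep c (F x) i (τ q) := fun {x i q} h => by
    rw [hF x i q h]; exact hg i q h.mem
  have hFF : Function.LeftInverse F F := fun x => by
    obtain ⟨i, q, h⟩ := exists_rep x
    have := hrep (hrep h)
    rw [ττ] at this
    exact this.unique h
  have haff : (surfS c).IsAffine A F := by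
    constructor
    · intro x
      obtain ⟨i, q, h⟩ := exists_rep x
      rw [mem_vertices_iff hc h, mem_vertices_iff hc (hrep h), τvert]
    · intro x y v h
      obtain ⟨i, q, r, hq, hr, rfl⟩ := seg_iff.1 h
      refine .single zero_le_one ?_
      convert (hrep hq).seg (hrep hr) using 1
      rw [one_smul, map_smul, map_sub]
      congr 1
      simp only [hτ]
      abel
  exact ⟨⟨F, F, hFF, hFF⟩, haff, by rw [hA]; exact haff⟩

theorem genA_mem_affGroup {c : ℝ} (hc : 1 ≤ c) : genA ∈ (surfS c).affGroup := by
  refine mem_affGroup_of_reversing hc genA rfl 0 0 fun k => ?_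
  ext i
  fin_cases i
  · simp [linAct_fst, genA, vert_neg_fst]
  · simp [linAct_snd, genA, vert_neg_snd]

/-- T_c after the reflection in the vertical axis has linear part C_c and translation part P_1 = (1,
1), and it exchanges P_k with P_{1-k}. -/
theorem genC_mem_affGroup {c : ℝ} (hc : 1 ≤ c) : genC c ∈ (surfS c).affGroup := by
  refine mem_affGroup_of_reversing hc (genC c) rfl !₂[1, 1] 1 fun k => ?_
  have h0 := vert_succ_fst c (-k)
  have h1 := vert_succ_snd c (-k)
  rw [vert_neg_fst, vert_neg_snd, neg_add_eq_sub] at h0 h1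
  ext i
  fin_cases i
  · simp [linAct_fst, genC, h0]
  · simp [linAct_snd, genC, h1]
    ring

/-! ### Horizontal cylinders, their developing strips and the multi-twist -/

noncomputable section

/-- The height of the `n`-th horizontal cylinder, which is also half of its circumference. -/
def cylW (c : ℝ) (n : ℕ) : ℝ := vert c (n + 1) 0 + vert c n 0

theorem cylW_eq (c : ℝ) (n : ℕ) : cylW c n = vert c (n + 1) 1 - vert c n 1 :=
  (vert_snd_sub c n).symm

theorem one_le_cylW {c : ℝ} (hc : 1 ≤ c) (n : ℕ) : 1 ≤ cylW c n := by
  have := vert_snd_step hc n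
  rw [cylW_eq]
  linarith

/-- The strip that is the universal cover of the `n`-th horizontal cylinder. -/
def InStrip (c : ℝ) (n : ℕ) (z : Plane) : Prop := vert c n 1 ≤ z 1 ∧ z 1 ≤ vert c (n + 1) 1

/-- The strip is tiled by trapezoids that develop the pieces of `Q_c^±` in the cylinder. This
affine function is nonnegative to the left of the right side of the `t`-th tile. -/
def tileSide (c : ℝ) (n : ℕ) (t : ℤ) (z : Plane) : ℝ :=
  if Even t then (vert c (n + 1) 0 - vert c n 0) * (z 1 - vert c n 1) +
      cylW c n * (vert c n 0 + t * cylW c n - z 0)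
    else -((vert c (n + 1) 0 - vert c n 0) * (z 1 - vert c n 1)) +
      cylW c n * (vert c (n + 1) 0 + t * cylW c n - z 0)

/-- The point of `Q_c⁺` that corresponds to the point `z` of the `t`-th tile. -/
def tileRep (c : ℝ) (n : ℕ) (t : ℤ) (z : Plane) : Plane :=
  if Even t then !₂[z 0 - t * cylW c n, z 1]
    else !₂[t * cylW c n - z 0, vert c n 1 + vert c (n + 1) 1 - z 1]

/-- The index of the edge of `Q_c⁺` on the right side of the `t`-th tile. -/
def tileEdge (n : ℕ) (t : ℤ) : ℤ := if Even t then n else -n - 1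

theorem not_even_succ {t : ℤ} (h : Even t) : ¬Even (t + 1) := by
  rw [Int.not_even_iff_odd]; exact h.add_one

theorem even_succ {t : ℤ} (h : ¬Even t) : Even (t + 1) := by
  rw [Int.not_even_iff_odd] at h; exact h.add_one

theorem vert_neg_succ (c : ℝ) (n : ℕ) :
    vert c (-n - 1) 0 = -vert c (n + 1) 0 ∧ vert c (-n - 1) 1 = vert c (n + 1) 1 := by
  rw [show -(n : ℤ) - 1 = -(n + 1) by ring]
  exact vert_neg c (n + 1)

theorem edgeFun_tileRep (c : ℝ) (n : ℕ) (t : ℤ) (z : Plane) :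
    edgeFun c (tileEdge n t) (tileRep c n t z) = tileSide c n t z := by
  have hw := cylW_eq c n
  unfold tileEdge tileRep tileSide edgeFun
  split_ifs
  · simp
    rw [← hw]
    ring
  · rw [sub_add_cancel, (vert_neg_succ c n).1, (vert_neg_succ c n).2, vert_neg_fst, vert_neg_snd]
    simp
    linear_combination ((t : ℝ) * cylW c n - z 0 + vert c (n + 1) 0) * (-hw)

/-- Passing the right side of a tile is exactly the gluing along `tileEdge`. So the even tiles,
taken from Q_c⁺, and the odd ones, taken from Q_c⁻, fit together to develop the cylinder. -/
theorem edgeFlip_tileRep (c : ℝ) (n : ℕ) (t : ℤ) (z : Plane) :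
    edgeFlip c (tileEdge n t) (tileRep c n t z) = tileRep c n (t + 1) z := by
  unfold tileEdge tileRep edgeFlip
  by_cases h : Even t
  · simp only [h, not_even_succ h, if_true, if_false]
    ext i
    fin_cases i
    · simp [cylW]; ring
    · simp
  · simp only [h, even_succ h, if_true, if_false]
    ext i
    fin_cases i
    · simp [(vert_neg_succ c n).1, vert_neg_fst, cylW]; ring
    · simp [(vert_neg_succ c n).2, vert_neg_snd]; ring

theorem edgeFun_tileRep_succ (c : ℝ) (n : ℕ) (t : ℤ) (z : Plane) :
    edgeFun c (tileEdge n t) (tileRep c n (t + 1) z) = -tileSide c n t z := by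
  rw [← edgeFlip_tileRep, edgeFun_edgeFlip, edgeFun_tileRep]

theorem tileSide_le_succ {c : ℝ} (hc : 1 ≤ c) {n : ℕ} (t : ℤ) {z : Plane} (hz : InStrip c n z) :
    tileSide c n t z ≤ tileSide c n (t + 1) z := by
  have hw := cylW_eq c n
  have hw1 := one_le_cylW hc n
  have ha := vert_fst_step hc n
  have ha0 := vert_fst_nonneg hc n
  have h1 : 0 ≤ (vert c (n + 1) 0 - vert c n 0) * (z 1 - vert c n 1) :=
    mul_nonneg (by linarith) (by linarith [hz.1])
  have h2 : (vert c (n + 1) 0 - vert c n 0) * (z 1 - vert c n 1) ≤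
      (vert c (n + 1) 0 - vert c n 0) * cylW c n :=
    mul_le_mul_of_nonneg_left (by linarith [hz.2]) (by linarith)
  have h3 : 0 ≤ cylW c n * vert c n 0 := by positivity
  have h4 : cylW c n * cylW c n = cylW c n * (vert c (n + 1) 0 + vert c n 0) := rfl
  unfold tileSide
  by_cases h : Even t
  · simp only [h, not_even_succ h, if_true, if_false]
    push_cast
    nlinarith
  · simp only [h, even_succ h, if_true, if_false]
    push_cast
    nlinarith

theorem tileSide_mono {c : ℝ} (hc : 1 ≤ c) {n : ℕ} {z : Plane} (hz : InStrip c n z) :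
    Monotone fun t => tileSide c n t z :=
  monotone_int_of_le_succ fun t => tileSide_le_succ hc t hz

/-- The point `z` of the strip lies in the `t`-th tile. -/
def InTile (c : ℝ) (n : ℕ) (t : ℤ) (z : Plane) : Prop :=
  InStrip c n z ∧ tileSide c n (t - 1) z ≤ 0 ∧ 0 ≤ tileSide c n t z

theorem InTile.mem {c : ℝ} (hc : 1 ≤ c) {n : ℕ} {t : ℤ} {z : Plane} (h : InTile c n t z) :
    tileRep c n t z ∈ polyQ c := by
  obtain ⟨hz, hl, hr⟩ := h
  have h1 := edgeFun_tileRep c n t z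
  have h2 := edgeFun_tileRep_succ c n (t - 1) z
  rw [sub_add_cancel] at h2
  by_cases ht : Even t
  · have ht' : ¬Even (t - 1) := fun h => not_even_succ h (by rwa [sub_add_cancel])
    simp only [tileEdge, ht, ht', if_true, if_false] at h1 h2
    refine mem_polyQ_of_level hc n ?_ ?_ (by rw [h1]; exact hr) (by rw [h2]; linarith)
    · simpa [tileRep, ht] using hz.1
    · simpa [tileRep, ht] using hz.2
  · have ht' : Even (t - 1) := by
      by_contra h
      have := even_succ h
      rw [sub_add_cancel] at this
      exact ht this
    simp only [tileEdge, ht, ht', if_true, if_false] at h1 h2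
    refine mem_polyQ_of_level hc n ?_ ?_ (by rw [h2]; linarith) (by rw [h1]; exact hr)
    · simp [tileRep, ht]; linarith [hz.2]
    · simp [tileRep, ht]; linarith [hz.1]

/-- The point `x` of `S_c` lies in the `n`-th horizontal cylinder and is covered by the point `z`
of the strip. -/
def Dev (c : ℝ) (n : ℕ) (x : (surfS c).Surface) (z : Plane) : Prop :=
  ∃ t : ℤ, InTile c n t z ∧ IsRep c x (decide (Even t)) (tileRep c n t z)

theorem decide_even_succ (t : ℤ) : decide (Even (t + 1)) = !decide (Even t) := by
  by_cases h : Even t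
  · simp [h, not_even_succ h]
  · simp [h, even_succ h]

theorem IsRep.next_tile {c : ℝ} (hc : 1 ≤ c) {n : ℕ} {t : ℤ} {z : Plane}
    {x : (surfS c).Surface} (h : IsRep c x (decide (Even t)) (tileRep c n t z))
    (h0 : tileSide c n t z = 0) : IsRep c x (decide (Even (t + 1))) (tileRep c n (t + 1) z) := by
  rw [decide_even_succ, ← edgeFlip_tileRep]
  exact h.flip hc (by rw [edgeFun_tileRep, h0])

/-- A point in two tiles lies on all the sides that separate them, so its representatives are
identified by successive gluings. -/
theorem Dev.unique {c : ℝ} (hc : 1 ≤ c) {n : ℕ} {z : Plane} {x y : (surfS c).Surface}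
    (hx : Dev c n x z) (hy : Dev c n y z) : x = y := by
  have key : ∀ (m : ℕ) (t : ℤ) (x y : (surfS c).Surface), InTile c n t z → InTile c n (t + m) z →
      IsRep c x (decide (Even t)) (tileRep c n t z) →
      IsRep c y (decide (Even (t + m))) (tileRep c n (t + m) z) → x = y := by
    intro m
    induction m with
    | zero => intro t x y _ _ h h'; simp at h'; exact h.unique h'
    | succ m ih =>
      intro t x y h1 h2 h h'
      have hle : tileSide c n t z ≤ 0 :=
        (tileSide_mono hc h1.1 (by push_cast; omega : t ≤ t + ((m + 1 : ℕ) : ℤ) - 1)).trans h2.2.1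
      have h0 : tileSide c n t z = 0 := le_antisymm hle h1.2.2
      have e : t + ((m + 1 : ℕ) : ℤ) = t + 1 + m := by push_cast; ring
      rw [e] at h2 h'
      refine ih (t + 1) x y ⟨h1.1, by rw [add_sub_cancel_right]; exact hle, ?_⟩ h2
        (h.next_tile hc h0) h'
      exact h0.symm.le.trans (tileSide_le_succ hc t h1.1)
  obtain ⟨t, ht, hxt⟩ := hx
  obtain ⟨s, hs, hys⟩ := hy
  rcases le_total t s with h | h
  · obtain ⟨m, hm⟩ := Int.eq_ofNat_of_zero_le (sub_nonneg.2 h)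
    obtain rfl : s = t + m := by omega
    exact key m t x y ht hs hxt hys
  · obtain ⟨m, hm⟩ := Int.eq_ofNat_of_zero_le (sub_nonneg.2 h)
    obtain rfl : t = s + m := by omega
    exact (key m s y x hs ht hys hxt).symm

theorem tileSide_shift (c : ℝ) (n : ℕ) (t m : ℤ) (z : Plane) :
    tileSide c n (t + 2 * m) (z + !₂[2 * m * cylW c n, 0]) = tileSide c n t z := by
  have e : Even (t + 2 * m) ↔ Even t := by
    rw [Int.even_add]; simp
  unfold tileSide
  simp only [e]
  split_ifs <;> simp <;> left <;> ring

theorem tileRep_shift (c : ℝ) (n : ℕ) (t m : ℤ) (z : Plane) :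
    tileRep c n (t + 2 * m) (z + !₂[2 * m * cylW c n, 0]) = tileRep c n t z := by
  have e : Even (t + 2 * m) ↔ Even t := by
    rw [Int.even_add]; simp
  unfold tileRep
  simp only [e]
  split_ifs <;> ext i <;> fin_cases i <;> simp <;> ring

theorem Dev.shift {c : ℝ} {n : ℕ} {z : Plane} {x : (surfS c).Surface} (hx : Dev c n x z) (m : ℤ) :
    Dev c n x (z + !₂[2 * m * cylW c n, 0]) := by
  obtain ⟨t, ⟨h1, h2, h3⟩, h⟩ := hx
  have e : Even (t + 2 * m) ↔ Even t := by
    rw [Int.even_add]; simp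
  refine ⟨t + 2 * m, ⟨by simpa [InStrip] using h1, ?_, ?_⟩, ?_⟩
  · rw [show t + 2 * m - 1 = t - 1 + 2 * m by ring, tileSide_shift]; exact h2
  · rw [tileSide_shift]; exact h3
  · rw [tileRep_shift]
    simpa only [e] using h

theorem exists_dev {c : ℝ} (hc : 1 ≤ c) {n : ℕ} {z : Plane} (hz : InStrip c n z) :
    ∃ x, Dev c n x z := by
  have hw := one_le_cylW hc n
  obtain ⟨t, ht⟩ : ∃ t, InTile c n t z := by
    set u := tileSide c n (-1) z with hu
    set w := cylW c n with hwdef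
    have hper : ∀ (t m : ℤ), tileSide c n (t + 2 * m) z = tileSide c n t z + 2 * m * w * w := by
      intro t m
      have e : Even (t + 2 * m) ↔ Even t := by
        rw [Int.even_add]; simp
      unfold tileSide
      simp only [e]
      split_ifs <;> push_cast <;> ring
    -- `tileSide` grows by `2 * w * w` over two tiles. The floor selects the pair of tiles `2 * m`,
    -- `2 * m + 1` whose union contains `z`.
    set m := ⌊-u / (2 * w * w)⌋ with hm
    have hpos : 0 < 2 * w * w := by positivity
    have f1 : (m : ℝ) * (2 * w * w) ≤ -u := (le_div_iff₀ hpos).1 (Int.floor_le _)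
    have f2 : -u < ((m : ℝ) + 1) * (2 * w * w) := (div_lt_iff₀ hpos).1 (Int.lt_floor_add_one _)
    have g1 : tileSide c n (2 * m - 1) z ≤ 0 := by
      have := hper (-1) m
      rw [show (-1 : ℤ) + 2 * m = 2 * m - 1 by ring] at this
      rw [this]; linarith
    have g2 : 0 ≤ tileSide c n (2 * m + 1) z := by
      have := hper (-1) (m + 1)
      rw [show (-1 : ℤ) + 2 * (m + 1) = 2 * m + 1 by ring] at this
      rw [this]; push_cast; linarith
    by_cases h : 0 ≤ tileSide c n (2 * m) z
    · exact ⟨2 * m, hz, g1, h⟩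
    · exact ⟨2 * m + 1, hz, by rw [add_sub_cancel_right]; exact (not_le.1 h).le, g2⟩
  obtain ⟨x, hx⟩ := exists_rep_of_mem (decide (Even t)) (ht.mem hc)
  exact ⟨x, t, ht, hx⟩

theorem StraightPath.symm {c : ℝ} {u : Plane} {x y : (surfS c).Surface} {L : ℝ}
    (h : (surfS c).StraightPath u x y L) : (surfS c).StraightPath (-u) y x L := by
  induction h with
  | nil => exact .nil _
  | @cons x y z s L hs hseg _ ih =>
    rw [add_comm]
    refine ih.append (.single hs ?_)
    rw [smul_neg]
    exact seg_symm hseg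

/-- A straight path can be subdivided. -/
theorem PolygonGluing.StraightPath.glue {G : PolygonGluing} {u : Plane} {x y z : G.Surface} {s : ℝ}
    (hs0 : 0 ≤ s) (hs1 : s ≤ 1) (h : G.StraightPath (s • u) x y 1)
    (h' : G.StraightPath ((1 - s) • u) y z 1) : G.StraightPath u x z 1 := by
  have h1 := h.rescale hs0 rfl
  have h2 := h'.rescale (by linarith) rfl
  have := h1.append h2
  simpa using this

theorem tileSide_combo (c : ℝ) (n : ℕ) (t : ℤ) (s : ℝ) (z z' : Plane) :
    tileSide c n t (z + s • (z' - z)) =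
      (1 - s) * tileSide c n t z + s * tileSide c n t z' := by
  unfold tileSide
  split_ifs <;> simp <;> ring

theorem InStrip.combo {c : ℝ} {n : ℕ} {z z' : Plane} (hz : InStrip c n z) (hz' : InStrip c n z')
    {s : ℝ} (hs0 : 0 ≤ s) (hs1 : s ≤ 1) : InStrip c n (z + s • (z' - z)) := by
  obtain ⟨a1, a2⟩ := hz
  obtain ⟨b1, b2⟩ := hz'
  constructor <;> simp <;> nlinarith

/-- Straight segments in the strip develop to straight paths in `S_c`. -/
theorem Dev.straightPath {c : ℝ} (hc : 1 ≤ c) {n : ℕ} {z z' : Plane} {x x' : (surfS c).Surface}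
    (h : Dev c n x z) (h' : Dev c n x' z') : (surfS c).StraightPath (z' - z) x x' 1 := by
  have key : ∀ (m : ℕ) (t : ℤ) (x x' : (surfS c).Surface) (z z' : Plane),
      InTile c n t z → InTile c n (t + m) z' →
      IsRep c x (decide (Even t)) (tileRep c n t z) →
      IsRep c x' (decide (Even (t + m))) (tileRep c n (t + m) z') →
      (surfS c).StraightPath (z' - z) x x' 1 := by
    have same : ∀ (t : ℤ) (x x' : (surfS c).Surface) (z z' : Plane),
        IsRep c x (decide (Even t)) (tileRep c n t z) →
        IsRep c x' (decide (Even t)) (tileRep c n t z') → (surfS c).Seg x x' (z' - z) := by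
      intro t x x' z z' hx hx'
      convert hx.seg hx' using 1
      unfold tileRep
      by_cases ht : Even t <;> simp only [ht] <;> ext i <;> fin_cases i <;> simp
    intro m
    induction m with
    | zero =>
      intro t x x' z z' _ _ hx hx'
      simp only [Nat.cast_zero, add_zero] at hx'
      exact .single zero_le_one (by rw [one_smul]; exact same t x x' z z' hx hx')
    | succ m ih =>
      intro t x x' z z' h1 h2 hx hx'
      have hle : tileSide c n t z' ≤ 0 :=
        (tileSide_mono hc h2.1 (by push_cast; omega : t ≤ t + ((m + 1 : ℕ) : ℤ) - 1)).trans h2.2.1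
      -- The segment is cut where it meets the right side of the tile `t`; the remainder starts in
      -- the tile `t + 1`.
      obtain ⟨s, hs0, hs1, hs⟩ : ∃ s : ℝ, 0 ≤ s ∧ s ≤ 1 ∧
          (1 - s) * tileSide c n t z + s * tileSide c n t z' = 0 := by
        have h0 := h1.2.2
        rcases hle.eq_or_lt with h | h
        · exact ⟨1, zero_le_one, le_rfl, by rw [h]; ring⟩
        · have hd : 0 < tileSide c n t z - tileSide c n t z' := by linarith
          refine ⟨tileSide c n t z / (tileSide c n t z - tileSide c n t z'), by positivity, ?_, ?_⟩
          · rw [div_le_one hd]; linarith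
          · field_simp; ring
      set y := z + s • (z' - z) with hy
      have hyS : InStrip c n y := h1.1.combo h2.1 hs0 hs1
      have hy0 : tileSide c n t y = 0 := by rw [hy, tileSide_combo, hs]
      have hyT : InTile c n t y := by
        refine ⟨hyS, ?_, hy0.symm.le⟩
        have := tileSide_le_succ hc (t - 1) hyS
        rw [sub_add_cancel] at this
        linarith
      obtain ⟨p, hp⟩ := exists_rep_of_mem (decide (Even t)) (hyT.mem hc)
      have e : t + ((m + 1 : ℕ) : ℤ) = t + 1 + m := by push_cast; ring
      rw [e] at h2 hx'
      have second := ih (t + 1) p x' y z' ⟨hyS, by rw [add_sub_cancel_right, hy0],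
        hy0.symm.le.trans (tileSide_le_succ hc t hyS)⟩ h2 (hp.next_tile hc hy0) hx'
      refine StraightPath.glue hs0 hs1 (y := p)
        (.single zero_le_one (by rw [one_smul]; convert same t x p z y hx hp using 1; simp [hy])) ?_
      convert second using 1
      rw [hy]
      module
  obtain ⟨t, ht, hxt⟩ := h
  obtain ⟨s, hs, hys⟩ := h'
  rcases le_total t s with h | h
  · obtain ⟨m, hm⟩ := Int.eq_ofNat_of_zero_le (sub_nonneg.2 h)
    obtain rfl : s = t + m := by omega
    exact key m t _ _ _ _ ht hs hxt hys
  · obtain ⟨m, hm⟩ := Int.eq_ofNat_of_zero_le (sub_nonneg.2 h)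
    obtain rfl : t = s + m := by omega
    have := StraightPath.symm (key m s _ _ _ _ hs ht hys hxt)
    rwa [neg_sub] at this

end

/-- The horizontal shear of the `n`-th strip, with factor `2 ν`. -/
def stripShear (c : ℝ) (ν : ℤ) (n : ℕ) (z : Plane) : Plane :=
  z + !₂[2 * ν * (z 1 - vert c n 1), 0]

theorem stripShear_snd (c : ℝ) (ν : ℤ) (n : ℕ) (z : Plane) : stripShear c ν n z 1 = z 1 := by
  simp [stripShear]

theorem InStrip.stripShear {c : ℝ} {n : ℕ} {z : Plane} (h : InStrip c n z) (ν : ℤ) :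
    InStrip c n (stripShear c ν n z) := by
  unfold InStrip
  rw [stripShear_snd]
  exact h

theorem stripShear_stripShear (c : ℝ) (ν : ℤ) (n : ℕ) (z : Plane) :
    stripShear c ν n (stripShear c (-ν) n z) = z := by
  ext i
  fin_cases i
  · simp [stripShear]
  · simp [stripShear]

/-- The point of the strip that covers the point `± q` of `Q_c^±` and lies in the tile `0` or
`1`. -/
def stripPt (c : ℝ) (n : ℕ) (i : Bool) (q : Plane) : Plane := if i then q else edgeFlip c n q

theorem tileRep_zero (c : ℝ) (n : ℕ) (z : Plane) : tileRep c n 0 z = z := by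
  ext i; fin_cases i <;> simp [tileRep]

theorem tileRep_one (c : ℝ) (n : ℕ) (z : Plane) : tileRep c n 1 z = edgeFlip c n z := by
  have := edgeFlip_tileRep c n 0 z
  rw [tileRep_zero] at this
  simpa [tileEdge] using this.symm

theorem edgeFlip_snd (c : ℝ) (k : ℤ) (q : Plane) :
    edgeFlip c k q 1 = vert c k 1 + vert c (k + 1) 1 - q 1 := by simp [edgeFlip]

theorem edgeFlip_fst (c : ℝ) (k : ℤ) (q : Plane) :
    edgeFlip c k q 0 = vert c k 0 + vert c (k + 1) 0 - q 0 := by simp [edgeFlip]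

theorem InStrip.stripPt {c : ℝ} {n : ℕ} {q : Plane} (h : InStrip c n q) (i : Bool) :
    InStrip c n (stripPt c n i q) := by
  cases i
  · obtain ⟨h1, h2⟩ := h
    constructor <;> simp only [_root_.stripPt, Bool.false_eq_true, if_false, edgeFlip_snd] <;>
      linarith
  · exact h

theorem IsRep.dev {c : ℝ} (hc : 1 ≤ c) {n : ℕ} {x : (surfS c).Surface} {i : Bool} {q : Plane}
    (h : IsRep c x i q) (hq : InStrip c n q) : Dev c n x (stripPt c n i q) := by
  have r1 := edgeFun_nonneg hc n h.mem
  have r2 := edgeFun_nonneg hc (-n - 1) h.mem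
  cases i
  · refine ⟨1, ⟨hq.stripPt false, ?_, ?_⟩, ?_⟩
    · have := edgeFun_tileRep c n 0 (edgeFlip c n q)
      rw [tileRep_zero, tileEdge, if_pos Even.zero, edgeFun_edgeFlip] at this
      simp only [stripPt, Bool.false_eq_true, if_false, sub_self]
      linarith
    · have := edgeFun_tileRep c n 1 (edgeFlip c n q)
      rw [tileRep_one, edgeFlip_edgeFlip, tileEdge, if_neg (by decide)] at this
      simp only [stripPt, Bool.false_eq_true, if_false]
      linarith
    · simp only [stripPt, Bool.false_eq_true, if_false]
      rw [tileRep_one, edgeFlip_edgeFlip]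
      simpa using h
  · refine ⟨0, ⟨hq.stripPt true, ?_, ?_⟩, ?_⟩
    · have := edgeFun_tileRep_succ c n (-1) q
      rw [show (-1 : ℤ) + 1 = 0 by rfl, tileRep_zero, tileEdge, if_neg (by decide)] at this
      simp only [stripPt, if_true, zero_sub]
      linarith
    · have := edgeFun_tileRep c n 0 q
      rw [tileRep_zero, tileEdge, if_pos Even.zero] at this
      simp only [stripPt, if_true]
      linarith
    · simp only [stripPt, if_true, tileRep_zero]
      simpa using h

theorem stripPt_tileRep (c : ℝ) (n : ℕ) (t : ℤ) (z : Plane) :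
    ∃ m : ℤ, z = stripPt c n (decide (Even t)) (tileRep c n t z) + !₂[2 * m * cylW c n, 0] := by
  by_cases h : Even t
  · obtain ⟨m, hm⟩ := h.two_dvd
    refine ⟨m, ?_⟩
    subst hm
    ext i
    fin_cases i <;> simp [stripPt, tileRep]
  · obtain ⟨m, hm⟩ := (Int.not_even_iff_odd.1 h)
    refine ⟨m, ?_⟩
    have ht : (t : ℝ) = 2 * m + 1 := by rw [hm]; push_cast; ring
    simp only [stripPt, tileRep, h, decide_false, if_false, Bool.false_eq_true]
    ext i
    fin_cases i
    · simp [edgeFlip_fst, ht, cylW]; ring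
    · simp [edgeFlip_snd]

/-- On the boundary of the cylinders the shear is a multiple of a full turn. -/
theorem dev_stripShear_of_boundary {c : ℝ} {n : ℕ} {x : (surfS c).Surface} {z : Plane} (ν : ℤ)
    (h : Dev c n x z) (hz : z 1 = vert c n 1 ∨ z 1 = vert c (n + 1) 1) :
    Dev c n x (stripShear c ν n z) := by
  unfold stripShear
  rcases hz with hz | hz
  · have := h.shift 0
    rw [hz]
    simpa using this
  · have := h.shift ν
    rw [hz, ← cylW_eq]
    exact this

/-- The twist of all horizontal cylinders. -/
theorem exists_twist {c : ℝ} (hc : 1 ≤ c) (ν : ℤ) :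
    ∃ F : (surfS c).Surface → (surfS c).Surface,
      ∀ n x z, Dev c n x z → Dev c n (F x) (stripShear c ν n z) := by
  have hex : ∀ (i : Bool) (q : Plane), ∃ x : (surfS c).Surface, q ∈ polyQ c →
      ∃ n : ℕ, vert c n 1 ≤ q 1 ∧ q 1 < vert c (n + 1) 1 ∧
        Dev c n x (stripShear c ν n (stripPt c n i q)) := by
    intro i q
    by_cases h : q ∈ polyQ c
    · obtain ⟨n, h1, h2⟩ := exists_level hc (snd_nonneg hc h)
      have hs : InStrip c n q := ⟨h1, h2.le⟩
      obtain ⟨x, hx⟩ := exists_dev hc ((hs.stripPt i).stripShear ν)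
      exact ⟨x, fun _ => ⟨n, h1, h2, hx⟩⟩
    · obtain ⟨x, -⟩ := exists_rep_of_mem (c := c) i (vert_mem_polyQ c 0)
      exact ⟨x, fun h' => absurd h' h⟩
  choose g hg using hex
  have hbd : ∀ (n : ℕ) (i : Bool) (q : Plane), (q 1 = vert c n 1 ∨ q 1 = vert c (n + 1) 1) →
      (stripPt c n i q 1 = vert c n 1 ∨ stripPt c n i q 1 = vert c (n + 1) 1) := by
    intro n i q h
    cases i
    · simp only [stripPt, Bool.false_eq_true, if_false, edgeFlip_snd]
      rcases h with h | h <;> rw [h]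
      · right; ring
      · left; ring
    · exact h
  -- At the height of a vertex the twist is the identity. There the shear amounts to a whole number
  -- of turns, seen from the cylinder above or from the one below.
  have hg0 : ∀ (n : ℕ) (i : Bool) (q : Plane) (x : (surfS c).Surface), IsRep c x i q →
      q 1 = vert c n 1 → g i q = x := by
    intro n i q x hx hq
    obtain ⟨m, h1, h2, h3⟩ := hg i q hx.mem
    have hlt : vert c n 1 < vert c (n + 1) 1 := by linarith [vert_snd_step hc n]
    obtain rfl : n = m := level_unique hc hq.ge (by rw [hq]; exact hlt) h1 h2
    exact h3.unique hc (dev_stripShear_of_boundary ν (hx.dev hc ⟨h1, h2.le⟩) (hbd _ i q (Or.inl hq)))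
  -- `g` was defined with half-open levels. A point on the upper boundary of a level was treated in
  -- the next one, and both prescriptions fix it.
  have hglevel : ∀ (n : ℕ) (i : Bool) (q : Plane), q ∈ polyQ c → InStrip c n q →
      Dev c n (g i q) (stripShear c ν n (stripPt c n i q)) := by
    intro n i q hq hs
    rcases hs.2.eq_or_lt with h | h
    · obtain ⟨x, hx⟩ := exists_rep_of_mem i hq
      have := hg0 (n + 1) i q x hx (by push_cast; exact h)
      rw [this]
      exact dev_stripShear_of_boundary ν (hx.dev hc hs) (hbd _ i q (Or.inr h))
    · obtain ⟨m, h1, h2, h3⟩ := hg i q hq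
      obtain rfl : n = m := level_unique hc hs.1 h h1 h2
      exact h3
  obtain ⟨F, hF⟩ := exists_lift (c := c) g (by
    intro k q hq hk
    have hq' := edgeFlip_mem_polyQ hc hq hk
    have hk' : edgeFun c k (edgeFlip c k q) = 0 := by rw [edgeFun_edgeFlip, hk, neg_zero]
    by_cases hv : IsVert c q
    · obtain ⟨x, hx⟩ := exists_rep_of_mem true hq
      have hx' := hx.flip hc hk
      have key : ∀ i r, IsRep c x i r → IsVert c r → g i r = x := by
        rintro i _ hr ⟨j, rfl⟩
        have e : vert c j 1 = vert c (j.natAbs : ℕ) 1 := by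
          rcases Int.natAbs_eq j with h | h
          · conv_lhs => rw [h]
          · conv_lhs => rw [h, vert_neg_snd]
        exact hg0 j.natAbs i _ x hr e
      rw [key _ _ hx hv, ← key _ _ hx' (isVert_edgeFlip hc hk hv)]
      rfl
    · obtain ⟨n, hn⟩ : ∃ n : ℕ, k = n ∨ k = -n - 1 := by
        rcases le_or_gt 0 k with h | h
        · exact ⟨k.toNat, Or.inl (by omega)⟩
        · exact ⟨(-k - 1).toNat, Or.inr (by omega)⟩
      have hseg := mem_segment_of_edgeFun_eq_zero hc hq hk
      have hlt : vert c n 1 < vert c (n + 1) 1 := by linarith [vert_snd_step hc n]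
      have hs : InStrip c n q := by
        obtain ⟨u, v, hu, hv, huv, rfl⟩ := hseg
        obtain rfl : v = 1 - u := by linarith
        rcases hn with rfl | rfl
        · constructor <;> simp <;> nlinarith
        · constructor <;> simp [(vert_neg_succ c n).2, vert_neg_snd] <;> nlinarith
      have hs' : InStrip c n (edgeFlip c k q) := by
        obtain ⟨h1, h2⟩ := hs
        rcases hn with rfl | rfl
        · constructor <;> rw [edgeFlip_snd] <;> linarith
        · constructor <;> rw [edgeFlip_snd, sub_add_cancel, (vert_neg_succ c n).2, vert_neg_snd] <;>
            linarith
      have d1 := hglevel n true q hq hs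
      have d2 := hglevel n false _ hq' hs'
      simp only [stripPt, if_true, Bool.false_eq_true, if_false] at d1 d2
      rcases hn with rfl | rfl
      · rw [edgeFlip_edgeFlip] at d2
        exact d1.unique hc d2
      -- For an edge on the left side of Q_c⁺ the two positions in the strip differ by one
      -- circumference, which the shear does not affect.
      · have e : edgeFlip c n (edgeFlip c (-n - 1) q) = q + !₂[2 * cylW c n, 0] := by
          ext i
          fin_cases i
          · simp [edgeFlip, (vert_neg_succ c n).1, vert_neg_fst, cylW]; ring
          · simp [edgeFlip, (vert_neg_succ c n).2, vert_neg_snd]; ring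
        rw [e] at d2
        have d3 := d1.shift 1
        refine d3.unique hc ?_
        convert d2 using 1
        simp only [stripShear]
        ext i
        fin_cases i
        · simp; ring
        · simp)
  refine ⟨F, fun n x z h => ?_⟩
  obtain ⟨t, ht, hx⟩ := h
  have hz := ht.1
  obtain ⟨m, hm⟩ := stripPt_tileRep c n t z
  have hs : InStrip c n (tileRep c n t z) := by
    obtain ⟨h1, h2⟩ := hz
    unfold tileRep
    split_ifs
    · constructor <;> simpa
    · constructor <;> simp <;> linarith
  have := (hglevel n (decide (Even t)) _ hx.mem hs).shift m
  rw [← hF x _ _ hx] at this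
  convert this using 1
  conv_lhs => rw [hm]
  simp only [stripShear]
  ext i
  fin_cases i
  · simp; ring
  · simp

/-- Within one level the twist is the linear shear of the strip, up to a translation. A longer
segment is cut at the vertex heights it crosses, by induction on a bound `N` for the number of
levels. -/
theorem isAffine_of_twist {c : ℝ} (hc : 1 ≤ c) {A : GL (Fin 2) ℝ} {ν : ℤ}
    (hA : ∀ v, linAct A v = v + !₂[2 * ν * v 1, 0])
    {F F' : (surfS c).Surface → (surfS c).Surface}
    (hF : ∀ n x z, Dev c n x z → Dev c n (F x) (stripShear c ν n z))
    (hF' : ∀ n x z, Dev c n x z → Dev c n (F' x) (stripShear c (-ν) n z)) :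
    Function.LeftInverse F F' ∧ (surfS c).IsAffine A F := by
  have hlevel : ∀ (x : (surfS c).Surface) i q, IsRep c x i q →
      ∃ n, Dev c n x (stripPt c n i q) := by
    intro x i q h
    obtain ⟨n, h1, h2⟩ := exists_level hc (snd_nonneg hc h.mem)
    exact ⟨n, h.dev hc ⟨h1, h2.le⟩⟩
  have inv : Function.LeftInverse F F' ∧ Function.LeftInverse F' F := by
    constructor <;> intro x <;> obtain ⟨i, q, h⟩ := exists_rep x <;>
      obtain ⟨n, hn⟩ := hlevel x i q h
    · have := hF _ _ _ (hF' _ _ _ hn)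
      rw [stripShear_stripShear] at this
      exact this.unique hc hn
    · have := hF' _ _ _ (hF _ _ _ hn)
      have e := stripShear_stripShear c (-ν) n (stripPt c n i q)
      rw [neg_neg] at e
      rw [e] at this
      exact this.unique hc hn
  have fix : ∀ {ν : ℤ} {F : (surfS c).Surface → (surfS c).Surface},
      (∀ n x z, Dev c n x z → Dev c n (F x) (stripShear c ν n z)) →
      ∀ x ∈ (surfS c).vertices, F x = x := by
    intro ν F hF x hx
    obtain ⟨k, hk⟩ := exists_rep_true_of_mem_vertices hc hx
    have e : vert c k 1 = vert c (k.natAbs : ℕ) 1 := by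
      rcases Int.natAbs_eq k with h | h
      · conv_lhs => rw [h]
      · conv_lhs => rw [h, vert_neg_snd]
    have hlt := vert_snd_step hc k.natAbs
    have hs : InStrip c k.natAbs (vert c k) := ⟨e.ge, by rw [e]; linarith⟩
    have h1 := hk.dev hc hs
    exact (hF _ _ _ h1).unique hc (dev_stripShear_of_boundary ν h1 (Or.inl e))
  refine ⟨inv.1, fun x => ⟨fun h => ?_, fun h => by rwa [fix hF x h]⟩, ?_⟩
  · have := fix hF' _ h
    rw [inv.2 x] at this
    rwa [← this] at h
  have level : ∀ (n : ℕ) (i : Bool) (x y : (surfS c).Surface) (q r : Plane), InStrip c n q →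
      InStrip c n r → IsRep c x i q → IsRep c y i r →
      (surfS c).StraightPath (linAct A (sgn i • (r - q))) (F x) (F y) 1 := by
    intro n i x y q r hq hr hx hy
    have := (hF _ _ _ (hx.dev hc hq)).straightPath hc (hF _ _ _ (hy.dev hc hr))
    convert this using 1
    rw [hA]
    cases i
    · ext i
      fin_cases i
      · simp [stripShear, stripPt, edgeFlip]; ring
      · simp [stripShear, stripPt, edgeFlip]
    · ext i
      fin_cases i
      · simp [stripShear, stripPt]; ring
      · simp [stripShear, stripPt]
  have up : ∀ (N n : ℕ) (i : Bool) (x y : (surfS c).Surface) (q r : Plane), InStrip c n q →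
      r 1 ≤ vert c ((n + 1 + N : ℕ) : ℤ) 1 → q 1 ≤ r 1 → IsRep c x i q → IsRep c y i r →
      (surfS c).StraightPath (linAct A (sgn i • (r - q))) (F x) (F y) 1 := by
    intro N
    induction N with
    | zero =>
      intro n i x y q r hq hr hqr hx hy
      exact level n i x y q r hq ⟨hq.1.trans hqr, by simpa using hr⟩ hx hy
    | succ N ih =>
      intro n i x y q r hq hr hqr hx hy
      rcases le_or_gt (r 1) (vert c (n + 1) 1) with h | h
      · exact level n i x y q r hq ⟨hq.1.trans hqr, h⟩ hx hy
      · have hd : 0 < r 1 - q 1 := by linarith [hq.2]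
        set s := (vert c (n + 1) 1 - q 1) / (r 1 - q 1) with hs
        have hs0 : 0 ≤ s := div_nonneg (by linarith [hq.2]) hd.le
        have hs1 : s ≤ 1 := by rw [hs, div_le_one hd]; linarith
        set p : Plane := (1 - s) • q + s • r with hp
        have hp1 : p 1 = vert c (n + 1) 1 := by
          have : s * (r 1 - q 1) = vert c (n + 1) 1 - q 1 := by rw [hs]; field_simp
          simp [hp]
          linarith
        obtain ⟨z, hz⟩ := exists_rep_of_mem i
          (convex_polyQ c hx.mem hy.mem (by linarith : 0 ≤ 1 - s) hs0 (by ring))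
        rw [← hp] at hz
        have hlt := vert_snd_step hc (n + 1)
        push_cast at hlt
        have first := level n i x z q p hq ⟨by rw [hp1]; linarith [hq.1, hq.2], hp1.le⟩ hx hz
        have second := ih (n + 1) i z y p r ⟨by rw [hp1]; push_cast; exact le_rfl,
            by rw [hp1]; push_cast; linarith⟩
          (by rw [show n + 1 + 1 + N = n + 1 + (N + 1) by ring]; exact hr) (by rw [hp1]; exact h.le) hz hy
        refine StraightPath.glue hs0 hs1 (y := F z) ?_ ?_
        · convert first using 1
          rw [← map_smul, smul_comm]
          congr 2
          rw [hp]; module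
        · convert second using 1
          rw [← map_smul, smul_comm]
          congr 2
          rw [hp]; module
  have upward : ∀ (i : Bool) (x y : (surfS c).Surface) (q r : Plane), q 1 ≤ r 1 →
      IsRep c x i q → IsRep c y i r →
      (surfS c).StraightPath (linAct A (sgn i • (r - q))) (F x) (F y) 1 := by
    intro i x y q r hqr hx hy
    obtain ⟨n, h1, h2⟩ := exists_level hc (snd_nonneg hc hx.mem)
    obtain ⟨N, hN⟩ := exists_nat_gt (r 1)
    refine up N n i x y q r ⟨h1, h2.le⟩ ?_ hqr hx hy
    have := le_vert_snd hc (n + 1 + N)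
    push_cast at this ⊢
    have hn : (0 : ℝ) ≤ n := by positivity
    linarith
  intro x y v h
  obtain ⟨i, q, r, hq, hr, rfl⟩ := seg_iff.1 h
  rcases le_total (q 1) (r 1) with h | h
  · exact upward i x y q r h hq hr
  · have := StraightPath.symm (upward i y x r q h hr hq)
    convert this using 1
    rw [← map_neg, ← smul_neg, neg_sub]

/-- The product `genA * genB` is the shear (x, y) ↦ (x - 2y, y), the derivative of the twist with ν
= -1; the twist with ν = 1 is its inverse. -/
theorem genB_mem_affGroup {c : ℝ} (hc : 1 ≤ c) : genB ∈ (surfS c).affGroup := by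
  have hM : ∀ v, linAct (genA * genB) v = v + !₂[2 * ((-1 : ℤ) : ℝ) * v 1, 0] := by
    intro v
    rw [linAct_mul]
    ext i
    fin_cases i
    · simp [linAct_fst, linAct_snd, genA, genB]; ring
    · simp [linAct_snd, genA, genB]
  have hM' : ∀ v, linAct (genA * genB)⁻¹ v = v + !₂[2 * ((1 : ℤ) : ℝ) * v 1, 0] := by
    intro v
    conv_rhs => rw [← linAct_inv_apply (genA * genB) (v + !₂[2 * ((1 : ℤ) : ℝ) * v 1, 0]), hM]
    congr 1
    ext i
    fin_cases i <;> simp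
  obtain ⟨F, hF⟩ := exists_twist hc (-1)
  obtain ⟨F', hF'⟩ := exists_twist hc 1
  obtain ⟨l1, a1⟩ := isAffine_of_twist hc hM hF (by simpa using hF')
  obtain ⟨l2, a2⟩ := isAffine_of_twist hc hM' hF' hF
  have : genA * genB ∈ (surfS c).affGroup := ⟨⟨F, F', l2, l1⟩, a1, a2⟩
  have h2 := mul_mem (inv_mem (genA_mem_affGroup hc)) this
  rwa [inv_mul_cancel_left] at h2

theorem closure_subset_veechGroup {c : ℝ} (hc : 1 ≤ c) :
    (Subgroup.closure ({-1, genA, genB, genC c} : Set (GL (Fin 2) ℝ)) : Set (GL (Fin 2) ℝ)) ⊆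
      (surfS c).veechGroup := by
  refine subset_trans ?_ (affGroup_le_veechGroup hc)
  rw [SetLike.coe_subset_coe, Subgroup.closure_le]
  rintro g (rfl | rfl | rfl | rfl)
  · exact neg_one_mem_affGroup hc
  · exact genA_mem_affGroup hc
  · exact genB_mem_affGroup hc
  · exact genC_mem_affGroup hc

/-! ### Following geodesics, and explicit closed geodesics -/

theorem vert_one (c : ℝ) : vert c 1 0 = 1 ∧ vert c 1 1 = 1 := by
  have h0 := vert_succ_fst c 0
  have h1 := vert_succ_snd c 0
  simp [vert_zero] at h0 h1
  exact ⟨h0, h1⟩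

theorem vert_two (c : ℝ) : vert c 2 0 = 2 * c ∧ vert c 2 1 = 2 * c + 2 := by
  have h0 := vert_succ_fst c 1
  have h1 := vert_succ_snd c 1
  rw [(vert_one c).1, (vert_one c).2] at h0 h1
  exact ⟨by rw [show (2 : ℤ) = 1 + 1 by rfl, h0]; ring,
    by rw [show (2 : ℤ) = 1 + 1 by rfl, h1]; ring⟩

theorem vert_three (c : ℝ) :
    vert c 3 0 = 4 * c ^ 2 - 1 ∧ vert c 3 1 = 4 * c ^ 2 + 4 * c + 1 := by
  have h0 := vert_succ_fst c 2
  have h1 := vert_succ_snd c 2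
  rw [(vert_two c).1, (vert_two c).2] at h0 h1
  exact ⟨by rw [show (3 : ℤ) = 2 + 1 by rfl, h0]; ring,
    by rw [show (3 : ℤ) = 2 + 1 by rfl, h1]; ring⟩

theorem seg_self {c : ℝ} (x : (surfS c).Surface) : (surfS c).Seg x x 0 := by
  obtain ⟨i, q, hq⟩ := exists_rep x
  simpa using hq.seg hq

/-- The points of a segment. -/
theorem exists_seg_param {c : ℝ} {x z : (surfS c).Surface} {u : Plane} {a : ℝ} (ha : 0 ≤ a)
    (h : (surfS c).Seg x z (a • u)) : ∃ X : ℝ → (surfS c).Surface, X 0 = x ∧ X a = z ∧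
      ∀ s ∈ Set.Icc 0 a, ∀ t ∈ Set.Icc 0 a, (surfS c).Seg (X s) (X t) ((t - s) • u) := by
  obtain ⟨i, q, r, hq, hr, e⟩ := seg_iff.1 h
  rcases ha.eq_or_lt with rfl | ha
  · have hqr : q = r := by
      rw [zero_smul, eq_comm, smul_eq_zero, sub_eq_zero] at e
      exact (e.resolve_left (sgn_ne_zero i)).symm
    subst hqr
    refine ⟨fun _ => x, rfl, hq.unique hr, fun s hs t ht => ?_⟩
    rw [le_antisymm hs.2 hs.1, le_antisymm ht.2 ht.1]
    simpa using seg_self x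
  have hex : ∀ t : ℝ, ∃ y, t ∈ Set.Icc 0 a → IsRep c y i ((1 - t / a) • q + (t / a) • r) := by
    intro t
    by_cases ht : t ∈ Set.Icc 0 a
    · have h1 : t / a ≤ 1 := (div_le_one ha).2 ht.2
      obtain ⟨y, hy⟩ := exists_rep_of_mem i (convex_polyQ c hq.mem hr.mem
        (by linarith : 0 ≤ 1 - t / a) (div_nonneg ht.1 ha.le) (by ring))
      exact ⟨y, fun _ => hy⟩
    · exact ⟨x, fun h => absurd h ht⟩
  choose X hX using hex
  refine ⟨X, (hX 0 ⟨le_rfl, ha.le⟩).unique (by simpa using hq),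
    (hX a ⟨ha.le, le_rfl⟩).unique (by simpa [ha.ne'] using hr), fun s hs t ht => ?_⟩
  convert (hX s hs).seg (hX t ht) using 1
  have : u = a⁻¹ • sgn i • (r - q) := by rw [← e, smul_smul, inv_mul_cancel₀ ha.ne', one_smul]
  rw [this, smul_smul, smul_comm]
  congr 1
  rw [div_eq_mul_inv, div_eq_mul_inv]
  module

/-- A geodesic that starts in the direction of a segment follows the segment. -/
theorem Geod.follow {c : ℝ} (hc : 1 ≤ c) {u : Plane} {x y : (surfS c).Surface} {L : ℝ}
    (h : (surfS c).Geod u x y L) : ∀ {z : (surfS c).Surface} {a : ℝ}, 0 ≤ a →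
      z ∉ (surfS c).vertices → (surfS c).Seg x z (a • u) →
      (L ≤ a ∧ (surfS c).Seg x y (L • u)) ∨ (a ≤ L ∧ (surfS c).Geod u z y (L - a)) := by
  induction h with
  | nil x hx =>
    intro z a ha hz hs
    exact Or.inl ⟨ha, by simpa using seg_self x⟩
  | @cons x y w s L hx hs hseg hpath ih =>
    intro z a ha hz hxz
    have hL := hpath.nonneg
    rcases le_total s a with hsa | hsa
    · obtain ⟨X, h0, h1, hX⟩ := exists_seg_param ha hxz
      have hy : X s = y := by
        refine seg_unique hc hx ?_ hseg
        have := hX 0 ⟨le_rfl, ha⟩ s ⟨hs.le, hsa⟩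
        rwa [h0, sub_zero] at this
      have hyz := hX s ⟨hs.le, hsa⟩ a ⟨ha, le_rfl⟩
      rw [hy, h1] at hyz
      rcases ih (sub_nonneg.2 hsa) hz hyz with ⟨h2, h3⟩ | ⟨h2, h3⟩
      · refine Or.inl ⟨by linarith, ?_⟩
        have hw : X (s + L) = w := by
          refine seg_unique hc hpath.left ?_ h3
          have := hX s ⟨hs.le, hsa⟩ (s + L) ⟨by linarith, by linarith⟩
          rwa [hy, add_sub_cancel_left] at this
        have := hX 0 ⟨le_rfl, ha⟩ (s + L) ⟨by linarith, by linarith⟩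
        rwa [h0, hw, sub_zero] at this
      · refine Or.inr ⟨by linarith, ?_⟩
        convert h3 using 1
        ring
    · obtain ⟨X, h0, h1, hX⟩ := exists_seg_param hs.le hseg
      have hy : X a = z := by
        refine seg_unique hc hx ?_ hxz
        have := hX 0 ⟨le_rfl, hs.le⟩ a ⟨ha, hsa⟩
        rwa [h0, sub_zero] at this
      refine Or.inr ⟨by linarith, ?_⟩
      have hzy := hX a ⟨ha, hsa⟩ s ⟨hs.le, le_rfl⟩
      rw [hy, h1] at hzy
      rcases hsa.eq_or_lt with rfl | hlt
      · have : z = y := seg_unique hc hx hxz hseg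
        subst this
        simpa using hpath
      · have := Geod.cons hz (sub_pos.2 hlt) hzy hpath
        convert this using 1
        ring

/-- The midpoint of the `k`-th edge. -/
noncomputable def edgeMid (c : ℝ) (k : ℤ) : Plane :=
  (1 / 2 : ℝ) • vert c k + (1 / 2 : ℝ) • vert c (k + 1)

theorem edgeMid_mem (c : ℝ) (k : ℤ) : edgeMid c k ∈ polyQ c :=
  convex_polyQ c (vert_mem_polyQ c _) (vert_mem_polyQ c _) (by norm_num) (by norm_num) (by norm_num)

theorem edgeFun_edgeMid (c : ℝ) (k : ℤ) : edgeFun c k (edgeMid c k) = 0 := by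
  unfold edgeMid
  rw [edgeFun_combo _ _ _ _ _ _ (by norm_num), edgeFun_vert_left, edgeFun_vert_right]
  ring

theorem not_isVert_edgeMid {c : ℝ} (hc : 1 ≤ c) (k : ℤ) : ¬IsVert c (edgeMid c k) := by
  rintro ⟨j, hj⟩
  have h := congrArg (fun p : Plane => p 0) hj
  simp [edgeMid] at h
  have h1 := vert_fst_step hc k
  rcases le_or_gt j k with h' | h'
  · have := (vert_fst_strictMono hc).monotone h'
    simp only at this
    linarith
  · have := (vert_fst_strictMono hc).monotone (show k + 1 ≤ j by omega)
    simp only at this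
    linarith

theorem edgeFlip_edgeMid (c : ℝ) (k : ℤ) : edgeFlip c k (edgeMid c k) = edgeMid c k := by
  unfold edgeFlip edgeMid
  module

theorem exists_rep_edgeMid {c : ℝ} (hc : 1 ≤ c) (k : ℤ) : ∃ x : (surfS c).Surface,
    x ∉ (surfS c).vertices ∧ (∀ i, IsRep c x i (edgeMid c k)) ∧
      ∀ i q, IsRep c x i q → q = edgeMid c k := by
  obtain ⟨x, hx⟩ := exists_rep_of_mem true (edgeMid_mem c k)
  have hv : x ∉ (surfS c).vertices := fun h =>
    not_isVert_edgeMid hc k ((mem_vertices_iff hc hx).1 h)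
  refine ⟨x, hv, ?_, ?_⟩
  · intro i
    cases i
    · have := hx.flip hc (edgeFun_edgeMid c k)
      rwa [edgeFlip_edgeMid] at this
    · exact hx
  · intro i q hq
    rcases hx.eq_or_flip hc hv hq with ⟨-, h⟩ | ⟨-, j, hj, h⟩
    · exact h
    · by_cases hjk : j = k
      · rw [h, hjk, edgeFlip_edgeMid]
      · exact absurd (isVert_of_two_edges hc hjk (edgeMid_mem c k) hj (edgeFun_edgeMid c k))
          (not_isVert_edgeMid hc k)

/-- Midpoints are fixed by their edge flips. The segment between two midpoints in Q_c⁺ continues in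
Q_c⁻ along its own reflection with the same displacement, and so it closes up after twice its
length. -/
theorem geod_edgeMid {c : ℝ} {j k : ℤ} {x y : (surfS c).Surface} (hx : x ∉ (surfS c).vertices)
    (hy : y ∉ (surfS c).vertices) (hxr : ∀ i, IsRep c x i (edgeMid c j))
    (hyr : ∀ i, IsRep c y i (edgeMid c k)) {u : Plane} {s : ℝ} (hs : 0 < s)
    (hu : edgeMid c k - edgeMid c j = s • u) :
    (surfS c).Seg x y (s • u) ∧ (surfS c).Seg y x (s • u) ∧ (surfS c).Geod u x x (2 * s) := by
  have h1 : (surfS c).Seg x y (s • u) := by simpa [← hu] using (hxr true).seg (hyr true)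
  have h2 : (surfS c).Seg y x (s • u) := by simpa [← hu] using (hyr false).seg (hxr false)
  refine ⟨h1, h2, ?_⟩
  rw [two_mul]
  exact .cons hx hs h1 (.single hy hx hs h2)

theorem two_zero_mem_closedHol {c : ℝ} (hc : 1 ≤ c) : !₂[2, 0] ∈ closedHol c := by
  obtain ⟨x, hx, hxr, -⟩ := exists_rep_edgeMid hc (-1)
  obtain ⟨y, hy, hyr, -⟩ := exists_rep_edgeMid hc 0
  refine ⟨fun h => ?_, x, ?_⟩
  · have := congrArg (fun p : Plane => p 0) h
    simp at this
  · have := (geod_edgeMid hx hy hxr hyr (s := 1 / 2) (u := !₂[2, 0]) (by norm_num) ?_).2.2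
    · simpa using this
    · ext i
      fin_cases i
      · simp [edgeMid, vert_zero, vert_neg_fst, (vert_one c).1]; norm_num
      · simp [edgeMid, vert_zero, vert_neg_snd]

theorem diag_mem_closedHol {c : ℝ} (hc : 1 ≤ c) : !₂[2 * c + 2, 2 * c + 2] ∈ closedHol c := by
  obtain ⟨x, hx, hxr, -⟩ := exists_rep_edgeMid hc (-1)
  obtain ⟨y, hy, hyr, -⟩ := exists_rep_edgeMid hc 1
  refine ⟨fun h => ?_, x, ?_⟩
  · have := congrArg (fun p : Plane => p 0) h
    simp at this
    linarith
  · have := (geod_edgeMid hx hy hxr hyr (s := 1 / 2) (u := !₂[2 * c + 2, 2 * c + 2])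
      (by norm_num) ?_).2.2
    · simpa using this
    · ext i
      fin_cases i
      · simp [edgeMid, vert_zero, vert_neg_fst, (vert_one c).1, (vert_two c).1]; ring
      · simp [edgeMid, vert_zero, vert_neg_snd, (vert_one c).2, (vert_two c).2]

/-- The witness is the diagonal geodesic through the midpoints of the edges `-2` and `2`. It
consists of one segment with displacement c • u in each polygon, and following these segments shows
that it does not return to `x` earlier. This is what distinguishes the diagonal from the horizontal
direction. -/
theorem diag_mem_primHol {c : ℝ} (hc : 1 ≤ c) : !₂[2 * c + 2, 2 * c + 2] ∈ primHol c := by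
  obtain ⟨x, hx, hxr, hxu⟩ := exists_rep_edgeMid hc (-2)
  obtain ⟨y, hy, hyr, hyu⟩ := exists_rep_edgeMid hc 2
  set u : Plane := !₂[2 * c + 2, 2 * c + 2] with hu
  have hu0 : u 0 ≠ 0 := by simp [hu]; linarith
  have hw : edgeMid c 2 - edgeMid c (-2) = c • u := by
    ext i
    fin_cases i
    · simp [edgeMid, hu, vert_neg_fst, (vert_one c).1, (vert_two c).1, (vert_three c).1]; ring
    · simp [edgeMid, hu, vert_neg_snd, (vert_one c).2, (vert_two c).2, (vert_three c).2]; ring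
  obtain ⟨h1, h2, h3⟩ := geod_edgeMid hx hy hxr hyr (by linarith : 0 < c) hw
  have coord : ∀ {s t : ℝ}, s • u = t • u → s = t := by
    intro s t h
    have := congrArg (fun p : Plane => p 0) h
    simpa [hu0] using this
  refine ⟨x, h3, fun s hs hs2 h => ?_⟩
  rcases Geod.follow hc h (by linarith : 0 ≤ c) hy h1 with ⟨-, h4⟩ | ⟨h4, h5⟩
  · obtain ⟨i, q, r, hq, hr, e⟩ := seg_iff.1 h4
    rw [hxu i q hq, hxu i r hr, sub_self, smul_zero, ← zero_smul ℝ u] at e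
    exact hs.ne' (coord e)
  · rcases Geod.follow hc h5 (by linarith : 0 ≤ c) hx h2 with ⟨-, h6⟩ | ⟨h6, -⟩
    · obtain ⟨i, q, r, hq, hr, e⟩ := seg_iff.1 h6
      rw [hyu i q hq, hxu i r hr, ← neg_sub (edgeMid c 2) (edgeMid c (-2)), hw, ← neg_smul, smul_smul] at e
      have := coord e
      cases i
      · simp at this; linarith
      · simp at this; linarith
    · linarith

/-! ### Constraints on the holonomy of closed geodesics -/

theorem neg_mem_closedHol {c : ℝ} (hc : 1 ≤ c) {v : Plane} (hv : v ∈ closedHol c) :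
    -v ∈ closedHol c := by
  have := veechGroup_subset_holStab hc (affGroup_le_veechGroup hc (neg_one_mem_affGroup hc))
  have h := (this.1 v).2 hv
  convert h using 1
  ext i
  fin_cases i
  · simp [linAct_fst]
  · simp [linAct_snd]

/-- There are no closed geodesics in the directions of the cone that is contained in `Q_c⁺`. -/
theorem closedHol_quadratic {c : ℝ} (hc : 1 ≤ c) {v : Plane} (hv : v ∈ closedHol c)
    (hv1 : v 1 ≠ 0) : (c - 1) * v 1 ^ 2 < (c + 1) * v 0 ^ 2 := by
  suffices H : ∀ v ∈ closedHol c, 0 < v 1 → (c - 1) * v 1 ^ 2 < (c + 1) * v 0 ^ 2 by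
    rcases lt_or_gt_of_ne hv1 with h | h
    · have := H (-v) (neg_mem_closedHol hc hv) (by simpa using h)
      simpa using this
    · exact H v hv h
  clear hv hv1 v
  rintro v ⟨hv0, x, hx⟩ hv1
  by_contra! hcon
  -- By `edge_quadratic` every edge is strictly less steep than the asymptotes of the hyperbola,
  -- while `v` is at least as steep. So `v` points into Q_c⁺ across every edge, and a geodesic in
  -- Q_c⁺ never leaves it.
  have up : ∀ k, 0 < (vert c (k + 1) 0 - vert c k 0) * v 1 -
      (vert c (k + 1) 1 - vert c k 1) * v 0 := by
    intro k
    have hq := edge_quadratic c k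
    have hstep := vert_fst_step hc k
    set ex := vert c (k + 1) 0 - vert c k 0 with hex
    set ey := vert c (k + 1) 1 - vert c k 1 with hey
    have hpos : 0 < ex * v 1 := mul_pos (by linarith) hv1
    have hsq : (ey * v 0) ^ 2 < (ex * v 1) ^ 2 := by
      have h1 : (c + 1) * (ey * v 0) ^ 2 ≤ (c - 1) * ey ^ 2 * v 1 ^ 2 := by
        have := mul_le_mul_of_nonneg_left hcon (sq_nonneg ey)
        nlinarith
      have h2 : (c - 1) * ey ^ 2 * v 1 ^ 2 < (c + 1) * (ex * v 1) ^ 2 := by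
        have : 0 < v 1 ^ 2 := by positivity
        have e : (c + 1) * (ex * v 1) ^ 2 = (c - 1) * ey ^ 2 * v 1 ^ 2 + 2 * v 1 ^ 2 := by
          linear_combination -(v 1 ^ 2) * hq
        linarith
      exact lt_of_mul_lt_mul_left (h1.trans_lt h2) (by linarith)
    have := abs_lt_of_sq_lt_sq hsq hpos.le
    linarith [(abs_lt.1 this).2]
  have segTrue : ∀ {x y : (surfS c).Surface} {q : Plane} {s : ℝ}, x ∉ (surfS c).vertices → 0 < s → IsRep c x true q →
      (surfS c).Seg x y (s • v) → IsRep c y true (q + s • v) := by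
    intro x y q s hx hs hq h
    obtain ⟨i, p, r, hp, hr, e⟩ := seg_iff.1 h
    rcases hq.eq_or_flip hc hx hp with ⟨rfl, rfl⟩ | ⟨rfl, k, hk, rfl⟩
    · rw [e]; simpa using hr
    · exfalso
      have hr' : r = edgeFlip c k q + (-s) • v := by
        rw [neg_smul, e]; simp
      have h1 := edgeFun_nonneg hc k hr.mem
      rw [hr', edgeFun_add, edgeFun_edgeFlip, hk] at h1
      have := mul_pos hs (up k)
      simp at h1
      linarith
  have stayTrue : ∀ {x y L}, (surfS c).Geod v x y L → ∀ q, IsRep c x true q →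
      IsRep c y true (q + L • v) := by
    intro x y L h
    induction h with
    | nil x hx => intro q hq; simpa using hq
    | cons hx hs hseg _ ih =>
      intro q hq
      have := ih _ (segTrue hx hs hq hseg)
      rwa [add_assoc, ← add_smul] at this
  have hxv := hx.left
  have noTrue : ∀ q, ¬IsRep c x true q := by
    intro q hq
    have := stayTrue hx q hq
    rcases hq.eq_or_flip hc hxv this with ⟨-, h⟩ | ⟨h, -⟩
    · simp at h; exact hv0 h
    · simp at h
  -- A geodesic that starts in Q_c⁻ either remains on a straight line there or enters Q_c⁺ for good;
  -- neither closes up.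
  have stayFalse : ∀ {x y L}, (surfS c).Geod v x y L → ∀ q, IsRep c x false q →
      IsRep c y false (q - L • v) ∨ ∃ p, IsRep c y true p := by
    intro x y L h
    induction h with
    | nil x hx => intro q hq; left; simpa using hq
    | @cons x y z s L hx hs hseg hpath ih =>
      intro q hq
      obtain ⟨i, p, r, hp, hr, e⟩ := seg_iff.1 hseg
      rcases hq.eq_or_flip hc hx hp with ⟨rfl, rfl⟩ | ⟨rfl, k, hk, rfl⟩
      · have := ih r hr
        rwa [show r - L • v = p - (s + L) • v by rw [add_smul, e]; simp; abel] at this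
      · exact Or.inr ⟨_, stayTrue hpath _ hr⟩
  obtain ⟨i, q, hq⟩ := exists_rep x
  cases i
  · rcases stayFalse hx q hq with h | ⟨p, hp⟩
    · rcases hq.eq_or_flip hc hxv h with ⟨-, h⟩ | ⟨h, -⟩
      · simp at h; exact hv0 h
      · simp at h
    · exact noTrue p hp
  · exact noTrue q hq

/-- A point in the interior of an edge lies strictly between the heights of two consecutive
vertices. -/
theorem edge_level {c : ℝ} (hc : 1 ≤ c) {q : Plane} (hq : q ∈ polyQ c) (hv : ¬IsVert c q) {k : ℤ}
    (hk : edgeFun c k q = 0) : ∃ n : ℕ, (k = n ∨ k = -n - 1) ∧ vert c n 1 < q 1 ∧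
      q 1 < vert c (n + 1) 1 := by
  obtain ⟨u, v, hu, hv', huv, rfl⟩ := mem_segment_of_edgeFun_eq_zero hc hq hk
  have hu0 : 0 < u := by
    rcases hu.eq_or_lt with h | h
    · subst h
      obtain rfl : v = 1 := by linarith
      exact absurd ⟨k + 1, by simp⟩ hv
    · exact h
  have hv0 : 0 < v := by
    rcases hv'.eq_or_lt with h | h
    · subst h
      obtain rfl : u = 1 := by linarith
      exact absurd ⟨k, by simp⟩ hv
    · exact h
  obtain rfl : v = 1 - u := by linarith
  rcases le_or_gt 0 k with h | h
  · obtain ⟨n, rfl⟩ := Int.eq_ofNat_of_zero_le h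
    have := vert_snd_step hc n
    refine ⟨n, Or.inl rfl, ?_, ?_⟩ <;> simp <;> nlinarith
  · obtain ⟨n, hn⟩ := Int.eq_ofNat_of_zero_le (show 0 ≤ -k - 1 by omega)
    obtain rfl : k = -n - 1 := by omega
    have := vert_snd_step hc n
    refine ⟨n, Or.inr rfl, ?_, ?_⟩ <;>
      simp [(vert_neg_succ c n).2, vert_neg_snd] <;> nlinarith

theorem edgeFlip_snd_of_level {c : ℝ} {k : ℤ} {n : ℕ} (h : k = n ∨ k = -n - 1) (q : Plane) :
    edgeFlip c k q 1 = vert c n 1 + vert c (n + 1) 1 - q 1 := by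
  rcases h with rfl | rfl
  · rw [edgeFlip_snd]
  · rw [edgeFlip_snd, (vert_neg_succ c n).2, sub_add_cancel, vert_neg_snd]
    ring

/-- A height function on the surface that is additive along the segments in `Q_c⁻`. -/
def HeightAt (c : ℝ) (x : (surfS c).Surface) (h : ℝ) : Prop :=
  (∃ q, IsRep c x false q ∧ h = -q 1) ∨ ∃ (q : Plane) (n : ℕ), IsRep c x true q ∧
    vert c n 1 ≤ q 1 ∧ q 1 < vert c (n + 1) 1 ∧ h = q 1 - vert c n 1 - vert c (n + 1) 1

/-- On Q_c⁻ this is the ordinary height. On Q_c⁺ it is the height lowered by b_n + b_{n+1} on the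
n-th level, the amount by which gluing along the edges `n` and `-n - 1` changes heights. -/
theorem HeightAt.unique {c : ℝ} (hc : 1 ≤ c) {x : (surfS c).Surface} (hx : x ∉ (surfS c).vertices)
    {h h' : ℝ} (H : HeightAt c x h) (H' : HeightAt c x h') : h = h' := by
  have mixed : ∀ {q r : Plane} {n : ℕ}, IsRep c x false q → IsRep c x true r →
      vert c n 1 ≤ r 1 → r 1 < vert c (n + 1) 1 → -q 1 = r 1 - vert c n 1 - vert c (n + 1) 1 := by
    intro q r n hq hr h1 h2
    rcases hr.eq_or_flip hc hx hq with ⟨h, -⟩ | ⟨-, k, hk, rfl⟩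
    · simp at h
    · obtain ⟨m, hm, h3, h4⟩ :=
        edge_level hc hr.mem (fun h => hx ((mem_vertices_iff hc hr).2 h)) hk
      rw [edgeFlip_snd_of_level hm, level_unique hc h1 h2 h3.le h4]
      ring
  rcases H with ⟨q, hq, rfl⟩ | ⟨q, n, hq, h1, h2, rfl⟩
  · rcases H' with ⟨r, hr, rfl⟩ | ⟨r, m, hr, h3, h4, rfl⟩
    · rcases hq.eq_or_flip hc hx hr with ⟨-, rfl⟩ | ⟨h, -⟩
      · rfl
      · simp at h
    · exact mixed hq hr h3 h4
  · rcases H' with ⟨r, hr, rfl⟩ | ⟨r, m, hr, h3, h4, rfl⟩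
    · exact (mixed hr hq h1 h2).symm
    · rcases hq.eq_or_flip hc hx hr with ⟨-, rfl⟩ | ⟨h, -⟩
      · rw [level_unique hc h1 h2 h3 h4]
      · simp at h

theorem exists_heightAt {c : ℝ} (hc : 1 ≤ c) (x : (surfS c).Surface) : ∃ h, HeightAt c x h := by
  obtain ⟨i, q, hq⟩ := exists_rep x
  cases i
  · exact ⟨_, Or.inl ⟨q, hq, rfl⟩⟩
  · obtain ⟨n, h1, h2⟩ := exists_level hc (snd_nonneg hc hq.mem)
    exact ⟨_, Or.inr ⟨q, n, hq, h1, h2, rfl⟩⟩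

/-- The possible heights of closed geodesics. -/
def heightMonoid (c : ℝ) : AddSubmonoid ℝ :=
  AddSubmonoid.closure (Set.range fun n : ℕ => vert c (n + 2 : ℕ) 1 - vert c n 1)

theorem monotone_height {c : ℝ} (hc : 1 ≤ c) :
    Monotone fun n : ℕ => vert c (n + 2 : ℕ) 1 - vert c n 1 := by
  refine monotone_nat_of_le_succ fun n => ?_
  have h0 := vert_snd_sub c n
  have h2 := vert_snd_sub c (n + 2)
  have f0 := vert_fst_step hc n
  have f1 := vert_fst_step hc (n + 1)
  have f2 := vert_fst_step hc (n + 2)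
  rw [show (n : ℤ) + 1 + 1 = n + 2 by ring] at f1
  push_cast
  rw [show (n : ℤ) + 1 + 2 = n + 2 + 1 by ring]
  linarith

/-- The generators are nonnegative and form a nondecreasing sequence, and a well-ordered set of
nonnegative reals generates a well-ordered monoid. This gives termination of the descent for every
real c. -/
theorem isPWO_heightMonoid {c : ℝ} (hc : 1 ≤ c) : (heightMonoid c : Set ℝ).IsPWO := by
  refine Set.IsPWO.addSubmonoid_closure ?_ ?_
  · rintro _ ⟨n, rfl⟩
    exact sub_nonneg.2 ((vert_snd_strictMono hc).monotone (by omega : n ≤ n + 2))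
  · rw [← Set.image_univ]
    exact (Set.isPWO_iff_isWF.2 (Set.IsWF.of_wellFoundedLT _)).image_of_monotone
      (monotone_height hc)

theorem le_of_mem_heightMonoid {c : ℝ} (hc : 1 ≤ c) {t : ℝ} (ht : t ∈ heightMonoid c) (h0 : t ≠ 0) :
    2 * c + 2 ≤ t := by
  suffices H : t = 0 ∨ 2 * c + 2 ≤ t from H.resolve_left h0
  refine AddSubmonoid.closure_induction ?_ (Or.inl rfl) ?_ ht
  · rintro _ ⟨n, rfl⟩
    right
    have := monotone_height hc (Nat.zero_le n)
    simp only [CharP.cast_eq_zero, vert_zero_apply, zero_add, Nat.cast_ofNat, (vert_two c).2] at this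
    linarith
  · rintro x y - - (rfl | hx) (rfl | hy)
    · simp
    · right; linarith
    · right; linarith
    · right; linarith

theorem sum_mem_heightMonoid (c : ℝ) (n d : ℕ) :
    vert c (n + d : ℕ) 1 + vert c (n + d + 1 : ℕ) 1 - vert c n 1 - vert c (n + 1 : ℕ) 1 ∈
      heightMonoid c := by
  induction d with
  | zero => simp
  | succ d ih =>
    have h := AddSubmonoid.add_mem _ ih (AddSubmonoid.subset_closure ⟨n + d, rfl⟩ :
      vert c (n + d + 2 : ℕ) 1 - vert c (n + d : ℕ) 1 ∈ heightMonoid c)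
    convert h using 1
    rw [show n + (d + 1) = n + d + 1 by ring]
    ring

/-- In Q_c⁻ the height increases by the vertical displacement. In Q_c⁺ the increase falls short of
it by a telescoping sum of differences b_{j+2} - b_j, one for each level passed. Around a closed
geodesic these defects add up to `v 1`. -/
theorem HeightAt.seg {c : ℝ} (hc : 1 ≤ c) {x y : (surfS c).Surface} {v : Plane}
    (hx : x ∉ (surfS c).vertices) (hv : 0 ≤ v 1) (h : (surfS c).Seg x y v) {a : ℝ}
    (ha : HeightAt c x a) : ∃ b, HeightAt c y b ∧ v 1 + a - b ∈ heightMonoid c := by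
  obtain ⟨i, q, r, hq, hr, rfl⟩ := seg_iff.1 h
  cases i
  · rw [ha.unique hc hx (Or.inl ⟨q, hq, rfl⟩)]
    refine ⟨_, Or.inl ⟨r, hr, rfl⟩, ?_⟩
    convert zero_mem (heightMonoid c) using 1
    simp
    ring
  · obtain ⟨n, h1, h2⟩ := exists_level hc (snd_nonneg hc hq.mem)
    obtain ⟨m, h3, h4⟩ := exists_level hc (snd_nonneg hc hr.mem)
    rw [ha.unique hc hx (Or.inr ⟨q, n, hq, h1, h2, rfl⟩)]
    refine ⟨_, Or.inr ⟨r, m, hr, h3, h4, rfl⟩, ?_⟩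
    simp at hv
    have hnm : n < m + 1 := by
      refine (vert_snd_strictMono hc).lt_iff_lt.1 ?_
      push_cast
      linarith
    obtain ⟨d, rfl⟩ := Nat.exists_eq_add_of_le (Nat.lt_succ_iff.1 hnm)
    convert sum_mem_heightMonoid c n d using 1
    simp
    ring

theorem HeightAt.geod {c : ℝ} (hc : 1 ≤ c) {x y : (surfS c).Surface} {v : Plane} {L : ℝ}
    (hv : 0 ≤ v 1) (h : (surfS c).Geod v x y L) : ∀ {a : ℝ}, HeightAt c x a →
      ∃ b, HeightAt c y b ∧ L * v 1 + a - b ∈ heightMonoid c := by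
  induction h with
  | nil x hx => exact fun {a} ha => ⟨a, ha, by simp⟩
  | @cons x y z s L hx hs hseg _ ih =>
    intro a ha
    obtain ⟨b, hb, h1⟩ := ha.seg hc hx (by simpa using mul_nonneg hs.le hv) hseg
    obtain ⟨d, hd, h2⟩ := ih hb
    refine ⟨d, hd, ?_⟩
    convert add_mem h1 h2 using 1
    simp
    ring

theorem abs_mem_heightMonoid {c : ℝ} (hc : 1 ≤ c) {v : Plane} (hv : v ∈ closedHol c) :
    |v 1| ∈ heightMonoid c := by
  suffices H : ∀ v ∈ closedHol c, 0 ≤ v 1 → v 1 ∈ heightMonoid c by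
    rcases le_total 0 (v 1) with h | h
    · rw [abs_of_nonneg h]; exact H v hv h
    · rw [abs_of_nonpos h]; exact H (-v) (neg_mem_closedHol hc hv) (by simpa using h)
  rintro v ⟨-, x, hx⟩ h
  obtain ⟨a, ha⟩ := exists_heightAt hc x
  obtain ⟨b, hb, hm⟩ := ha.geod hc h hx
  rw [ha.unique hc hx.left hb] at hm
  simpa using hm

/-- The position in the `n`-th horizontal cylinder, up to multiples of the circumference. -/
def CylPos (c : ℝ) (n : ℕ) (x : (surfS c).Surface) (θ : ℝ) : Prop :=
  ∃ i q, IsRep c x i q ∧ vert c n 1 ≤ q 1 ∧ q 1 < vert c (n + 1) 1 ∧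
    θ = if i then q 0 else cylW c n - q 0

theorem exists_cylPos {c : ℝ} (hc : 1 ≤ c) (x : (surfS c).Surface) : ∃ n θ, CylPos c n x θ := by
  obtain ⟨i, q, hq⟩ := exists_rep x
  obtain ⟨n, h1, h2⟩ := exists_level hc (snd_nonneg hc hq.mem)
  exact ⟨n, _, i, q, hq, h1, h2, rfl⟩

/-- Gluing along the right edge of the level preserves the position; gluing along the left edge
changes it by one circumference. -/
theorem CylPos.unique {c : ℝ} (hc : 1 ≤ c) {x : (surfS c).Surface} (hx : x ∉ (surfS c).vertices)
    {n m : ℕ} {θ θ' : ℝ} (h : CylPos c n x θ) (h' : CylPos c m x θ') :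
    m = n ∧ ∃ k : ℤ, θ' = θ + k * (2 * cylW c n) := by
  obtain ⟨i, q, hq, h1, h2, rfl⟩ := h
  obtain ⟨j, r, hr, h3, h4, rfl⟩ := h'
  rcases hq.eq_or_flip hc hx hr with ⟨rfl, rfl⟩ | ⟨rfl, k, hk, rfl⟩
  · obtain rfl := level_unique hc h1 h2 h3 h4
    exact ⟨rfl, 0, by simp⟩
  · obtain ⟨l, hl, h5, h6⟩ := edge_level hc hq.mem (fun h => hx ((mem_vertices_iff hc hq).2 h)) hk
    obtain rfl := level_unique hc h1 h2 h5.le h6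
    rw [edgeFlip_snd_of_level hl] at h3 h4
    obtain rfl : m = n := level_unique hc h3 h4 (by linarith) (by linarith)
    refine ⟨rfl, ?_⟩
    rcases hl with rfl | rfl
    · refine ⟨0, ?_⟩
      cases i <;> simp [edgeFlip_fst, cylW] <;> ring
    · rw [edgeFlip_fst, (vert_neg_succ c m).1, sub_add_cancel, vert_neg_fst]
      cases i
      · refine ⟨-1, ?_⟩
        simp [cylW]; ring
      · refine ⟨1, ?_⟩
        simp [cylW]; ring

theorem CylPos.geod {c : ℝ} (hc : 1 ≤ c) {x y : (surfS c).Surface} {v : Plane} {L : ℝ}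
    (hv : v 1 = 0) (h : (surfS c).Geod v x y L) : ∀ {n : ℕ} {θ : ℝ}, CylPos c n x θ →
      ∃ k : ℤ, CylPos c n y (θ + L * v 0 + k * (2 * cylW c n)) := by
  induction h with
  | nil x hx => exact fun {n θ} h => ⟨0, by simpa using h⟩
  | @cons x y z s L hx hs hseg _ ih =>
    intro n θ h
    obtain ⟨i, q, r, hq, hr, e⟩ := seg_iff.1 hseg
    have e1 : r 1 = q 1 := by
      have := congrArg (fun p : Plane => p 1) e
      simp [hv, sgn_ne_zero] at this
      linarith
    have e0 : s * v 0 = sgn i * (r 0 - q 0) := by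
      simpa using congrArg (fun p : Plane => p 0) e
    obtain ⟨m, h1, h2⟩ := exists_level hc (snd_nonneg hc hq.mem)
    obtain ⟨rfl, k, hk⟩ := h.unique hc hx ⟨i, q, hq, h1, h2, rfl⟩
    obtain ⟨l, hl⟩ := ih ⟨i, r, hr, by rwa [e1], by rwa [e1], rfl⟩
    refine ⟨k + l, ?_⟩
    convert hl using 1
    cases i
    · simp at hk e0 ⊢
      linear_combination e0 - hk
    · simp at hk e0 ⊢
      linear_combination e0 - hk

/-- A closed horizontal geodesic winds a nonzero integral number of times around a cylinder of
circumference `2 * cylW c n`, which is at least 2. -/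
theorem two_le_of_mem_closedHol {c : ℝ} (hc : 1 ≤ c) {v : Plane} (hv : v ∈ closedHol c)
    (hv1 : v 1 = 0) : 2 ≤ |v 0| := by
  obtain ⟨hv0, x, hx⟩ := hv
  obtain ⟨n, θ, h⟩ := exists_cylPos hc x
  obtain ⟨k, hk⟩ := h.geod hc hv1 hx
  obtain ⟨-, l, hl⟩ := h.unique hc hx.left hk
  have hw := one_le_cylW hc n
  have e : v 0 = ((l - k : ℤ) : ℝ) * (2 * cylW c n) := by push_cast; linear_combination hl
  have hlk : l - k ≠ 0 := by
    intro h0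
    apply hv0
    ext i
    fin_cases i
    · simpa [h0] using e
    · exact hv1
  have : (1 : ℝ) ≤ |((l - k : ℤ) : ℝ)| := by exact_mod_cast Int.one_le_abs hlk
  rw [e, abs_mul, abs_of_nonneg (by linarith : 0 ≤ 2 * cylW c n)]
  nlinarith

theorem PolygonGluing.Geod.cons_of_nonneg {c : ℝ} (hc : 1 ≤ c) {u : Plane}
    {x y z : (surfS c).Surface} {s L : ℝ} (hx : x ∉ (surfS c).vertices) (hs : 0 ≤ s)
    (h : (surfS c).Seg x y (s • u)) (h' : (surfS c).Geod u y z L) :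
    (surfS c).Geod u x z (s + L) := by
  rcases hs.eq_or_lt with rfl | hs
  · obtain rfl : x = y := seg_unique hc hx (v := (0 : ℝ) • u) (by simpa using seg_self x) h
    simpa using h'
  · exact .cons hx hs h h'

/-- The geodesics in the bottom cylinder close up after `(2, 0)`. -/
theorem geod_bottom {c : ℝ} (hc : 1 ≤ c) {x : (surfS c).Surface} (hx : x ∉ (surfS c).vertices)
    {i : Bool} {q : Plane} (hq : IsRep c x i q) (h1 : q 1 < 1) :
    (surfS c).Geod !₂[2, 0] x x 1 := by
  have hqR := edgeFun_nonneg hc 0 hq.mem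
  have hqL := edgeFun_nonneg hc (-1) hq.mem
  have eL : ∀ p : Plane, edgeFun c (-1) p = p 0 + p 1 := by
    intro p
    simp [edgeFun, vert_neg_fst, vert_neg_snd, vert_one, vert_zero]
    ring
  rw [edgeFun_zero_index] at hqR
  rw [eL] at hqL
  have hpos : 0 < q 1 := by
    rcases (snd_nonneg hc hq.mem).eq_or_lt with h | h
    · refine absurd ((mem_vertices_iff hc hq).2 ⟨0, ?_⟩) hx
      ext j
      fin_cases j
      · simp [vert_zero]; linarith
      · simp [vert_zero]; linarith
    · exact h
  have key : ∀ j : Bool, ∃ y, y ∉ (surfS c).vertices ∧ IsRep c y i !₂[sgn j * q 1, q 1] ∧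
      IsRep c y (!i) !₂[sgn j * (1 - q 1), 1 - q 1] := by
    intro j
    have hm : (!₂[sgn j * q 1, q 1] : Plane) ∈ polyQ c := by
      refine mem_polyQ_of_level hc 0 (by simp [vert_zero]; linarith) (by simp [vert_one]; linarith)
        ?_ ?_
      · rw [Nat.cast_zero, edgeFun_zero_index]
        cases j <;> simp
        linarith
      · simp only [Nat.cast_zero, neg_zero, zero_sub, eL]
        cases j <;> simp
        linarith
    obtain ⟨y, hy⟩ := exists_rep_of_mem i hm
    have hflip : edgeFun c (if j then 0 else -1) !₂[sgn j * q 1, q 1] = 0 := by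
      cases j
      · simp [eL]
      · simp [edgeFun_zero_index]
    refine ⟨y, fun h => ?_, hy, ?_⟩
    · obtain ⟨k, hk⟩ := (mem_vertices_iff hc hy).1 h
      have hk1 : q 1 = vert c k 1 := by simpa using congrArg (fun p : Plane => p 1) hk
      have habs : vert c k 1 = vert c (k.natAbs : ℕ) 1 := by
        rcases Int.natAbs_eq k with h | h
        · rw [← h]
        · conv_lhs => rw [h, vert_neg_snd]
      have hlt : k.natAbs < 1 := (vert_snd_strictMono hc).lt_iff_lt.1 (by
        simp only
        rw [← habs, ← hk1, Nat.cast_one, (vert_one c).2]; exact h1)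
      have : k = 0 := by omega
      rw [this, vert_zero_apply] at hk1
      linarith
    · have := hy.flip hc hflip
      convert this using 1
      ext l
      cases j <;> fin_cases l <;>
        simp [edgeFlip, vert_zero, vert_neg_fst, vert_neg_snd, vert_one]
      ring
  -- From `x` the geodesic runs to the side point `y`, crosses the triangle of the other piece to
  -- `z`, and returns to `x` in its own piece.
  obtain ⟨y, hy, hy1, hy2⟩ := key i
  obtain ⟨z, hz, hz1, hz2⟩ := key (!i)
  have s1 : (surfS c).Seg x y (((q 1 - sgn i * q 0) / 2) • !₂[2, 0]) := by
    convert hq.seg hy1 using 1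
    ext l
    cases i <;> fin_cases l <;> simp
    ring
  have s2 : (surfS c).Seg y z ((1 - q 1) • !₂[2, 0]) := by
    convert hy2.seg hz2 using 1
    ext l
    cases i <;> fin_cases l <;> simp
    · ring
    · ring
  have s3 : (surfS c).Seg z x (((q 1 + sgn i * q 0) / 2) • !₂[2, 0]) := by
    convert hz1.seg hq using 1
    ext l
    cases i <;> fin_cases l <;> simp <;> ring
  have := Geod.cons_of_nonneg hc hx (by cases i <;> simp <;> linarith) s1
    (.cons hy (by linarith) s2
      (Geod.cons_of_nonneg hc hz (by cases i <;> simp <;> linarith) s3 (.nil x hx)))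
  convert this using 1
  ring

/-- The length to exclude is 4c. In the bottom cylinder geodesics close up already after length 2 <
4c, and the circumference of every other cylinder is at least 4c + 2. -/
theorem two_zero_notMem_primHol {c : ℝ} (hc : 1 ≤ c) : !₂[2, 0] ∉ primHol c := by
  rintro ⟨x, hx, hprim⟩
  obtain ⟨n, θ, h⟩ := exists_cylPos hc x
  obtain ⟨k, hk⟩ := h.geod hc (by simp) hx
  obtain ⟨-, l, hl⟩ := h.unique hc hx.left hk
  simp at hl
  obtain ⟨i, q, hq, h1, h2, -⟩ := h
  rcases Nat.eq_zero_or_pos n with rfl | hn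
  · simp [vert_one] at h2
    exact hprim 1 (by norm_num) (by linarith) (geod_bottom hc hx.left hq h2)
  · have hw : 2 * c + 1 ≤ cylW c n := by
      have m1 := (vert_fst_strictMono hc).monotone (show (1 : ℤ) ≤ n by exact_mod_cast hn)
      have m2 := (vert_fst_strictMono hc).monotone (show (2 : ℤ) ≤ n + 1 by omega)
      simp only [vert_one, vert_two] at m1 m2
      unfold cylW
      linarith
    have e : 2 * c = ((l - k : ℤ) : ℝ) * cylW c n := by push_cast; linear_combination hl / 2
    have hpos : 0 < l - k := by
      by_contra! h
      have : ((l - k : ℤ) : ℝ) ≤ 0 := by exact_mod_cast h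
      nlinarith
    have : (1 : ℝ) ≤ ((l - k : ℤ) : ℝ) := by exact_mod_cast hpos
    nlinarith

/-! ### Descent in the group generated by the involutions -/

/-- The group generated by the four involutions. -/
def genGroup (c : ℝ) : Subgroup (GL (Fin 2) ℝ) := Subgroup.closure {-1, genA, genB, genC c}

theorem neg_one_mem_genGroup (c : ℝ) : -1 ∈ genGroup c := Subgroup.subset_closure (by simp)

theorem genA_mem_genGroup (c : ℝ) : genA ∈ genGroup c := Subgroup.subset_closure (by simp)

theorem genB_mem_genGroup (c : ℝ) : genB ∈ genGroup c := Subgroup.subset_closure (by simp)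

theorem genC_mem_genGroup (c : ℝ) : genC c ∈ genGroup c := Subgroup.subset_closure (by simp)

theorem genGroup_le_holStab {c : ℝ} (hc : 1 ≤ c) : genGroup c ≤ holStab c :=
  (closure_subset_veechGroup hc).trans (veechGroup_subset_holStab hc)

theorem linAct_neg_one (v : Plane) : linAct (-1) v = -v := by
  ext i; fin_cases i <;> simp [linAct_fst, linAct_snd]

theorem linAct_genA (v : Plane) : linAct genA v = !₂[-v 0, v 1] := by
  ext i; fin_cases i <;> simp [linAct_fst, linAct_snd, genA]

theorem linAct_genB (v : Plane) : linAct genB v = !₂[-v 0 + 2 * v 1, v 1] := by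
  ext i; fin_cases i <;> simp [linAct_fst, linAct_snd, genB]

theorem linAct_genC (c : ℝ) (v : Plane) :
    linAct (genC c) v = !₂[-c * v 0 + (c - 1) * v 1, (-c - 1) * v 0 + c * v 1] := by
  ext i; fin_cases i <;> simp [linAct_fst, linAct_snd, genC]

theorem exists_shear (c : ℝ) (n : ℤ) :
    ∃ g ∈ genGroup c, ∀ v : Plane, linAct g v = !₂[v 0 + 2 * n * v 1, v 1] := by
  have hBA := mul_mem (genB_mem_genGroup c) (genA_mem_genGroup c)
  have hAB := mul_mem (genA_mem_genGroup c) (genB_mem_genGroup c)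
  induction n using Int.induction_on with
  | zero =>
    refine ⟨1, one_mem _, fun v => ?_⟩
    rw [linAct_one]
    ext i; fin_cases i <;> simp
  | succ n ih =>
    obtain ⟨g, hg, h⟩ := ih
    refine ⟨_, mul_mem hBA hg, fun v => ?_⟩
    rw [linAct_mul, linAct_mul, h, linAct_genA, linAct_genB]
    ext i; fin_cases i <;> simp
    ring
  | pred n ih =>
    obtain ⟨g, hg, h⟩ := ih
    refine ⟨_, mul_mem hAB hg, fun v => ?_⟩
    rw [linAct_mul, linAct_mul, h, linAct_genB, linAct_genA]
    ext i; fin_cases i <;> simp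
    ring

theorem exists_shear_abs_le (c : ℝ) {v : Plane} (hv : v 1 ≠ 0) :
    ∃ g ∈ genGroup c, (∀ w : Plane, w 1 = 0 → linAct g w = w) ∧ linAct g v 1 = v 1 ∧
      |linAct g v 0| ≤ |v 1| := by
  obtain ⟨g, hg, h⟩ := exists_shear c (-round (v 0 / (2 * v 1)))
  refine ⟨g, hg, fun w hw => ?_, by simp [h], ?_⟩
  · rw [h, hw]
    ext i; fin_cases i <;> simp [hw]
  have := abs_sub_round (v 0 / (2 * v 1))
  have e : linAct g v 0 = (v 0 / (2 * v 1) - round (v 0 / (2 * v 1))) * (2 * v 1) := by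
    rw [h]
    simp
    field_simp
    ring
  rw [e, abs_mul, abs_mul, abs_of_nonneg (by norm_num : (0 : ℝ) ≤ 2)]
  nlinarith [abs_nonneg (v 1)]

/-- In the cone `|x| < |y|` one of the involutions lowers the height of closed geodesics. -/
theorem exists_height_lt {c : ℝ} (hc : 1 ≤ c) {v : Plane} (hv : v ∈ closedHol c)
    (h : |v 0| < |v 1|) : ∃ g ∈ genGroup c, |linAct g v 1| < |v 1| := by
  have hv1 : v 1 ≠ 0 := fun h0 => by
    rw [h0, abs_zero] at h
    exact absurd h (abs_nonneg _).not_gt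
  have hq := closedHol_quadratic hc hv hv1
  -- Up to sign this is the height after `genC c`, once `genA` has made the signs of the coordinates
  -- agree. The lower bound comes from |x| < |y|, the upper bound (c - 1)|y| < (c + 1)|x| from
  -- `closedHol_quadratic` together with |x| < |y|.
  have key : |(c * |v 1| - (c + 1) * |v 0|)| < |v 1| := by
    rw [← sq_abs (v 0), ← sq_abs (v 1)] at hq
    have hx := abs_nonneg (v 0)
    set x := |v 0|
    set y := |v 1|
    rw [abs_lt]
    constructor
    · nlinarith
    · have : (c - 1) * y < (c + 1) * x := by
        by_contra! hcon
        nlinarith [mul_le_mul_of_nonneg_right hcon (by linarith : 0 ≤ y),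
          mul_nonneg hx (by linarith : 0 ≤ y - x)]
      linarith
  have hC := genC_mem_genGroup c
  rcases le_total 0 (v 0 * v 1) with hs | hs
  · refine ⟨genC c, hC, ?_⟩
    have e : |linAct (genC c) v 1| = |(c * |v 1| - (c + 1) * |v 0|)| := by
      rw [linAct_genC]
      rcases lt_or_gt_of_ne hv1 with h1 | h1
      · have h0 : v 0 ≤ 0 := by nlinarith
        rw [abs_of_neg h1, abs_of_nonpos h0, ← abs_neg]
        congr 1; simp; ring
      · have h0 : 0 ≤ v 0 := by nlinarith
        rw [abs_of_pos h1, abs_of_nonneg h0]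
        congr 1; simp; ring
    rwa [e]
  · refine ⟨genC c * genA, mul_mem hC (genA_mem_genGroup c), ?_⟩
    have e : |linAct (genC c * genA) v 1| = |(c * |v 1| - (c + 1) * |v 0|)| := by
      rw [linAct_mul, linAct_genC, linAct_genA]
      rcases lt_or_gt_of_ne hv1 with h1 | h1
      · have h0 : 0 ≤ v 0 := by nlinarith
        rw [abs_of_neg h1, abs_of_nonneg h0, ← abs_neg]
        congr 1; simp; ring
      · have h0 : v 0 ≤ 0 := by nlinarith
        rw [abs_of_pos h1, abs_of_nonpos h0]
        congr 1; simp; ring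
    rwa [e]

/-- Up to the group generated by the involutions, closed geodesics are horizontal or diagonal. -/
theorem exists_horizontal_or_diagonal {c : ℝ} (hc : 1 ≤ c) {v : Plane} (hv : v ∈ closedHol c) :
    ∃ g ∈ genGroup c, ∃ s : ℝ, 0 < s ∧ (linAct g v = !₂[s, 0] ∨ linAct g v = !₂[s, s]) := by
  have hmem : ∀ g ∈ genGroup c, linAct g v ∈ closedHol c := fun g hg =>
    ((genGroup_le_holStab hc hg).1 v).2 hv
  suffices H : ∃ g ∈ genGroup c, ∃ s : ℝ, linAct g v = !₂[s, 0] ∨ linAct g v = !₂[s, s] by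
    obtain ⟨g, hg, s, h⟩ := H
    have hs : s ≠ 0 := by
      rintro rfl
      refine (hmem g hg).1 ?_
      rcases h with h | h <;> rw [h] <;> ext i <;> fin_cases i <;> simp
    rcases lt_or_gt_of_ne hs with hs | hs
    · refine ⟨-1 * g, mul_mem (neg_one_mem_genGroup c) hg, -s, by linarith, ?_⟩
      rw [linAct_mul, linAct_neg_one]
      rcases h with h | h
      · left; rw [h]; ext i; fin_cases i <;> simp
      · right; rw [h]; ext i; fin_cases i <;> simp
    · exact ⟨g, hg, s, hs, h⟩
  -- The heights along the orbit of `v` lie in the well-ordered monoid, so a least one exists.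
  set S : Set ℝ := {t | ∃ g ∈ genGroup c, |linAct g v 1| = t} with hS
  have hSW : S.IsWF := by
    refine ((isPWO_heightMonoid hc).mono ?_).isWF
    rintro _ ⟨g, hg, rfl⟩
    exact abs_mem_heightMonoid hc (hmem g hg)
  have hne : S.Nonempty := ⟨_, 1, one_mem _, rfl⟩
  obtain ⟨g, hg, hgm⟩ := hSW.min_mem hne
  have hmin : ∀ g' ∈ genGroup c, |linAct g v 1| ≤ |linAct g' v 1| := by
    intro g' hg'
    rw [hgm]
    exact hSW.min_le hne ⟨g', hg', rfl⟩
  by_cases h0 : linAct g v 1 = 0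
  · exact ⟨g, hg, linAct g v 0, Or.inl (by ext i; fin_cases i <;> simp [h0])⟩
  obtain ⟨g', hg', -, e, hle⟩ := exists_shear_abs_le c h0
  rw [← linAct_mul] at e hle
  have hgg := mul_mem hg' hg
  -- At the least height the strict inequality would permit a further descent, so the vector is
  -- diagonal up to `genA`.
  rcases hle.lt_or_eq with hlt | heq
  · obtain ⟨k, hk, hk'⟩ := exists_height_lt hc (hmem _ hgg) (by rwa [e])
    rw [← linAct_mul, e] at hk'
    exact absurd (hmin _ (mul_mem hk hgg)) hk'.not_ge
  · rcases abs_eq_abs.1 heq with h | h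
    · refine ⟨_, hgg, linAct g v 1, Or.inr ?_⟩
      ext i; fin_cases i <;> simp [e, h]
    · refine ⟨_, mul_mem (genA_mem_genGroup c) hgg, linAct g v 1, Or.inr ?_⟩
      rw [linAct_mul, linAct_genA]
      ext i; fin_cases i <;> simp [e, h]

theorem holStab_le_genGroup {c : ℝ} (hc : 1 ≤ c) : holStab c ≤ genGroup c := by
  have hGH := genGroup_le_holStab hc
  have hdiag := diag_mem_closedHol hc
  have htwo := two_zero_mem_closedHol hc
  set m : ℝ := 2 * c + 2 with hm
  have hm0 : 0 < m := by rw [hm]; linarith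
  have inv_mem : ∀ {k : GL (Fin 2) ℝ}, k ∈ holStab c → ∀ {v : Plane}, v ∈ closedHol c →
      linAct k⁻¹ v ∈ closedHol c := fun {_} hk {v} hv => (((holStab c).inv_mem hk).1 v).2 hv
  have twoLe : ∀ {s : ℝ}, (!₂[s, 0] : Plane) ∈ closedHol c → 2 ≤ |s| := fun {s} hs => by
    simpa using two_le_of_mem_closedHol hc hs (by simp)
  have heightLe : ∀ {v : Plane}, v ∈ closedHol c → v 1 ≠ 0 → m ≤ |v 1| := fun hv h =>
    le_of_mem_heightMonoid hc (abs_mem_heightMonoid hc hv) (by simpa using h)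
  -- an element of the stabilizer does not exchange the horizontal and the diagonal direction
  have noDiag : ∀ k ∈ holStab c, ∀ s : ℝ, 0 < s → linAct k !₂[2, 0] ≠ !₂[s, s] := by
    intro k hk s hs e
    have h1 : m ≤ s := by
      have := heightLe ((hk.1 _).2 htwo) (by rw [e]; simpa using hs.ne')
      rw [e] at this
      simpa [abs_of_pos hs] using this
    have h2 : linAct k⁻¹ !₂[m, m] = !₂[2 * m / s, 0] := by
      have : (!₂[m, m] : Plane) = (m / s) • linAct k !₂[2, 0] := by
        rw [e]; ext i; fin_cases i <;> simp <;> field_simp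
      rw [this, map_smul, linAct_inv_apply]
      ext i; fin_cases i <;> simp
      ring
    have h3 := inv_mem hk hdiag
    rw [h2] at h3
    have h4 := twoLe h3
    rw [abs_of_pos (by positivity), le_div_iff₀ hs] at h4
    -- Lengths alone do not separate the two directions when s = m; here `primHol` is needed.
    obtain rfl : s = m := by linarith
    refine two_zero_notMem_primHol hc ((hk.2 _).1 ?_)
    rw [e]
    exact diag_mem_primHol hc
  have noHor : ∀ k ∈ holStab c, ∀ s : ℝ, linAct k !₂[m, m] ≠ !₂[s, 0] := by
    intro k hk s e
    have hs : s ≠ 0 := by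
      rintro rfl
      refine ((hk.1 _).2 hdiag).1 ?_
      rw [e]; ext i; fin_cases i <;> simp
    have h1 : linAct k⁻¹ !₂[2, 0] = !₂[2 * m / s, 2 * m / s] := by
      have : (!₂[2, 0] : Plane) = (2 / s) • linAct k !₂[m, m] := by
        rw [e]; ext i; fin_cases i <;> simp; field_simp
      rw [this, map_smul, linAct_inv_apply]
      ext i; fin_cases i <;> simp <;> ring
    rcases lt_or_gt_of_ne hs with h | h
    · refine noDiag (-1 * k⁻¹) (mul_mem (hGH (neg_one_mem_genGroup c)) ((holStab c).inv_mem hk))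
        (2 * m / -s) (div_pos (by linarith) (by linarith)) ?_
      rw [linAct_mul, h1, linAct_neg_one]
      ext i; fin_cases i <;> simp <;> ring
    · exact noDiag k⁻¹ ((holStab c).inv_mem hk) (2 * m / s) (by positivity) h1
  intro h hh
  -- After correction by a generator word (2, 0) stays horizontal. Since 2 is the least length both
  -- for the element and for its inverse, (2, 0) is fixed.
  suffices H : ∀ k ∈ holStab c, linAct k !₂[2, 0] = !₂[2, 0] → k ∈ genGroup c by
    obtain ⟨g, hg, s, hs, e⟩ := exists_horizontal_or_diagonal hc ((hh.1 _).2 htwo)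
    have hgh := mul_mem (hGH hg) hh
    rw [← linAct_mul] at e
    have e := e.resolve_right (noDiag _ hgh s hs)
    have h1 : 2 ≤ s := by
      have := twoLe (e ▸ (hgh.1 _).2 htwo)
      rwa [abs_of_pos hs] at this
    have h2 : 2 ≤ 4 / s := by
      have h3 : linAct (g * h)⁻¹ !₂[2, 0] = !₂[4 / s, 0] := by
        have : (!₂[2, 0] : Plane) = (2 / s) • linAct (g * h) !₂[2, 0] := by
          rw [e]; ext i; fin_cases i <;> simp; field_simp
        rw [this, map_smul, linAct_inv_apply]
        ext i; fin_cases i <;> simp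
        ring
      have := twoLe (h3 ▸ inv_mem hgh htwo)
      rwa [abs_of_pos (by positivity)] at this
    rw [le_div_iff₀ hs] at h2
    obtain rfl : s = 2 := by linarith
    have := mul_mem ((genGroup c).inv_mem hg) (H _ hgh e)
    rwa [inv_mul_cancel_left] at this
  clear h hh
  have fst_col : ∀ {k : GL (Fin 2) ℝ}, linAct k !₂[2, 0] = !₂[2, 0] → k.1 0 0 = 1 ∧ k.1 1 0 = 0 := by
    intro k e
    have e0 := congrArg (fun p : Plane => p 0) e
    have e1 := congrArg (fun p : Plane => p 1) e
    simp [linAct_fst, linAct_snd] at e0 e1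
    exact ⟨e0, e1⟩
  have one_le : ∀ k ∈ holStab c, linAct k !₂[2, 0] = !₂[2, 0] → 1 ≤ |k.1 1 1| := by
    intro k hk e
    have h1 : linAct k !₂[m, m] 1 = m * k.1 1 1 := by
      rw [linAct_snd, (fst_col e).2]; simp; ring
    have h2 : linAct k !₂[m, m] 1 ≠ 0 := fun h0 => by
      refine noHor k hk (linAct k !₂[m, m] 0) ?_
      ext i; fin_cases i <;> simp [h0]
    have := heightLe ((hk.1 _).2 hdiag) h2
    rw [h1, abs_mul, abs_of_pos hm0] at this
    nlinarith
  -- Since m is the least nonzero height, the lower right entries of `k` and of `k⁻¹` have absolute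
  -- value at least 1; as their product is 1, the entry is 1 or -1. The sign is corrected by -A_c,
  -- which fixes (2, 0).
  suffices H : ∀ k ∈ holStab c, linAct k !₂[2, 0] = !₂[2, 0] → k.1 1 1 = 1 → k ∈ genGroup c by
    intro k hk e
    have e' : linAct k⁻¹ !₂[2, 0] = !₂[2, 0] := by
      conv_lhs => rw [← e, linAct_inv_apply]
    have h1 := one_le k hk e
    have h2 := one_le _ ((holStab c).inv_mem hk) e'
    have h3 : k.1 1 1 * k⁻¹.1 1 1 = 1 := by
      have := congrArg (fun M : Matrix (Fin 2) (Fin 2) ℝ => M 1 1) k.mul_inv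
      simpa [Matrix.mul_apply, (fst_col e).2] using this
    have h4 : |k.1 1 1| = 1 := by
      have := congrArg abs h3
      rw [abs_mul, abs_one] at this
      nlinarith
    rcases abs_eq (by norm_num) |>.1 h4 with h5 | h5
    · exact H k hk e h5
    · have hD := mul_mem (neg_one_mem_genGroup c) (genA_mem_genGroup c)
      have := H (-1 * genA * k) (mul_mem (hGH hD) hk) ?_ ?_
      · have := mul_mem ((genGroup c).inv_mem hD) this
        rwa [inv_mul_cancel_left] at this
      · rw [linAct_mul, e, linAct_mul, linAct_neg_one, linAct_genA]
        ext i; fin_cases i <;> simp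
      · simp [genA]
        simp [Matrix.vecMul, dotProduct, h5]
  have eq_one : ∀ {k : GL (Fin 2) ℝ}, linAct k !₂[2, 0] = !₂[2, 0] →
      linAct k !₂[m, m] = !₂[m, m] → k = 1 := by
    intro k e e'
    obtain ⟨h00, h10⟩ := fst_col e
    have e0 := congrArg (fun p : Plane => p 0) e'
    have e1 := congrArg (fun p : Plane => p 1) e'
    simp [linAct_fst, linAct_snd, h00, h10, hm0.ne'] at e0 e1
    ext i j
    fin_cases i <;> fin_cases j <;> simp [h00, h10, e0, e1]
  intro k hk e h11
  obtain ⟨h00, h10⟩ := fst_col e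
  have hkm : linAct k !₂[m, m] 1 = m := by simp [linAct_snd, h10, h11]
  obtain ⟨g, hg, hgw, hgm, hgle⟩ := exists_shear_abs_le c (v := linAct k !₂[m, m])
    (by rw [hkm]; exact hm0.ne')
  have hgk := mul_mem (hGH hg) hk
  have hg2 : linAct (g * k) !₂[2, 0] = !₂[2, 0] := by rw [linAct_mul, e, hgw _ (by simp)]
  rw [← linAct_mul, hkm] at hgm
  rw [← linAct_mul, hkm] at hgle
  suffices g * k ∈ genGroup c by
    have := mul_mem ((genGroup c).inv_mem hg) this
    rwa [inv_mul_cancel_left] at this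
  -- In the strict case a descent step would give the image of (m, m) a height below m. Then it
  -- would be horizontal, which `noHor` excludes, or contradict the minimality of m. Otherwise the
  -- image is (m, m) or (-m, m), and B_c A_c takes the latter to (m, m).
  rcases hgle.lt_or_eq with hlt | heq
  · exfalso
    have hcl := (hgk.1 _).2 hdiag
    obtain ⟨g', hg', hh⟩ := exists_height_lt hc hcl (by rwa [hgm])
    rw [← linAct_mul, hgm, abs_of_pos hm0] at hh
    have hst := mul_mem (hGH hg') hgk
    by_cases h0 : linAct (g' * (g * k)) !₂[m, m] 1 = 0
    · refine noHor _ hst (linAct (g' * (g * k)) !₂[m, m] 0) ?_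
      ext i; fin_cases i <;> simp [h0]
    · exact absurd (heightLe ((hst.1 _).2 hdiag) h0) hh.not_ge
  · rcases abs_eq_abs.1 heq with h | h
    · rw [eq_one hg2 (by ext i; fin_cases i <;> simp [h, hgm])]
      exact one_mem _
    · have hBA := mul_mem (genB_mem_genGroup c) (genA_mem_genGroup c)
      have : genB * genA * (g * k) = 1 := by
        apply eq_one
        · rw [linAct_mul, hg2, linAct_mul, linAct_genA, linAct_genB]
          ext i; fin_cases i <;> simp
        · rw [linAct_mul, linAct_mul, linAct_genA, linAct_genB]
          ext i; fin_cases i <;> simp [h, hgm]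
          ring
      rw [eq_inv_of_mul_eq_one_right this]
      exact (genGroup c).inv_mem hBA

theorem veechGroup_eq_genGroup {c : ℝ} (hc : 1 ≤ c) :
    (surfS c).veechGroup = (genGroup c : Set (GL (Fin 2) ℝ)) :=
  Set.Subset.antisymm ((veechGroup_subset_holStab hc).trans (holStab_le_genGroup hc))
    (closure_subset_veechGroup hc)

theorem orderOf_gen {c : ℝ} (hc : 1 ≤ c) :
    ∀ g ∈ ({-1, genA, genB, genC c} : Set (GL (Fin 2) ℝ)), orderOf g = 2 := by
  have key : ∀ {g : GL (Fin 2) ℝ}, g * g = 1 → g.1 0 0 ≠ 1 → orderOf g = 2 := fun {g} h h0 =>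
    orderOf_eq_prime (by rw [pow_two, h]) (by rintro rfl; simp at h0)
  rintro g (rfl | rfl | rfl | rfl)
  · exact key (by simp) (by norm_num)
  · exact key (Units.ext genA.val_inv) (by norm_num [genA])
  · exact key (Units.ext genB.val_inv) (by norm_num [genB])
  · exact key (Units.ext (genC c).val_inv) (by simp [genC]; linarith)

/-! ### The case c = 1: the congruence two subgroup -/

/-- An involution with integer entries. -/
def intInvolution (a b d e : ℤ) (h1 : a * a + b * d = 1) (h2 : a * b + b * e = 0)
    (h3 : d * a + e * d = 0) (h4 : d * b + e * e = 1) : GL (Fin 2) ℤ where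
  val := !![a, b; d, e]
  inv := !![a, b; d, e]
  val_inv := by ext i j; fin_cases i <;> fin_cases j <;> simp [h1, h2, h3, h4]
  inv_val := by ext i j; fin_cases i <;> fin_cases j <;> simp [h1, h2, h3, h4]

/-- The integer matrices that represent elements of the group generated by the involutions. -/
def intGenGroup : Subgroup (GL (Fin 2) ℤ) :=
  (genGroup 1).comap (Matrix.GeneralLinearGroup.map (n := Fin 2) (Int.castRingHom ℝ))

def intA : GL (Fin 2) ℤ := intInvolution (-1) 0 0 1 rfl rfl rfl rfl

def intB : GL (Fin 2) ℤ := intInvolution (-1) 2 0 1 rfl rfl rfl rfl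

def intC : GL (Fin 2) ℤ := intInvolution (-1) 0 (-2) 1 rfl rfl rfl rfl

theorem map_intA : Matrix.GeneralLinearGroup.map (n := Fin 2) (Int.castRingHom ℝ) intA = genA := by
  ext i j; fin_cases i <;> fin_cases j <;> simp [intA, intInvolution, genA]

theorem map_intB : Matrix.GeneralLinearGroup.map (n := Fin 2) (Int.castRingHom ℝ) intB = genB := by
  ext i j; fin_cases i <;> fin_cases j <;> simp [intB, intInvolution, genB]

theorem map_intC :
    Matrix.GeneralLinearGroup.map (n := Fin 2) (Int.castRingHom ℝ) intC = genC 1 := by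
  ext i j; fin_cases i <;> fin_cases j <;> simp [intC, intInvolution, genC]; norm_num

theorem map_neg_one {R : Type*} [CommRing R] (f : ℤ →+* R) :
    Matrix.GeneralLinearGroup.map (n := Fin 2) f (-1) = -1 := by
  ext i j; fin_cases i <;> fin_cases j <;> simp

theorem intA_mem : intA ∈ intGenGroup := by
  rw [intGenGroup, Subgroup.mem_comap, map_intA]; exact genA_mem_genGroup 1

theorem intB_mem : intB ∈ intGenGroup := by
  rw [intGenGroup, Subgroup.mem_comap, map_intB]; exact genB_mem_genGroup 1

theorem intC_mem : intC ∈ intGenGroup := by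
  rw [intGenGroup, Subgroup.mem_comap, map_intC]; exact genC_mem_genGroup 1

theorem neg_one_mem_intGenGroup : -1 ∈ intGenGroup := by
  rw [intGenGroup, Subgroup.mem_comap, map_neg_one]; exact neg_one_mem_genGroup 1

theorem intA_mul (h : GL (Fin 2) ℤ) :
    (intA * h).1 = !![-h.1 0 0, -h.1 0 1; h.1 1 0, h.1 1 1] := by
  ext i j; fin_cases i <;> fin_cases j <;> simp [intA, intInvolution, Matrix.mul_apply]

theorem intB_mul (h : GL (Fin 2) ℤ) :
    (intB * h).1 = !![-h.1 0 0 + 2 * h.1 1 0, -h.1 0 1 + 2 * h.1 1 1; h.1 1 0, h.1 1 1] := by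
  ext i j; fin_cases i <;> fin_cases j <;> simp [intB, intInvolution, Matrix.mul_apply]

theorem intC_mul (h : GL (Fin 2) ℤ) :
    (intC * h).1 = !![-h.1 0 0, -h.1 0 1; -2 * h.1 0 0 + h.1 1 0, -2 * h.1 0 1 + h.1 1 1] := by
  ext i j; fin_cases i <;> fin_cases j <;> simp [intC, intInvolution, Matrix.mul_apply]

/-- Congruence to the identity modulo two. -/
def CongOne (h : GL (Fin 2) ℤ) : Prop :=
  h.1 0 0 % 2 = 1 ∧ h.1 0 1 % 2 = 0 ∧ h.1 1 0 % 2 = 0 ∧ h.1 1 1 % 2 = 1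

theorem CongOne.of_mem_ker {h : GL (Fin 2) ℤ}
    (hh : h ∈ (Matrix.GeneralLinearGroup.map (n := Fin 2) (Int.castRingHom (ZMod 2))).ker) :
    CongOne h := by
  have H : ∀ i j, ((h.1 i j : ℤ) : ZMod 2) = (1 : Matrix (Fin 2) (Fin 2) (ZMod 2)) i j := by
    intro i j
    have := congrArg (fun g : GL (Fin 2) (ZMod 2) => g.1 i j) (MonoidHom.mem_ker.1 hh)
    simpa using this
  have one : ∀ a : ℤ, (a : ZMod 2) = 1 → a % 2 = 1 := fun a ha => by
    have : ((a - 1 : ℤ) : ZMod 2) = 0 := by push_cast; rw [ha]; rfl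
    rw [ZMod.intCast_zmod_eq_zero_iff_dvd] at this
    omega
  have zero : ∀ a : ℤ, (a : ZMod 2) = 0 → a % 2 = 0 := fun a ha => by
    have := (ZMod.intCast_zmod_eq_zero_iff_dvd a 2).1 ha
    omega
  exact ⟨one _ (H 0 0), zero _ (H 0 1), zero _ (H 1 0), one _ (H 1 1)⟩

theorem mem_intGenGroup_of_mul_mem {h g : GL (Fin 2) ℤ} (hg : g ∈ intGenGroup) (H : g * h ∈ intGenGroup) :
    h ∈ intGenGroup := by
  have := mul_mem (inv_mem hg) H
  rwa [inv_mul_cancel_left] at this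

theorem mem_intGenGroup_of_triangular (n : ℕ) : ∀ {h : GL (Fin 2) ℤ}, h.1 0 0 = 1 → h.1 1 0 = 0 →
    h.1 1 1 = 1 → (h.1 0 1).natAbs = 2 * n → h ∈ intGenGroup := by
  induction n with
  | zero =>
    intro h h00 h10 h11 h01
    have : h = 1 := by
      ext i j
      fin_cases i <;> fin_cases j <;> simp [h00, h10, h11]
      omega
    rw [this]
    exact one_mem _
  | succ n ih =>
    intro h h00 h10 h11 h01
    rcases le_total 0 (h.1 0 1) with hs | hs
    · refine mem_intGenGroup_of_mul_mem (mul_mem intA_mem intB_mem) (ih ?_ ?_ ?_ ?_) <;>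
        rw [mul_assoc, intA_mul, intB_mul] <;> simp [h00, h10, h11]
      omega
    · refine mem_intGenGroup_of_mul_mem (mul_mem intB_mem intA_mem) (ih ?_ ?_ ?_ ?_) <;>
        rw [mul_assoc, intB_mul, intA_mul] <;> simp [h00, h10, h11]
      omega

/-- Euclidean algorithm on the first column, `n` bounding the sum of its absolute values. One entry
is odd and the other even, so they never agree in absolute value, and adding or subtracting twice
the smaller one (if nonzero) shrinks the larger. It ends at a triangular matrix with diagonal
entries ±1. -/
theorem CongOne.mem_intGenGroup (n : ℕ) : ∀ {h : GL (Fin 2) ℤ}, CongOne h →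
    (h.1 0 0).natAbs + (h.1 1 0).natAbs ≤ n → h ∈ intGenGroup := by
  induction n with
  | zero =>
    rintro h ⟨h1, -⟩ hn
    omega
  | succ n ih =>
    rintro h ⟨h1, h2, h3, h4⟩ hn
    by_cases h10 : h.1 1 0 = 0
    · have hdet : IsUnit (h.1 0 0 * h.1 1 1) := by
        have : IsUnit h.1.det := (Matrix.isUnit_iff_isUnit_det _).1 h.isUnit
        rwa [Matrix.det_fin_two, h10, mul_zero, sub_zero] at this
      rw [IsUnit.mul_iff, Int.isUnit_iff, Int.isUnit_iff] at hdet
      obtain ⟨m, hm⟩ : ∃ m, (h.1 0 1).natAbs = 2 * m := ⟨(h.1 0 1).natAbs / 2, by omega⟩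
      have hneg : ∀ g : GL (Fin 2) ℤ, (-1 * g).1 = -g.1 := by intro g; simp
      rcases hdet with ⟨ha | ha, hd | hd⟩
      · exact mem_intGenGroup_of_triangular m ha h10 hd hm
      · refine mem_intGenGroup_of_mul_mem (mul_mem neg_one_mem_intGenGroup intA_mem)
          (mem_intGenGroup_of_triangular m ?_ ?_ ?_ ?_) <;>
          rw [mul_assoc, hneg, intA_mul] <;> simp [ha, h10, hd, hm]
      · refine mem_intGenGroup_of_mul_mem intA_mem (mem_intGenGroup_of_triangular m ?_ ?_ ?_ ?_) <;>
          rw [intA_mul] <;> simp [ha, h10, hd, hm]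
      · refine mem_intGenGroup_of_mul_mem neg_one_mem_intGenGroup
          (mem_intGenGroup_of_triangular m ?_ ?_ ?_ ?_) <;>
          rw [hneg] <;> simp [ha, h10, hd, hm]
    · have step : ∀ g ∈ intGenGroup, CongOne (g * h) →
          ((g * h).1 0 0).natAbs + ((g * h).1 1 0).natAbs ≤ n → h ∈ intGenGroup :=
        fun g hg hc hl => mem_intGenGroup_of_mul_mem hg (ih hc hl)
      rcases Nat.lt_or_ge (h.1 1 0).natAbs (h.1 0 0).natAbs with hlt | hge
      · by_cases hs : (-h.1 0 0 + 2 * h.1 1 0).natAbs < (h.1 0 0).natAbs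
        · refine step intB intB_mem ?_ ?_
          · unfold CongOne; rw [intB_mul]; simp; omega
          · rw [intB_mul]; simp; omega
        · refine step (intB * intA) (mul_mem intB_mem intA_mem) ?_ ?_
          · unfold CongOne; rw [mul_assoc, intB_mul, intA_mul]; simp; omega
          · rw [mul_assoc, intB_mul, intA_mul]; simp; omega
      · by_cases hs : (-2 * h.1 0 0 + h.1 1 0).natAbs < (h.1 1 0).natAbs
        · refine step intC intC_mem ?_ ?_
          · unfold CongOne; rw [intC_mul]; simp; omega
          · rw [intC_mul]; simp; omega
        · refine step (intC * intA) (mul_mem intC_mem intA_mem) ?_ ?_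
          · unfold CongOne; rw [mul_assoc, intC_mul, intA_mul]; simp; omega
          · rw [mul_assoc, intC_mul, intA_mul]; simp; omega

theorem genGroup_one : genGroup 1 = congruenceTwo := by
  apply le_antisymm
  · refine (Subgroup.closure_le _).2 ?_
    rintro g (rfl | rfl | rfl | rfl)
    · refine ⟨-1, MonoidHom.mem_ker.2 ?_, map_neg_one _⟩
      rw [map_neg_one]
      ext i j; fin_cases i <;> fin_cases j <;> rfl
    · refine ⟨intA, MonoidHom.mem_ker.2 ?_, map_intA⟩
      ext i j; fin_cases i <;> fin_cases j <;> rfl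
    · refine ⟨intB, MonoidHom.mem_ker.2 ?_, map_intB⟩
      ext i j; fin_cases i <;> fin_cases j <;> rfl
    · refine ⟨intC, MonoidHom.mem_ker.2 ?_, map_intC⟩
      ext i j; fin_cases i <;> fin_cases j <;> rfl
  · rintro _ ⟨h, hh, rfl⟩
    exact (CongOne.of_mem_ker hh).mem_intGenGroup _ le_rfl

/-! ### Fundamental domains and the Haar measure of Siegel sets -/

open MeasureTheory Topology Pointwise in
/-- A discrete subgroup of a second countable group has a measurable fundamental domain inside
every measurable set that meets all orbits. -/
theorem exists_isFundamentalDomain_subset {H : Type*} [Group H] [TopologicalSpace H]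
    [IsTopologicalGroup H] [SecondCountableTopology H] [MeasurableSpace H] [BorelSpace H]
    (Λ : Subgroup H) [DiscreteTopology Λ] (μ : Measure H) {D : Set H} (hD : MeasurableSet D)
    (hcov : ∀ x, ∃ γ : Λ, γ • x ∈ D) : ∃ F ⊆ D, IsFundamentalDomain Λ F μ := by
  have hΛ : Countable Λ := TopologicalSpace.separableSpace_iff_countable.1 inferInstance
  obtain ⟨U, hU, hUΛ⟩ : ∃ U : Set H, IsOpen U ∧ ∀ γ : Λ, (γ : H) ∈ U ↔ γ = 1 := by
    obtain ⟨U, hU, e⟩ := isOpen_induced_iff.1 (isOpen_discrete ({1} : Set Λ))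
    exact ⟨U, hU, fun γ => by rw [← Set.mem_singleton_iff, ← e]; rfl⟩
  -- Since `p * q⁻¹` is near 1 for `p` and `q` near `x`, discreteness gives a neighbourhood of `x`
  -- that meets each orbit at most once.
  have hloc : ∀ x : H, ∃ V : Set H, IsOpen V ∧ x ∈ V ∧ ∀ γ : Λ, ∀ y ∈ V, (γ : H) * y ∈ V → γ = 1 := by
    intro x
    have hcont : Continuous fun p : H × H => p.1 * p.2⁻¹ := by fun_prop
    obtain ⟨V, W, hV, hW, hxV, hxW, hsub⟩ := isOpen_prod_iff.1 (hU.preimage hcont) x x (by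
      have := (hUΛ 1).2 rfl
      simpa using this)
    refine ⟨V ∩ W, hV.inter hW, ⟨hxV, hxW⟩, fun γ y hy hγy => (hUΛ γ).1 ?_⟩
    have := @hsub ((γ : H) * y, y) ⟨hγy.1, hy.2⟩
    simpa using this
  choose V hVo hxV hVinj using hloc
  obtain ⟨s, hs, hsU⟩ := TopologicalSpace.countable_cover_nhds fun x => (hVo x).mem_nhds (hxV x)
  have hne : s.Nonempty := by
    by_contra h
    rw [Set.not_nonempty_iff_eq_empty] at h
    have : (1 : H) ∈ (⋃ x ∈ s, V x) := by rw [hsU]; trivial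
    simp [h] at this
  obtain ⟨f, rfl⟩ := hs.exists_eq_range hne
  simp only [Set.biUnion_range] at hsU
  set E : ℕ → Set H := fun n => D ∩ V (f n) with hE
  have hEm : ∀ n, MeasurableSet (E n) := fun n => hD.inter (hVo _).measurableSet
  -- From each orbit `F` keeps the point in the first `E n` that the orbit meets.
  set F : Set H := ⋃ n, E n \ ⋃ m < n, ⋃ γ : Λ, γ • E m with hF
  have hmemF : ∀ {x}, x ∈ F ↔ ∃ n, x ∈ E n ∧ ∀ m < n, ∀ γ : Λ, γ • x ∉ E m := by
    intro x
    simp only [hF, Set.mem_iUnion, Set.mem_sdiff, not_exists]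
    refine exists_congr fun n => and_congr_right fun _ => forall₂_congr fun m _ => ?_
    constructor
    · intro h γ hγ
      exact h γ⁻¹ (by rwa [Set.mem_smul_set_iff_inv_smul_mem, inv_inv])
    · intro h γ hγ
      exact h γ⁻¹ (by rwa [Set.mem_smul_set_iff_inv_smul_mem] at hγ)
  refine ⟨F, ?_, IsFundamentalDomain.mk' ?_ fun x => ?_⟩
  · intro x hx
    obtain ⟨n, hn, -⟩ := hmemF.1 hx
    exact hn.1
  · refine (MeasurableSet.iUnion fun n => (hEm n).diff ?_).nullMeasurableSet
    exact MeasurableSet.iUnion fun m => MeasurableSet.iUnion fun _ => MeasurableSet.iUnion fun γ =>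
      (hEm m).const_smul γ
  · have hex : ∃ n, ∃ γ : Λ, γ • x ∈ E n := by
      obtain ⟨γ, hγ⟩ := hcov x
      have : γ • x ∈ ⋃ n, V (f n) := by rw [hsU]; trivial
      obtain ⟨n, hn⟩ := Set.mem_iUnion.1 this
      exact ⟨n, γ, hγ, hn⟩
    classical
    obtain ⟨γ, hγ⟩ := Nat.find_spec hex
    have hmin : ∀ m < Nat.find hex, ∀ γ : Λ, γ • x ∉ E m := fun m hm γ h =>
      Nat.find_min hex hm ⟨γ, h⟩
    refine ⟨γ, hmemF.2 ⟨_, hγ, fun m hm γ' => ?_⟩, ?_⟩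
    · rw [smul_smul]
      exact hmin m hm _
    · intro γ' hγ'
      obtain ⟨n, hn, hn'⟩ := hmemF.1 hγ'
      have hnn : n = Nat.find hex := by
        apply le_antisymm
        · by_contra! hlt
          refine hn' _ hlt (γ * γ'⁻¹) ?_
          rwa [smul_smul, inv_mul_cancel_right]
        · exact Nat.find_min' hex ⟨γ', hn⟩
      subst hnn
      have h1 := hVinj _ (γ * γ'⁻¹) (γ' • x) hn.2 (by
        have := hγ.2
        rw [show γ • x = (γ * γ'⁻¹) • γ' • x by rw [smul_smul, inv_mul_cancel_right]] at this
        exact this)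
      exact (mul_inv_eq_one.1 h1).symm

/-- The inclusion of `SL^±(2, ℝ)` in the space of matrices. -/
def slMat (h : SLpm) : Matrix (Fin 2) (Fin 2) ℝ := (h : GL (Fin 2) ℝ).1

theorem slMat_det (h : SLpm) : (slMat h).det = 1 ∨ (slMat h).det = -1 := h.2

theorem slMat_mul (g h : SLpm) : slMat (g * h) = slMat g * slMat h := rfl

/-- The topology of the unit group also involves the inverse, which is a continuous function of the
matrix where it is invertible. Countability, local compactness and compactness of bounded closed
sets can thus be taken from the space of matrices. -/
theorem isClosedEmbedding_slMat : Topology.IsClosedEmbedding slMat := by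
  refine ⟨?_, ?_⟩
  · have hf : ContinuousOn (fun M : Matrix (Fin 2) (Fin 2) ℝ => M.det⁻¹ • M.adjugate)
        {M | IsUnit M} := by
      refine ContinuousOn.smul (ContinuousOn.inv₀ continuous_id.matrix_det.continuousOn
        fun M hM => ?_) continuous_id.matrix_adjugate.continuousOn
      exact ((Matrix.isUnit_iff_isUnit_det _).1 hM).ne_zero
    refine (Units.isEmbedding_val_mk' hf fun u => ?_).comp Topology.IsEmbedding.subtypeVal
    rw [Matrix.coe_units_inv, Matrix.inv_def, Ring.inverse_eq_inv']
  · have : Set.range slMat = {M : Matrix (Fin 2) (Fin 2) ℝ | M.det = 1 ∨ M.det = -1} := by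
      ext M
      constructor
      · rintro ⟨h, rfl⟩
        exact slMat_det h
      · intro hM
        have hu : IsUnit M := by
          rw [Matrix.isUnit_iff_isUnit_det]
          rcases hM with h | h <;> simp [h]
        obtain ⟨u, rfl⟩ := hu
        exact ⟨⟨u, hM⟩, rfl⟩
    rw [this]
    exact (isClosed_eq (by fun_prop) continuous_const).union
      (isClosed_eq (by fun_prop) continuous_const)

instance : SecondCountableTopology SLpm := by
  have : SecondCountableTopology (Matrix (Fin 2) (Fin 2) ℝ) :=
    inferInstanceAs (SecondCountableTopology (Fin 2 → Fin 2 → ℝ))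
  exact isClosedEmbedding_slMat.isEmbedding.secondCountableTopology

instance : LocallyCompactSpace SLpm := by
  have : LocallyCompactSpace (Matrix (Fin 2) (Fin 2) ℝ) :=
    inferInstanceAs (LocallyCompactSpace (Fin 2 → Fin 2 → ℝ))
  exact isClosedEmbedding_slMat.locallyCompactSpace

theorem continuous_slMat_apply (i j : Fin 2) : Continuous fun h : SLpm => slMat h i j :=
  (continuous_apply_apply i j).comp isClosedEmbedding_slMat.continuous

theorem isCompact_slMat_bounded (C : ℝ) : IsCompact {h : SLpm | ∀ i j, |slMat h i j| ≤ C} := by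
  have hK : IsCompact (Set.pi Set.univ fun _ : Fin 2 => Set.pi Set.univ fun _ : Fin 2 =>
      Set.Icc (-C) C) :=
    isCompact_univ_pi fun _ => isCompact_univ_pi fun _ => isCompact_Icc
  convert isClosedEmbedding_slMat.isCompact_preimage hK using 1
  ext h
  change (∀ i j, |slMat h i j| ≤ C) ↔
    ∀ i ∈ Set.univ, ∀ j ∈ Set.univ, slMat h i j ∈ Set.Icc (-C) C
  simp only [abs_le, Set.mem_Icc, Set.mem_univ, true_imp_iff]

/-- The real part of the image of `i` under `h`. -/
noncomputable def slRe (h : SLpm) : ℝ :=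
  (slMat h 0 0 * slMat h 1 0 + slMat h 0 1 * slMat h 1 1) / (slMat h 1 0 ^ 2 + slMat h 1 1 ^ 2)

/-- The imaginary part of the image of `i` under `h`. -/
noncomputable def slIm (h : SLpm) : ℝ := 1 / (slMat h 1 0 ^ 2 + slMat h 1 1 ^ 2)

theorem sq_add_sq_pos (h : SLpm) : 0 < slMat h 1 0 ^ 2 + slMat h 1 1 ^ 2 := by
  by_contra! hle
  have h0 : slMat h 1 0 = 0 := by nlinarith [sq_nonneg (slMat h 1 0), sq_nonneg (slMat h 1 1)]
  have h1 : slMat h 1 1 = 0 := by nlinarith [sq_nonneg (slMat h 1 0), sq_nonneg (slMat h 1 1)]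
  have := slMat_det h
  rw [Matrix.det_fin_two, h0, h1] at this
  norm_num at this

theorem slIm_pos (h : SLpm) : 0 < slIm h := one_div_pos.2 (sq_add_sq_pos h)

theorem abs_det_coe (h : SLpm) : |((h : GL (Fin 2) ℝ).det : ℝ)| = 1 := by
  have := slMat_det h
  rw [Matrix.GeneralLinearGroup.val_det_apply]
  rcases this with h | h <;> (unfold slMat at h; rw [h]; norm_num)

theorem re_smul_I (h : SLpm) : ((h : GL (Fin 2) ℝ) • UpperHalfPlane.I).re = slRe h := by
  rw [UpperHalfPlane.re_smul]
  simp [UpperHalfPlane.num, UpperHalfPlane.denom, Complex.div_re, Complex.normSq_apply, slRe, slMat]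
  ring

theorem im_smul_I (h : SLpm) : ((h : GL (Fin 2) ℝ) • UpperHalfPlane.I).im = slIm h := by
  rw [UpperHalfPlane.im_smul_eq_div_normSq, abs_det_coe]
  simp [UpperHalfPlane.denom, Complex.normSq_apply, slIm, slMat]
  ring

theorem continuous_slRe : Continuous slRe :=
  have h := continuous_slMat_apply
  (((h 0 0).mul (h 1 0)).add ((h 0 1).mul (h 1 1))).div (((h 1 0).pow 2).add ((h 1 1).pow 2))
    fun x => (sq_add_sq_pos x).ne'

theorem continuous_slIm : Continuous slIm :=
  have h := continuous_slMat_apply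
  continuous_const.div (((h 1 0).pow 2).add ((h 1 1).pow 2)) fun x => (sq_add_sq_pos x).ne'

/-- The unipotent matrix with entry `y`. -/
def slUnip (y : ℝ) : SLpm :=
  ⟨⟨!![1, y; 0, 1], !![1, -y; 0, 1],
    by ext i j; fin_cases i <;> fin_cases j <;> simp,
    by ext i j; fin_cases i <;> fin_cases j <;> simp⟩, by left; simp [Matrix.det_fin_two]⟩

/-- The diagonal matrix with entries `s` and `s⁻¹`. -/
noncomputable def slDiag (s : ℝ) (hs : s ≠ 0) : SLpm :=
  ⟨⟨!![s, 0; 0, s⁻¹], !![s⁻¹, 0; 0, s],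
    by ext i j; fin_cases i <;> fin_cases j <;> simp [hs],
    by ext i j; fin_cases i <;> fin_cases j <;> simp [hs]⟩, by left; simp [Matrix.det_fin_two, hs]⟩

theorem slMat_unip_mul (y : ℝ) (h : SLpm) : slMat (slUnip y * h) =
    !![slMat h 0 0 + y * slMat h 1 0, slMat h 0 1 + y * slMat h 1 1; slMat h 1 0, slMat h 1 1] := by
  rw [slMat_mul]
  ext i j; fin_cases i <;> fin_cases j <;> simp [slMat, slUnip, Matrix.mul_apply]

theorem slMat_diag_mul {s : ℝ} (hs : s ≠ 0) (h : SLpm) : slMat (slDiag s hs * h) =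
    !![s * slMat h 0 0, s * slMat h 0 1; s⁻¹ * slMat h 1 0, s⁻¹ * slMat h 1 1] := by
  rw [slMat_mul]
  ext i j; fin_cases i <;> fin_cases j <;> simp [slMat, slDiag, Matrix.mul_apply]

theorem slRe_unip_mul (y : ℝ) (h : SLpm) : slRe (slUnip y * h) = slRe h + y := by
  have := (sq_add_sq_pos h).ne'
  rw [slRe, slMat_unip_mul]
  simp [slRe]
  field_simp
  ring

theorem slIm_unip_mul (y : ℝ) (h : SLpm) : slIm (slUnip y * h) = slIm h := by
  rw [slIm, slMat_unip_mul]
  simp [slIm]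

theorem slRe_diag_mul {s : ℝ} (hs : s ≠ 0) (h : SLpm) :
    slRe (slDiag s hs * h) = s ^ 2 * slRe h := by
  have := (sq_add_sq_pos h).ne'
  rw [slRe, slMat_diag_mul]
  simp [slRe]
  rw [show (s⁻¹ * slMat h 1 0) ^ 2 + (s⁻¹ * slMat h 1 1) ^ 2 =
    (slMat h 1 0 ^ 2 + slMat h 1 1 ^ 2) / s ^ 2 by field_simp]
  field_simp

theorem slIm_diag_mul {s : ℝ} (hs : s ≠ 0) (h : SLpm) :
    slIm (slDiag s hs * h) = s ^ 2 * slIm h := by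
  have := (sq_add_sq_pos h).ne'
  rw [slIm, slMat_diag_mul]
  simp [slIm]
  rw [show (s⁻¹ * slMat h 1 0) ^ 2 + (s⁻¹ * slMat h 1 1) ^ 2 =
    (slMat h 1 0 ^ 2 + slMat h 1 1 ^ 2) / s ^ 2 by field_simp]
  field_simp

/-- The lower row has squared norm t = 1 / `slIm h`. As the determinant squares to 1, Lagrange's
identity gives the upper row squared norm (`slRe h`)² t + `slIm h`. These are at most 2 and 4. -/
theorem abs_slMat_le {h : SLpm} (h0 : 0 ≤ slRe h) (h1 : slRe h ≤ 1) (h2 : 1 / 2 ≤ slIm h)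
    (h3 : slIm h ≤ 2) (i j : Fin 2) : |slMat h i j| ≤ 2 := by
  have hpos := sq_add_sq_pos h
  have him : slIm h * (slMat h 1 0 ^ 2 + slMat h 1 1 ^ 2) = 1 := by
    unfold slIm; field_simp
  have hre : slRe h * (slMat h 1 0 ^ 2 + slMat h 1 1 ^ 2) =
      slMat h 0 0 * slMat h 1 0 + slMat h 0 1 * slMat h 1 1 := by
    unfold slRe; field_simp
  have hdet : (slMat h 0 0 * slMat h 1 1 - slMat h 0 1 * slMat h 1 0) ^ 2 = 1 := by
    have := slMat_det h
    rw [Matrix.det_fin_two] at this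
    rcases this with h | h <;> rw [h] <;> norm_num
  set t := slMat h 1 0 ^ 2 + slMat h 1 1 ^ 2 with ht
  have ht2 : t ≤ 2 := by nlinarith
  have hrow : slMat h 0 0 ^ 2 + slMat h 0 1 ^ 2 = slRe h ^ 2 * t + slIm h := by
    have e : (slMat h 0 0 ^ 2 + slMat h 0 1 ^ 2) * t = (slRe h ^ 2 * t + slIm h) * t := by
      rw [show (slRe h ^ 2 * t + slIm h) * t = (slRe h * t) ^ 2 + slIm h * t by ring, hre, him, ht]
      linear_combination hdet
    exact mul_right_cancel₀ hpos.ne' e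
  have hrow' : slMat h 0 0 ^ 2 + slMat h 0 1 ^ 2 ≤ 4 := by
    have : slRe h ^ 2 ≤ 1 := by nlinarith
    nlinarith
  refine abs_le_of_sq_le_sq ?_ (by norm_num)
  fin_cases i <;> fin_cases j <;> simp <;>
    nlinarith [sq_nonneg (slMat h 0 0), sq_nonneg (slMat h 0 1), sq_nonneg (slMat h 1 0),
      sq_nonneg (slMat h 1 1)]

open MeasureTheory

/-- The elements that map `i` to a point with real part in `I` and imaginary part in
`[1/2, 2)`. -/
def siegelBox (I : Set ℝ) : Set SLpm := {h | slRe h ∈ I ∧ slIm h ∈ Set.Ico (1 / 2) 2}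

theorem measure_siegelBox_lt_top [MeasurableSpace SLpm] (μ : Measure SLpm) [μ.IsHaarMeasure] :
    μ (siegelBox (Set.Ico 0 1)) < ∞ := by
  refine (measure_mono ?_).trans_lt (isCompact_slMat_bounded 2).measure_lt_top
  rintro h ⟨h1, h2⟩
  exact abs_slMat_le h1.1 h1.2.le h2.1 h2.2.le

section Measure

variable [MeasurableSpace SLpm] [BorelSpace SLpm] (μ : Measure SLpm) [μ.IsHaarMeasure]

theorem measurableSet_siegelBox {I : Set ℝ} (hI : MeasurableSet I) :
    MeasurableSet (siegelBox I) :=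
  (continuous_slRe.measurable hI).inter (continuous_slIm.measurable measurableSet_Ico)

theorem measure_siegelBox_shift (a b y : ℝ) :
    μ (siegelBox (Set.Ico (a + y) (b + y))) = μ (siegelBox (Set.Ico a b)) := by
  rw [← measure_preimage_mul μ (slUnip y)]
  congr 1
  ext h
  simp [siegelBox, slRe_unip_mul, slIm_unip_mul]

/-- The unit box contains `M` disjoint left translates of the narrow box by unipotent matrices, and
these all have the same measure. -/
theorem measure_siegelBox_le (M : ℕ) (hM : 0 < M) :
    μ (siegelBox (Set.Ico 0 (1 / M))) ≤ μ (siegelBox (Set.Ico 0 1)) / M := by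
  have hM' : (0 : ℝ) < M := by exact_mod_cast hM
  rw [ENNReal.le_div_iff_mul_le (Or.inl (by exact_mod_cast hM.ne')) (Or.inl (by simp))]
  have hsum : ∑ i ∈ Finset.range M, μ (siegelBox (Set.Ico ((i : ℝ) / M) ((i + 1) / M))) =
      M * μ (siegelBox (Set.Ico 0 (1 / M))) := by
    rw [Finset.sum_congr rfl (g := fun _ => μ (siegelBox (Set.Ico 0 (1 / M))))]
    · simp
    · intro i _
      rw [← measure_siegelBox_shift μ 0 (1 / M) (i / M)]
      congr 3 <;> ring
  rw [mul_comm, ← hsum, ← measure_biUnion_finset]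
  · refine measure_mono ?_
    intro h hh
    simp only [Set.mem_iUnion, Finset.mem_range] at hh
    obtain ⟨i, hi, ⟨h1, h2⟩, h3⟩ := hh
    have hi' : (i : ℝ) + 1 ≤ M := by exact_mod_cast hi
    exact ⟨⟨le_trans (by positivity) h1, h2.trans_le ((div_le_one hM').2 hi')⟩, h3⟩
  · intro i _ j _ hij
    refine Set.disjoint_left.2 ?_
    rintro h ⟨⟨h1, h2⟩, -⟩ ⟨⟨h3, h4⟩, -⟩
    have k1 := (div_lt_div_iff_of_pos_right hM').1 (h1.trans_lt h4)
    have k2 := (div_lt_div_iff_of_pos_right hM').1 (h3.trans_lt h2)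
    have : i < j + 1 := by exact_mod_cast k1
    have : j < i + 1 := by exact_mod_cast k2
    omega
  · exact fun i _ => measurableSet_siegelBox measurableSet_Ico

/-- A Siegel set: the elements that map `i` into a half strip. -/
def siegelSet : Set SLpm := {h | slRe h ∈ Set.Icc (-1 / 2) (1 / 2) ∧ 1 / 2 ≤ slIm h}

theorem measurableSet_siegelSet : MeasurableSet siegelSet :=
  (continuous_slRe.measurable measurableSet_Icc).inter
    (continuous_slIm.measurable measurableSet_Ici)

/-- The part of the half strip with imaginary part in [4^j / 2, 4^{j+1} / 2) is moved by the inverse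
of the diagonal matrix with entries 2^j, 2^{-j} into a box of width 2 / 4^j over [1/2, 2). Left
invariance bounds the total by a geometric series, so no explicit formula for the Haar measure is
needed. -/
theorem measure_siegelSet_lt_top : μ siegelSet < ∞ := by
  set C := μ (siegelBox (Set.Ico 0 1)) with hC
  have hpow : ∀ j : ℕ, ((2 : ℝ) ^ j) ^ 2 = 4 ^ j := fun j => by
    rw [← pow_mul, mul_comm, pow_mul]; norm_num
  have hne : ∀ j : ℕ, (2 : ℝ) ^ j ≠ 0 := fun j => by positivity
  have hcover : siegelSet ⊆ ⋃ j : ℕ, ((slDiag (2 ^ j) (hne j))⁻¹ * ·) ⁻¹'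
      siegelBox (Set.Ico (-(1 / (4 ^ j : ℕ))) (1 / (4 ^ j : ℕ))) := by
    rintro h ⟨h1, h2⟩
    obtain ⟨j, hj1, hj2⟩ := exists_nat_pow_near (show 1 ≤ 2 * slIm h by linarith)
      (by norm_num : (1 : ℝ) < 4)
    refine Set.mem_iUnion.2 ⟨j, ?_⟩
    have h4 : (0 : ℝ) < 4 ^ j := by positivity
    obtain ⟨g, rfl⟩ : ∃ g, h = slDiag (2 ^ j) (hne j) * g :=
      ⟨_, (mul_inv_cancel_left _ _).symm⟩
    rw [slRe_diag_mul, hpow] at h1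
    rw [slIm_diag_mul, hpow] at hj1 hj2
    simp only [Set.mem_preimage, inv_mul_cancel_left]
    rw [pow_succ] at hj2
    push_cast
    refine ⟨⟨?_, ?_⟩, ?_, ?_⟩
    · rw [neg_le, ← mul_le_mul_iff_right₀ h4, mul_one_div_cancel h4.ne']
      linarith [h1.1]
    · rw [← mul_lt_mul_iff_right₀ h4, mul_one_div_cancel h4.ne']
      linarith [h1.2]
    · by_contra! hlt
      nlinarith
    · by_contra! hlt
      nlinarith
  have hle : ∀ j : ℕ, μ (siegelBox (Set.Ico (-(1 / (4 ^ j : ℕ))) (1 / (4 ^ j : ℕ)))) ≤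
      2 * C * (4⁻¹ : ℝ≥0∞) ^ j := by
    intro j
    set δ : ℝ := 1 / (4 ^ j : ℕ) with hδ
    have hsub : siegelBox (Set.Ico (-δ) δ) ⊆
        siegelBox (Set.Ico (0 + -δ) (δ + -δ)) ∪ siegelBox (Set.Ico 0 δ) := by
      rintro h ⟨h1, h2⟩
      rcases lt_or_ge (slRe h) 0 with h0 | h0
      · exact Or.inl ⟨⟨by linarith [h1.1], by linarith⟩, h2⟩
      · exact Or.inr ⟨⟨h0, h1.2⟩, h2⟩
    calc _ ≤ _ := (measure_mono hsub).trans (measure_union_le _ _)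
      _ = 2 * μ (siegelBox (Set.Ico 0 δ)) := by rw [measure_siegelBox_shift, two_mul]
      _ ≤ 2 * (C / (4 ^ j : ℕ)) := by
        gcongr
        exact measure_siegelBox_le μ (4 ^ j) (by positivity)
      _ = _ := by
        rw [mul_assoc, ENNReal.div_eq_inv_mul, mul_comm _ C, ← ENNReal.inv_pow, Nat.cast_pow,
          Nat.cast_ofNat]
  calc μ siegelSet ≤ ∑' j : ℕ, 2 * C * (4⁻¹ : ℝ≥0∞) ^ j := by
        refine (measure_mono hcover).trans ((measure_iUnion_le _).trans ?_)
        refine ENNReal.tsum_le_tsum fun j => ?_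
        rw [measure_preimage_mul]
        exact hle j
    _ < ∞ := by
      rw [ENNReal.tsum_mul_left, ENNReal.tsum_geometric]
      refine ENNReal.mul_lt_top (ENNReal.mul_lt_top (by simp) (measure_siegelBox_lt_top μ)) ?_
      rw [ENNReal.inv_lt_top, tsub_pos_iff_lt]
      exact ENNReal.inv_lt_one.2 (by norm_num)

end Measure

/-! ### The congruence two subgroup is a lattice -/

open scoped MatrixGroups

theorem congruenceTwo_le_SLpm : congruenceTwo ≤ SLpm := by
  rintro _ ⟨h, -, rfl⟩
  have : IsUnit h.1.det := (Matrix.isUnit_iff_isUnit_det _).1 h.isUnit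
  have e : (Matrix.GeneralLinearGroup.map (n := Fin 2) (Int.castRingHom ℝ) h).1.det =
      ((h.1.det : ℤ) : ℝ) := by
    simp [Matrix.det_fin_two]
  change _ = _ ∨ _ = _
  rw [e]
  rcases Int.isUnit_iff.1 this with h | h <;> rw [h] <;> simp

/-- The congruence two subgroup as a subgroup of `SL^±(2, ℝ)`. -/
def slCongruenceTwo : Subgroup SLpm := congruenceTwo.subgroupOf SLpm

theorem exists_int_of_mem_slCongruenceTwo {h : SLpm} (hh : h ∈ slCongruenceTwo) (i j : Fin 2) :
    ∃ n : ℤ, slMat h i j = n := by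
  obtain ⟨g, -, e⟩ := Subgroup.mem_subgroupOf.1 hh
  refine ⟨g.1 i j, ?_⟩
  rw [slMat, ← e]
  simp

instance : DiscreteTopology slCongruenceTwo := by
  refine discreteTopology_of_isOpen_singleton_one ?_
  have hopen : IsOpen {γ : slCongruenceTwo | ∀ i j,
      slMat γ i j ∈ Metric.ball ((1 : Matrix (Fin 2) (Fin 2) ℝ) i j) 1} := by
    have : {γ : slCongruenceTwo | ∀ i j,
        slMat γ i j ∈ Metric.ball ((1 : Matrix (Fin 2) (Fin 2) ℝ) i j) 1} =
        ⋂ i, ⋂ j, (fun γ : slCongruenceTwo => slMat γ i j) ⁻¹'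
          Metric.ball ((1 : Matrix (Fin 2) (Fin 2) ℝ) i j) 1 := by
      ext; simp
    rw [this]
    exact isOpen_iInter_of_finite fun i => isOpen_iInter_of_finite fun j =>
      Metric.isOpen_ball.preimage ((continuous_slMat_apply i j).comp continuous_subtype_val)
  convert hopen using 1
  ext γ
  constructor
  · rintro rfl i j
    exact Metric.mem_ball_self one_pos
  · intro h
    refine Subtype.ext (isClosedEmbedding_slMat.injective ?_)
    ext i j
    obtain ⟨n, hn⟩ := exists_int_of_mem_slCongruenceTwo γ.2 i j
    obtain ⟨m, hm⟩ := exists_int_of_mem_slCongruenceTwo (one_mem slCongruenceTwo) i j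
    have h1 := h i j
    change slMat γ i j = slMat 1 i j
    change slMat γ i j ∈ Metric.ball (slMat 1 i j) 1 at h1
    rw [hn, hm, Metric.mem_ball, Real.dist_eq] at h1
    rw [hn, hm]
    have : |n - m| < 1 := by exact_mod_cast h1
    rw [Int.abs_lt_one_iff, sub_eq_zero] at this
    rw [this]

/-- `SL(2, ℤ)` as a subgroup of `SL^±(2, ℝ)`. -/
noncomputable def slInt : SL(2, ℤ) →* SLpm :=
  (Matrix.SpecialLinearGroup.mapGL ℝ).codRestrict SLpm fun g => by
    left
    change (Matrix.SpecialLinearGroup.map (algebraMap ℤ ℝ) g).1.det = 1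
    exact (Matrix.SpecialLinearGroup.map (algebraMap ℤ ℝ) g).2

/-- Every element of `SL^±(2, ℝ)` can be moved into the Siegel set by `SL(2, ℤ)`. -/
theorem exists_mul_mem_siegelSet (h : SLpm) : ∃ g : SL(2, ℤ), slInt g * h ∈ siegelSet := by
  obtain ⟨g, hg1, hg2⟩ := ModularGroup.exists_smul_mem_fd ((h : GL (Fin 2) ℝ) • UpperHalfPlane.I)
  have e : g • (h : GL (Fin 2) ℝ) • UpperHalfPlane.I =
      ((slInt g * h : SLpm) : GL (Fin 2) ℝ) • UpperHalfPlane.I := by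
    rw [Subgroup.coe_mul, mul_smul]
    rfl
  rw [e] at hg1 hg2
  rw [re_smul_I] at hg2
  rw [Complex.normSq_apply] at hg1
  change 1 ≤ UpperHalfPlane.re _ * UpperHalfPlane.re _ +
    UpperHalfPlane.im _ * UpperHalfPlane.im _ at hg1
  rw [re_smul_I, im_smul_I] at hg1
  have hpos := slIm_pos (slInt g * h)
  rw [abs_le] at hg2
  refine ⟨g, ⟨by linarith [hg2.1], hg2.2⟩, ?_⟩
  -- In the standard fundamental domain |z| ≥ 1 and |Re z| ≤ 1/2, so (Im z)² ≥ 3/4.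
  by_contra! hlt
  nlinarith [hg2.1, hg2.2]

theorem slInt_mem_slCongruenceTwo {g : SL(2, ℤ)}
    (hg : Matrix.SpecialLinearGroup.map (Int.castRingHom (ZMod 2)) g = 1) :
    slInt g ∈ slCongruenceTwo := by
  refine Subgroup.mem_subgroupOf.2 ⟨g, ?_, ?_⟩
  · refine MonoidHom.mem_ker.2 ?_
    ext i j
    have := congrArg (fun x : SL(2, ZMod 2) => x.1 i j) hg
    simpa using this
  · ext i j
    rfl

/-- The congruence two subgroup is a lattice. -/
theorem isLatticeSubgroup_slCongruenceTwo : IsLatticeSubgroup slCongruenceTwo := by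
  let _ : MeasurableSpace SLpm := borel SLpm
  have : BorelSpace SLpm := ⟨rfl⟩
  refine ⟨inferInstance, ?_⟩
  set μ : Measure SLpm := Measure.haar
  set φ := Matrix.SpecialLinearGroup.map (n := Fin 2) (Int.castRingHom (ZMod 2)) with hφ
  -- Lifts are required only for residues in the image of SL(2, ℤ), so surjectivity of the reduction
  -- plays no role.
  have hr : ∀ q : SL(2, ZMod 2), ∃ r : SL(2, ℤ), q ∈ φ.range → φ r = q := by
    intro q
    by_cases hq : q ∈ φ.range
    · obtain ⟨r, hr⟩ := hq
      exact ⟨r, fun _ => hr⟩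
    · exact ⟨1, fun h => absurd h hq⟩
  choose r hr using hr
  set D : Set SLpm := ⋃ q : SL(2, ZMod 2), (slInt (r q) * ·) ⁻¹' siegelSet with hD
  have hDm : MeasurableSet D := MeasurableSet.iUnion fun q =>
    measurable_const_mul _ measurableSet_siegelSet
  -- `D` is a finite union of translates of the Siegel set, one for each residue class modulo 2. If
  -- `g` moves `h` into the Siegel set, then g = r · γ with `r` the chosen lift of its residue and γ
  -- congruent to 1, so γ moves `h` into `D`.
  obtain ⟨F, hF, hfund⟩ := exists_isFundamentalDomain_subset slCongruenceTwo μ hDm fun h => by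
    obtain ⟨g, hg⟩ := exists_mul_mem_siegelSet h
    have hmem : slInt ((r (φ g))⁻¹ * g) ∈ slCongruenceTwo := by
      apply slInt_mem_slCongruenceTwo
      rw [← hφ, map_mul, map_inv, hr (φ g) ⟨g, rfl⟩, inv_mul_cancel]
    refine ⟨⟨_, hmem⟩, Set.mem_iUnion.2 ⟨φ g, ?_⟩⟩
    change slInt (r (φ g)) * (slInt ((r (φ g))⁻¹ * g) * h) ∈ siegelSet
    rwa [← mul_assoc, ← map_mul, mul_inv_cancel_left]
  refine ⟨μ, F, inferInstance, hfund, (measure_mono hF).trans_lt ?_⟩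
  refine (measure_iUnion_le _).trans_lt ?_
  simp_rw [measure_preimage_mul]
  rw [tsum_fintype]
  exact ENNReal.sum_lt_top.2 fun _ _ => measure_siegelSet_lt_top μ

theorem mainTheorem2 :
    (∀ c : ℝ, 1 ≤ c →
      (∀ g ∈ ({-1, genA, genB, genC c} : Set (GL (Fin 2) ℝ)), orderOf g = 2) ∧
      (surfS c).veechGroup =
        (Subgroup.closure ({-1, genA, genB, genC c} : Set (GL (Fin 2) ℝ)) :
          Set (GL (Fin 2) ℝ))) ∧
    (surfS 1).veechGroup = (congruenceTwo : Set (GL (Fin 2) ℝ)) ∧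
    HasLatticeProperty (surfS 1) := by
  have h1 : (surfS 1).veechGroup = (congruenceTwo : Set (GL (Fin 2) ℝ)) := by
    rw [veechGroup_eq_genGroup le_rfl, genGroup_one]
  refine ⟨fun c hc => ⟨orderOf_gen hc, veechGroup_eq_genGroup hc⟩, h1,
    slCongruenceTwo, ?_, isLatticeSubgroup_slCongruenceTwo⟩
  rw [h1, slCongruenceTwo, Subgroup.map_subgroupOf_eq_of_le congruenceTwo_le_SLpm]
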